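/- All algebras are unital associative algebras over $\mathbb{C}$. Number the rows and columns of $3\times 3$ matrices by $-1,0,1$ and let $$P=\sum_{i,j} e_{ij}\otimes e_{ji},\qquad Q=\sum_{i,j} e_{ij}\otimes e_{-i,-j},\qquad R(u)=1-\frac{P}{u}+\frac{Q}{u-1/2}.$$ The extended Yangian $\mathrm{X}(\mathfrak{o}_3)$ is the algebra with generators $t_{ij}^{(r)}$, $i,j\in\{-1,0,1\}$, $r\ge 1$, and defining relations $$R(u-v)\,T_1(u)\,T_2(v)=T_2(v)\,T_1(u)\,R(u-v),$$ where $T(u)=(t_{ij}(u))$, $t_{ij}(u)=\delta_{ij}+\sum_{r\ge1}t_{ij}^{(r)}u^{-r}$, $T_1(u)=\sum e_{ij}\otimes 1\otimes t_{ij}(u)$ and $T_2(u)=\sum 1\otimes e_{ij}\otimes t_{ij}(u)$. The Yangian $\mathrm{Y}(\mathfrak{o}_3)$ is the subalgebra of $\mathrm{X}(\mathfrak{o}_3)$ of all elements stable under all automorphisms $T(u)\mapsto f(u)\,T(u)$, $f(u)\in 1+u^{-1}\mathbb{C}[[u^{-1}]]$. The Yangian $\mathrm{Y}(\mathfrak{gl}_2)$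 is the algebra with generators $T_{ij}^{(r)}$, $i,j\in\{1,2\}$, $r\ge1$, and defining relations $$[T^{(r+1)}_{ij}, T^{(s)}_{kl}]-[T^{(r)}_{ij}, T^{(s+1)}_{kl}]=T^{(r)}_{kj} T^{(s)}_{il}-T^{(s)}_{kj} T^{(r)}_{il},\qquad r,s\ge0,\quad T^{(0)}_{ij}=\delta_{ij}.$$ Put $T^\circ(u)=\big(\sum_{r\ge0}T_{ij}^{(r)}u^{-r}\big)_{i,j}$. The Yangian $\mathrm{Y}(\mathfrak{sl}_2)$ is the subalgebra of $\mathrm{Y}(\mathfrak{gl}_2)$ of all elements stable under all automorphisms $T^\circ(u)\mapsto g(u)\,T^\circ(u)$, $g(u)\in 1+u^{-1}\mathbb{C}[[u^{-1}]]$. Let $V\subset\mathbb{C}^2\otimes\mathbb{C}^2$ be the subspace with the basis $$v_{-1}=e_1\otimes e_1,\qquad v_0=\tfrac{1}{\sqrt2}(e_1\otimes e_2+e_2\otimes e_1),\qquad v_1=-e_2\otimes e_2.$$ **Statement.** There is an algebra isomorphism $\phi:\mathrm{X}(\mathfrak{o}_3)\to\mathrm{Y}(\mathfrak{gl}_2)$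 given by $$T(u)\mapsto \frac{1+P}{2}\cdot T^\circ_1(2u)\,T^\circ_2(2u+1),$$ where $P$ on the right hand side is the permutation operator on $\mathbb{C}^2\otimes\mathbb{C}^2$, series in $(2u)^{-1}$ and $(2u+1)^{-1}$ are expanded in $u^{-1}$, and the right hand side is regarded as an element of $\operatorname{End}V\otimes\mathrm{Y}(\mathfrak{gl}_2)[[u^{-1}]]$, that is, as a $3\times3$ matrix in the basis $v_{-1},v_0,v_1$. The restriction of $\phi$ to $\mathrm{Y}(\mathfrak{o}_3)$ is an algebra isomorphism $\mathrm{Y}(\mathfrak{o}_3)\to\mathrm{Y}(\mathfrak{sl}_2)$. -/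

import Mathlib

open scoped Kronecker PowerSeries

noncomputable section

namespace LowRankYangian

/-! Formal series in `u⁻¹` over a (noncommutative) algebra `A` are modelled by `A⟦X⟧`, the variable
`X` standing for `u⁻¹`. Formal series in `u⁻¹, v⁻¹` are modelled by `A⟦X⟧⟦X⟧`: the inner variable
is `u⁻¹` and the outer one is `v⁻¹`. -/

section Series

variable {A : Type*} [Ring A]

/-- `f ↦ f(u)`, a series in one variable regarded as a series in `u⁻¹, v⁻¹`. -/
def serU : A⟦X⟧ →+* A⟦X⟧⟦X⟧ := PowerSeries.C

/-- `f ↦ f(v)`, a series in one variable regarded as a series in `u⁻¹, v⁻¹`. -/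
def serV : A⟦X⟧ →+* A⟦X⟧⟦X⟧ := PowerSeries.map PowerSeries.C

variable [Algebra ℂ A]

/-- A scalar series regarded as a series with coefficients in `A`. -/
def scalarSeries : ℂ⟦X⟧ →+* A⟦X⟧ := PowerSeries.map (algebraMap ℂ A)

/-- A scalar series in two variables regarded as a series with coefficients in `A`. -/
def scalarSeries₂ : ℂ⟦X⟧⟦X⟧ →+* A⟦X⟧⟦X⟧ := PowerSeries.map scalarSeries

/-- The expansion of `(c u + a)⁻¹ = u⁻¹ / (c + a u⁻¹)` as a series in `u⁻¹` (for `c ≠ 0`). -/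
def affineInv (c a : ℂ) : ℂ⟦X⟧ :=
  PowerSeries.X * (PowerSeries.C c + PowerSeries.C a * PowerSeries.X)⁻¹

/-- The series `f(c u + a) = ∑ f_r (c u + a)⁻ʳ` in `u⁻¹` (for `c ≠ 0`). The sum giving the
coefficient of `u⁻ⁿ` stops at `r = n` because `(c u + a)⁻ʳ` is divisible by `u⁻ʳ`. -/
def affineSubst (c a : ℂ) (f : A⟦X⟧) : A⟦X⟧ :=
  PowerSeries.mk fun n =>
    ∑ r ∈ Finset.range (n + 1),
      PowerSeries.coeff n (affineInv c a ^ r) • PowerSeries.coeff r f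

/-- The subalgebra of `A` of all elements stable under all automorphisms of `A` of the form
`T(u) ↦ f(u) T(u)` with `f(u) ∈ 1 + u⁻¹ ℂ[[u⁻¹]]`. -/
def multInvariants {N : ℕ} (T : Matrix (Fin N) (Fin N) A⟦X⟧) : Subalgebra ℂ A where
  carrier := {a | ∀ (f : ℂ⟦X⟧) (σ : A ≃ₐ[ℂ] A), PowerSeries.constantCoeff f = 1 →
    (∀ i j, PowerSeries.map (σ : A →+* A) (T i j) = scalarSeries f * T i j) → σ a = a}
  mul_mem' := fun ha hb f σ hf h => by rw [map_mul, ha f σ hf h, hb f σ hf h]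
  add_mem' := fun ha hb f σ hf h => by rw [map_add, ha f σ hf h, hb f σ hf h]
  algebraMap_mem' := fun c _ σ _ _ => σ.commutes c

end Series

section Operators

variable {S : Type*} [Ring S] (N : ℕ)

/-- The permutation operator `P = ∑ e_ij ⊗ e_ji` on `S^N ⊗ S^N`. -/
def permOp : Matrix (Fin N × Fin N) (Fin N × Fin N) S :=
  ∑ i, ∑ j, Matrix.single i j 1 ⊗ₖ Matrix.single j i 1

/-- The operator `Q = ∑ e_ij ⊗ e_{-i,-j}`. The rows and columns, numbered by `-n, …, n` in
increasing order, are numbered here by `Fin N`, so that `i ↦ -i` becomes `Fin.rev`. -/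
def transOp : Matrix (Fin N × Fin N) (Fin N × Fin N) S :=
  ∑ i : Fin N, ∑ j : Fin N, Matrix.single i j 1 ⊗ₖ Matrix.single i.rev j.rev 1

end Operators

section Generators

variable (N : ℕ)

/-- The free algebra on symbols `t_ij^(r)`, `r ≥ 1`; the triple `(i, j, r)` is `t_ij^(r+1)`. -/
abbrev FreeGen : Type := FreeAlgebra ℂ (Fin N × Fin N × ℕ)

/-- The element `t_ij^(r)` of the free algebra, with `t_ij^(0) = δ_ij`. -/
def freeT (i j : Fin N) : ℕ → FreeGen N
  | 0 => if i = j then 1 else 0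
  | r + 1 => FreeAlgebra.ι ℂ (i, j, r)

/-- The matrix `T(u)` with the entries `t_ij(u) = ∑ t_ij^(r) u⁻ʳ` over the free algebra. -/
def freeMatrix : Matrix (Fin N) (Fin N) (FreeGen N)⟦X⟧ :=
  Matrix.of fun i j => PowerSeries.mk (freeT N i j)

end Generators

/-! ### The extended Yangian of the orthogonal Lie algebra -/

section Orthogonal

variable (N : ℕ)

/-- `κ = N/2 - 1`. -/
def kappa : ℂ := (N : ℂ) / 2 - 1

/-- `u⁻¹ v⁻¹` -/
def invUV : ℂ⟦X⟧⟦X⟧ := PowerSeries.C PowerSeries.X * PowerSeries.X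

/-- `u⁻¹ v⁻¹ (u - v) = v⁻¹ - u⁻¹` -/
def invUVDiff : ℂ⟦X⟧⟦X⟧ := PowerSeries.X - PowerSeries.C PowerSeries.X

/-- `u⁻¹ v⁻¹ (u - v - κ)` -/
def invUVDiffKappa : ℂ⟦X⟧⟦X⟧ := invUVDiff - kappa N • invUV

/-- The `R`-matrix `R(u - v) = 1 - P / (u - v) + Q / (u - v - κ)` with denominators cleared, that
is, multiplied by the scalar `u⁻² v⁻² (u - v) (u - v - κ)`. Multiplication by this scalar is
injective on series, so that clearing denominators does not change the `RTT`-relation. -/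
def clearedR : Matrix (Fin N × Fin N) (Fin N × Fin N) ℂ⟦X⟧⟦X⟧ :=
  (invUVDiff * invUVDiffKappa N) • 1 - (invUV * invUVDiffKappa N) • permOp N
    + (invUV * invUVDiff) • transOp N

variable {N} in
/-- `R(u - v) T₁(u) T₂(v)`, denominators cleared. -/
def rttLeft {A : Type*} [Ring A] [Algebra ℂ A] (T : Matrix (Fin N) (Fin N) A⟦X⟧) :
    Matrix (Fin N × Fin N) (Fin N × Fin N) A⟦X⟧⟦X⟧ :=
  (clearedR N).map scalarSeries₂ * (T.map serU ⊗ₖ 1) * (1 ⊗ₖ T.map serV)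

variable {N} in
/-- `T₂(v) T₁(u) R(u - v)`, denominators cleared. -/
def rttRight {A : Type*} [Ring A] [Algebra ℂ A] (T : Matrix (Fin N) (Fin N) A⟦X⟧) :
    Matrix (Fin N × Fin N) (Fin N × Fin N) A⟦X⟧⟦X⟧ :=
  (1 ⊗ₖ T.map serV) * (T.map serU ⊗ₖ 1) * (clearedR N).map scalarSeries₂

/-- The defining relations of `X(o_N)`: the coefficients of `u⁻ʳ v⁻ˢ` in the matrix entries
of both sides of `R(u - v) T₁(u) T₂(v) = T₂(v) T₁(u) R(u - v)` are equal. -/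
inductive RttRel : FreeGen N → FreeGen N → Prop
  | mk (a b : Fin N × Fin N) (r s : ℕ) :
      RttRel
        (PowerSeries.coeff r (PowerSeries.coeff s (rttLeft (freeMatrix N) a b)))
        (PowerSeries.coeff r (PowerSeries.coeff s (rttRight (freeMatrix N) a b)))

/-- The extended Yangian `X(o_N)`. -/
def ExtYangianO : Type := RingQuot (RttRel N)

instance : Ring (ExtYangianO N) := inferInstanceAs (Ring (RingQuot (RttRel N)))

instance : Algebra ℂ (ExtYangianO N) := inferInstanceAs (Algebra ℂ (RingQuot (RttRel N)))

/-- The quotient map from the free algebra onto `X(o_N)`. -/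
def ExtYangianO.proj : FreeGen N →ₐ[ℂ] ExtYangianO N := RingQuot.mkAlgHom ℂ (RttRel N)

/-- The generator matrix `T(u)` of `X(o_N)`. -/
def ExtYangianO.T : Matrix (Fin N) (Fin N) (ExtYangianO N)⟦X⟧ :=
  (freeMatrix N).map (PowerSeries.map (ExtYangianO.proj N : FreeGen N →+* ExtYangianO N))

/-- The Yangian `Y(o_N)`: the elements of `X(o_N)` stable under all `T(u) ↦ f(u) T(u)`. -/
def YangianO : Subalgebra ℂ (ExtYangianO N) := multInvariants (ExtYangianO.T N)

end Orthogonal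

/-! ### The Yangians of `gl_N` and `sl_N` -/

section GeneralLinear

variable (N : ℕ)

/-- The defining relations of `Y(gl_N)`:
`[T_ij^(r+1), T_kl^(s)] - [T_ij^(r), T_kl^(s+1)] = T_kj^(r) T_il^(s) - T_kj^(s) T_il^(r)`
for all `r, s ≥ 0`. -/
inductive GlRel : FreeGen N → FreeGen N → Prop
  | mk (i j k l : Fin N) (r s : ℕ) :
      GlRel
        (⁅freeT N i j (r + 1), freeT N k l s⁆ - ⁅freeT N i j r, freeT N k l (s + 1)⁆)
        (freeT N k j r * freeT N i l s - freeT N k j s * freeT N i l r)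

/-- The Yangian `Y(gl_N)`. -/
def YangianGL : Type := RingQuot (GlRel N)

instance : Ring (YangianGL N) := inferInstanceAs (Ring (RingQuot (GlRel N)))

instance : Algebra ℂ (YangianGL N) := inferInstanceAs (Algebra ℂ (RingQuot (GlRel N)))

/-- The quotient map from the free algebra onto `Y(gl_N)`. -/
def YangianGL.proj : FreeGen N →ₐ[ℂ] YangianGL N := RingQuot.mkAlgHom ℂ (GlRel N)

/-- The generator matrix `T°(u)` of `Y(gl_N)`. -/
def YangianGL.T : Matrix (Fin N) (Fin N) (YangianGL N)⟦X⟧ :=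
  (freeMatrix N).map (PowerSeries.map (YangianGL.proj N : FreeGen N →+* YangianGL N))

/-- The Yangian `Y(sl_N)`: the elements of `Y(gl_N)` stable under all `T°(u) ↦ g(u) T°(u)`. -/
def YangianSL : Subalgebra ℂ (YangianGL N) := multInvariants (YangianGL.T N)

end GeneralLinear

/-! ### The fusion map -/

section Fusion

/-- The vectors `v₋₁ = e₁ ⊗ e₁`, `v₀ = (e₁ ⊗ e₂ + e₂ ⊗ e₁) / √2`, `v₁ = - e₂ ⊗ e₂` of `ℂ² ⊗ ℂ²`,
numbered by `0, 1, 2 : Fin 3`; here `e₁, e₂` are numbered by `0, 1 : Fin 2`. -/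
def symVec : Fin 3 → (Fin 2 × Fin 2 → ℂ) :=
  ![Pi.single (0, 0) 1,
    ((Real.sqrt 2 : ℝ) : ℂ)⁻¹ • (Pi.single (0, 1) 1 + Pi.single (1, 0) 1),
    -Pi.single (1, 1) 1]

/-- The matrix whose columns are `v₋₁, v₀, v₁`: the embedding of `ℂ³` onto the subspace
`V = span (v₋₁, v₀, v₁)` of `ℂ² ⊗ ℂ²`, with scalars regarded as constant series over `A`. -/
def symEmb (A : Type*) [Ring A] [Algebra ℂ A] : Matrix (Fin 2 × Fin 2) (Fin 3) A⟦X⟧ :=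
  Matrix.of fun p a => algebraMap ℂ A⟦X⟧ (symVec a p)

/-- The operator `(1 + P)/2 · T°₁(2u) T°₂(2u+1)` on `ℂ² ⊗ ℂ²`, with entries in
`Y(gl_2)[[u⁻¹]]`. -/
def fusedOp : Matrix (Fin 2 × Fin 2) (Fin 2 × Fin 2) (YangianGL 2)⟦X⟧ :=
  ((2⁻¹ : ℂ) • (1 + permOp 2)) *
    ((YangianGL.T 2).map (affineSubst 2 0) ⊗ₖ 1) *
    (1 ⊗ₖ (YangianGL.T 2).map (affineSubst 2 1))

/-- `M` is the matrix, in the basis `v₋₁, v₀, v₁`, of the operator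
`(1 + P)/2 · T°₁(2u) T°₂(2u+1)` regarded as an operator on the subspace `V` of `ℂ² ⊗ ℂ²`. -/
def IsFusedMatrix (M : Matrix (Fin 3) (Fin 3) (YangianGL 2)⟦X⟧) : Prop :=
  fusedOp * symEmb (YangianGL 2) = symEmb (YangianGL 2) * M

end Fusion

end LowRankYangian

end

noncomputable section

namespace LowRankYangian

/-! ### Affine changes of the spectral parameter -/

section Affine

variable {A : Type*} [Ring A] [Algebra ℂ A]

/-! The homomorphism is the fusion procedure. When the two arguments differ by -1, the R-matrix of
`gl_2` is 1 + P. Therefore (1 + P) T°₁(2u) T°₂(2u+1) kills antisymmetric tensors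
(`IsGLMatrix.fused_symm`). The product of the four `gl_2` exchange operators between the pair (2u,
2u+1) and the pair (2v, 2v+1) acts on symmetrized tensors as the R-matrix of `o_3`, up to a scalar
that can be cancelled (`symPart₂_exchange`). Moving the four matrices through this product gives the
RTT relation for the fused matrix (`IsGLMatrix.isExtYangianMatrix`).

Bijectivity is shown without a PBW theorem, by constructing the inverse. With indices 0, 1, 2, the
relations of `X(o_3)` between T_00, T_01, T_10, and those of T_00 with T_11, do not involve Q. A
Gauss decomposition therefore gives currents e, f, h subject to relations of type `gl_2`. Comparison
with the Gauss decomposition of the fused matrix suggests how to recover the factors a, E, F, K of a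
`Y(gl_2)` matrix: a(2u) a(2u+1) = T_00(u), E(2u+1) = e(u)/√2, F(2u+1) = f(u)/√2, K(2u+1) = h(u). The
first equation has exactly one solution with constant term 1, found coefficient by coefficient
(`exists_fused_eq`, `fused_injective`).

The point is to carry the relations over to a, E, F, K. Write e(u) = J(1/(u - S)), where J is the
linear functional S^r ↦ e_{r+1}. The relation between T_00 and e then becomes an intertwining
relation J(P) T_00 = T_00 J(P g) with g = (u - 1 - S)/(u - S). Since g(u) = γ(2u) γ(2u+1) for the
analogous γ with 1 + 2S in place of S (`fused_ratio`), the intertwining property has a "square root"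
for a (`left_intertwine_of_fused`). The commutators of e with f depend only on products of moments,
so they survive the substitution S ↦ 1 + 2S. The Q-part of the relations, taken at u = v + 1,
expresses T_02 and T_20 through T_00, e, f (`corner_upper`, `corner_lower`), and this yields
Serre-type relations. Together with the action of the level-one generators, four of the sixteen
`gl_2` relations imply the rest (`IsCovariant.relations`).

Both composites are the identity, because a homomorphism is determined by the image of the first
matrix entry and of two level-one generators (the two `map_eq` lemmas). The same lemmas show that
multiplication by g on `Y(gl_2)` corresponds to multiplication by g(2u) g(2u+1) on `X(o_3)`. Since
every scalar series with constant term 1 has this form, the two fixed subalgebras correspond. -/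

theorem coeff_affineInv_pow_of_lt (c a : ℂ) {n r : ℕ} (h : n < r) :
    PowerSeries.coeff n (affineInv c a ^ r) = 0 := by
  unfold affineInv
  rw [mul_pow, PowerSeries.coeff_X_pow_mul', if_neg (by omega)]

theorem coeff_affineSubst (c a : ℂ) (f : A⟦X⟧) (n : ℕ) :
    PowerSeries.coeff n (affineSubst c a f) = ∑ r ∈ Finset.range (n + 1),
      PowerSeries.coeff n (affineInv c a ^ r) • PowerSeries.coeff r f := by
  simp [affineSubst]

theorem coeff_affineSubst_of_lt (c a : ℂ) (f : A⟦X⟧) {n N : ℕ} (h : n < N) :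
    PowerSeries.coeff n (affineSubst c a f) = ∑ r ∈ Finset.range N,
      PowerSeries.coeff n (affineInv c a ^ r) • PowerSeries.coeff r f := by
  rw [coeff_affineSubst]
  refine Finset.sum_subset (by simpa using by omega) fun r _ hr => ?_
  rw [coeff_affineInv_pow_of_lt c a (by simpa using hr), zero_smul]

/-- Substitution respects products because (cu + a)⁻ⁱ (cu + a)⁻ʲ = (cu + a)⁻⁽ⁱ⁺ʲ⁾. The work lies in
the truncation: the product side sums over a square of index pairs, the substituted product over a
triangle. -/
theorem affineSubst_mul (c a : ℂ) (f g : A⟦X⟧) :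
    affineSubst c a (f * g) = affineSubst c a f * affineSubst c a g := by
  ext n
  have key : ∀ i j, PowerSeries.coeff n (affineInv c a ^ (i + j)) =
      ∑ p ∈ Finset.HasAntidiagonal.antidiagonal n, PowerSeries.coeff p.1 (affineInv c a ^ i) *
        PowerSeries.coeff p.2 (affineInv c a ^ j) := fun i j => by
    rw [pow_add, PowerSeries.coeff_mul]
  have hR : PowerSeries.coeff n (affineSubst c a f * affineSubst c a g) =
      ∑ q ∈ Finset.range (n + 1) ×ˢ Finset.range (n + 1),
        PowerSeries.coeff n (affineInv c a ^ (q.1 + q.2)) •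
          (PowerSeries.coeff q.1 f * PowerSeries.coeff q.2 g) := by
    simp only [key, Finset.sum_smul]
    rw [Finset.sum_comm, PowerSeries.coeff_mul]
    refine Finset.sum_congr rfl fun p hp => ?_
    have hp' := Finset.HasAntidiagonal.mem_antidiagonal.1 hp
    rw [coeff_affineSubst_of_lt c a f (show p.1 < n + 1 by omega),
      coeff_affineSubst_of_lt c a g (show p.2 < n + 1 by omega), Finset.sum_mul_sum,
      Finset.sum_product]
    refine Finset.sum_congr rfl fun i _ => Finset.sum_congr rfl fun j _ => ?_
    rw [smul_mul_smul_comm]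
  have hL : PowerSeries.coeff n (affineSubst c a (f * g)) =
      ∑ r ∈ Finset.range (n + 1), ∑ q ∈ Finset.HasAntidiagonal.antidiagonal r,
        PowerSeries.coeff n (affineInv c a ^ (q.1 + q.2)) •
          (PowerSeries.coeff q.1 f * PowerSeries.coeff q.2 g) := by
    rw [coeff_affineSubst]
    refine Finset.sum_congr rfl fun r _ => ?_
    rw [PowerSeries.coeff_mul, Finset.smul_sum]
    refine Finset.sum_congr rfl fun q hq => ?_
    rw [Finset.HasAntidiagonal.mem_antidiagonal.1 hq]
  rw [hL, hR]
  have h1 : ∀ q ∈ (Finset.range (n + 1) ×ˢ Finset.range (n + 1)).filter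
      (fun q => q.1 + q.2 ∈ Finset.range (n + 1)), q.1 + q.2 ∈ Finset.range (n + 1) :=
    fun q hq => (Finset.mem_filter.1 hq).2
  -- Pairs with i + j > n contribute nothing to the coefficient of u⁻ⁿ, so the square reduces to the
  -- triangle, which is then sliced by i + j.
  rw [← Finset.sum_filter_of_ne (p := fun q : ℕ × ℕ => q.1 + q.2 ∈ Finset.range (n + 1)),
    ← Finset.sum_fiberwise_of_maps_to h1]
  · refine Finset.sum_congr rfl fun r hr => Finset.sum_congr ?_ fun _ _ => rfl
    ext q
    simp only [Finset.HasAntidiagonal.mem_antidiagonal, Finset.mem_filter, Finset.mem_product, Finset.mem_range]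
      at hr ⊢
    omega
  · intro q _ hq
    by_contra hlt
    apply hq
    rw [coeff_affineInv_pow_of_lt c a (by simpa using hlt), zero_smul]

/-- `f(u) ↦ f(c u + a)` as a homomorphism of algebras. -/
def aff (c a : ℂ) : A⟦X⟧ →+* A⟦X⟧ where
  toFun := affineSubst c a
  map_mul' := affineSubst_mul c a
  map_one' := by
    ext n
    rw [coeff_affineSubst, Finset.sum_eq_single 0] <;>
      simp +contextual [PowerSeries.coeff_one]
  map_zero' := by ext n; simp [coeff_affineSubst]
  map_add' f g := by ext n; simp [coeff_affineSubst, Finset.sum_add_distrib]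

theorem aff_apply (c a : ℂ) (f : A⟦X⟧) : aff c a f = affineSubst c a f := rfl

theorem coeff_aff (c a : ℂ) (f : A⟦X⟧) (n : ℕ) :
    PowerSeries.coeff n (aff c a f) = ∑ r ∈ Finset.range (n + 1),
      PowerSeries.coeff n (affineInv c a ^ r) • PowerSeries.coeff r f :=
  coeff_affineSubst c a f n

theorem aff_C (c a : ℂ) (x : A) : aff c a (PowerSeries.C x) = PowerSeries.C x := by
  ext n
  rw [coeff_aff, Finset.sum_eq_single 0]
  · simp [PowerSeries.coeff_one, PowerSeries.coeff_C]
  · intro b _ hb; simp [PowerSeries.coeff_C, hb]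
  · simp

/-- Naturality of affine substitutions with respect to coefficientwise linear maps. -/
theorem coeff_aff_linear {B : Type*} [Ring B] [Algebra ℂ B] (c a : ℂ) (J : A →ₗ[ℂ] B)
    (f : A⟦X⟧) (n : ℕ) :
    PowerSeries.coeff n (aff c a (PowerSeries.mk fun k => J (PowerSeries.coeff k f))) =
      J (PowerSeries.coeff n (aff c a f)) := by
  simp [coeff_aff, map_sum]

theorem map_aff {B : Type*} [Ring B] [Algebra ℂ B] (c a : ℂ) (σ : A →ₐ[ℂ] B) (f : A⟦X⟧) :
    PowerSeries.map (σ : A →+* B) (aff c a f) = aff c a (PowerSeries.map (σ : A →+* B) f) := by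
  ext n
  simp [coeff_aff, map_sum]

theorem aff_scalarSeries (c a : ℂ) (f : ℂ⟦X⟧) :
    aff c a (scalarSeries f : A⟦X⟧) = scalarSeries (aff c a f) :=
  (map_aff c a (Algebra.ofId ℂ A) f).symm

theorem aff_X_scalar (c a : ℂ) : aff c a (PowerSeries.X : ℂ⟦X⟧) = affineInv c a := by
  ext n
  rw [coeff_aff]
  rcases Nat.eq_zero_or_pos n with rfl | h
  · simp [affineInv]
  · rw [Finset.sum_eq_single 1]
    · simp
    · intro b _ hb; simp [PowerSeries.coeff_X, hb]
    · intro h'; simp at h'; omega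

theorem scalarSeries_X : (scalarSeries PowerSeries.X : A⟦X⟧) = PowerSeries.X :=
  PowerSeries.map_X _

theorem aff_X (c a : ℂ) : aff c a (PowerSeries.X : A⟦X⟧) = scalarSeries (affineInv c a) := by
  rw [← scalarSeries_X, aff_scalarSeries, aff_X_scalar]

theorem scalarSeries_commute (s : ℂ⟦X⟧) (f : A⟦X⟧) : Commute (scalarSeries s) f := by
  ext n
  rw [PowerSeries.coeff_mul, PowerSeries.coeff_mul, ← Finset.Nat.sum_antidiagonal_swap]
  refine Finset.sum_congr rfl fun p _ => ?_
  simp [scalarSeries, Algebra.commutes]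

end Affine

/-! ### Series in two variables and cancellation of scalar factors -/

section TwoVariables

variable {A : Type*} [Ring A] [Algebra ℂ A]

theorem scalarSeries₂_commute (s : ℂ⟦X⟧⟦X⟧) (F : A⟦X⟧⟦X⟧) : Commute (scalarSeries₂ s) F := by
  ext1 n
  rw [PowerSeries.coeff_mul, PowerSeries.coeff_mul, ← Finset.Nat.sum_antidiagonal_swap]
  refine Finset.sum_congr rfl fun p _ => ?_
  simp only [scalarSeries₂, PowerSeries.coeff_map, Prod.fst_swap, Prod.snd_swap]
  exact scalarSeries_commute _ _

/-- Series in two variables as an algebra over the scalar series in two variables. -/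
abbrev seriesAlgebra₂ : Algebra ℂ⟦X⟧⟦X⟧ A⟦X⟧⟦X⟧ :=
  RingHom.toAlgebra' scalarSeries₂ fun s F => scalarSeries₂_commute s F

attribute [local instance] seriesAlgebra₂

theorem smul_eq_scalarSeries₂_mul (s : ℂ⟦X⟧⟦X⟧) (F : A⟦X⟧⟦X⟧) :
    s • F = scalarSeries₂ s * F := rfl

theorem scalarSeries₂_X :
    (scalarSeries₂ PowerSeries.X : A⟦X⟧⟦X⟧) = PowerSeries.X := PowerSeries.map_X _

theorem scalarSeries₂_C (p : ℂ⟦X⟧) :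
    (scalarSeries₂ (PowerSeries.C p) : A⟦X⟧⟦X⟧) = PowerSeries.C (scalarSeries p) :=
  PowerSeries.map_C _ _

theorem invUV_smul (F : A⟦X⟧⟦X⟧) :
    (invUV : ℂ⟦X⟧⟦X⟧) • F = PowerSeries.C PowerSeries.X * (PowerSeries.X * F) := by
  rw [smul_eq_scalarSeries₂_mul, invUV, map_mul, scalarSeries₂_X, scalarSeries₂_C,
    scalarSeries_X, mul_assoc]

theorem coeff_coeff_invUV_smul (F : A⟦X⟧⟦X⟧) (r s : ℕ) :
    PowerSeries.coeff (r + 1) (PowerSeries.coeff (s + 1) ((invUV : ℂ⟦X⟧⟦X⟧) • F)) =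
      PowerSeries.coeff r (PowerSeries.coeff s F) := by
  rw [invUV_smul, PowerSeries.coeff_C_mul, PowerSeries.coeff_succ_X_mul,
    PowerSeries.coeff_succ_X_mul]

theorem coeff_zero_left_invUV_smul (F : A⟦X⟧⟦X⟧) (s : ℕ) :
    PowerSeries.coeff 0 (PowerSeries.coeff s ((invUV : ℂ⟦X⟧⟦X⟧) • F)) = 0 := by
  rw [invUV_smul, PowerSeries.coeff_C_mul, PowerSeries.coeff_zero_X_mul]

theorem coeff_zero_right_invUV_smul (F : A⟦X⟧⟦X⟧) :
    PowerSeries.coeff 0 ((invUV : ℂ⟦X⟧⟦X⟧) • F) = 0 := by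
  rw [invUV_smul, PowerSeries.coeff_C_mul, PowerSeries.coeff_zero_X_mul, mul_zero]

theorem diff_smul (p : ℂ⟦X⟧) (F : A⟦X⟧⟦X⟧) :
    (PowerSeries.X * PowerSeries.C p - PowerSeries.C PowerSeries.X : ℂ⟦X⟧⟦X⟧) • F =
      PowerSeries.X * (PowerSeries.C (scalarSeries p) * F)
        - PowerSeries.C PowerSeries.X * F := by
  rw [smul_eq_scalarSeries₂_mul, map_sub, map_mul, scalarSeries₂_X, scalarSeries₂_C,
    scalarSeries₂_C, scalarSeries_X, sub_mul, mul_assoc]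

/-- Multiplication by `v⁻¹ p(u⁻¹) - u⁻¹` is injective. -/
theorem diff_smul_cancel (p : ℂ⟦X⟧) {F : A⟦X⟧⟦X⟧}
    (h : (PowerSeries.X * PowerSeries.C p - PowerSeries.C PowerSeries.X : ℂ⟦X⟧⟦X⟧) • F = 0) :
    F = 0 := by
  rw [diff_smul] at h
  ext1 n
  rw [map_zero]
  induction n with
  | zero =>
    have h0 := congrArg (PowerSeries.coeff 0) h
    rw [map_sub, PowerSeries.coeff_zero_X_mul, PowerSeries.coeff_C_mul, map_zero, zero_sub,
      neg_eq_zero] at h0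
    exact PowerSeries.X_mul_cancel (h0.trans (mul_zero _).symm)
  | succ n ih =>
    have h0 := congrArg (PowerSeries.coeff (n + 1)) h
    rw [map_sub, PowerSeries.coeff_succ_X_mul, PowerSeries.coeff_C_mul, PowerSeries.coeff_C_mul,
      ih, mul_zero, map_zero, zero_sub, neg_eq_zero] at h0
    exact PowerSeries.X_mul_cancel (h0.trans (mul_zero _).symm)

theorem invUVDiff_eq : invUVDiff =
    PowerSeries.X * PowerSeries.C 1 - PowerSeries.C PowerSeries.X := by
  simp [invUVDiff]

/-- Puts the cleared factor u - v - c into the shape handled by `diff_smul_cancel`. It is needed for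
c = κ and for c = 1. -/
theorem invUVDiff_sub_smul_eq (c : ℂ) : invUVDiff - c • invUV =
    PowerSeries.X * PowerSeries.C (1 - c • PowerSeries.X) - PowerSeries.C PowerSeries.X := by
  rw [invUVDiff, invUV, map_sub, map_one, mul_sub, mul_one, PowerSeries.X_mul (φ := PowerSeries.C _),
    ← smul_mul_assoc]
  have : (PowerSeries.C (c • PowerSeries.X) : ℂ⟦X⟧⟦X⟧) = c • PowerSeries.C PowerSeries.X := by
    ext n m
    simp only [PowerSeries.coeff_smul, PowerSeries.coeff_C]
    split_ifs <;> simp [*]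
  rw [this]
  ring

theorem invUVDiff_smul_cancel {F : A⟦X⟧⟦X⟧} (h : (invUVDiff : ℂ⟦X⟧⟦X⟧) • F = 0) : F = 0 := by
  rw [invUVDiff_eq] at h; exact diff_smul_cancel 1 h

theorem invUVDiff_sub_smul_cancel (c : ℂ) {F : A⟦X⟧⟦X⟧}
    (h : (invUVDiff - c • invUV : ℂ⟦X⟧⟦X⟧) • F = 0) : F = 0 := by
  rw [invUVDiff_sub_smul_eq] at h; exact diff_smul_cancel _ h

theorem coeff_invUVDiff_smul (F : A⟦X⟧⟦X⟧) (r s : ℕ) :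
    PowerSeries.coeff (r + 1) (PowerSeries.coeff (s + 1) ((invUVDiff : ℂ⟦X⟧⟦X⟧) • F)) =
      PowerSeries.coeff (r + 1) (PowerSeries.coeff s F) -
        PowerSeries.coeff r (PowerSeries.coeff (s + 1) F) := by
  rw [invUVDiff_eq, diff_smul]
  simp [PowerSeries.coeff_C_mul, PowerSeries.coeff_succ_X_mul]

theorem coeff_zero_left_invUVDiff_smul (F : A⟦X⟧⟦X⟧) (s : ℕ) :
    PowerSeries.coeff 0 (PowerSeries.coeff (s + 1) ((invUVDiff : ℂ⟦X⟧⟦X⟧) • F)) =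
      PowerSeries.coeff 0 (PowerSeries.coeff s F) := by
  rw [invUVDiff_eq, diff_smul, map_sub, map_sub, PowerSeries.coeff_C_mul,
    PowerSeries.coeff_succ_X_mul, PowerSeries.coeff_zero_X_mul]
  simp

theorem coeff_zero_right_invUVDiff_smul (F : A⟦X⟧⟦X⟧) (r : ℕ) :
    PowerSeries.coeff (r + 1) (PowerSeries.coeff 0 ((invUVDiff : ℂ⟦X⟧⟦X⟧) • F)) =
      - PowerSeries.coeff r (PowerSeries.coeff 0 F) := by
  rw [invUVDiff_eq, diff_smul, map_sub, map_sub, PowerSeries.coeff_C_mul,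
    PowerSeries.coeff_zero_X_mul, PowerSeries.coeff_succ_X_mul, map_zero, zero_sub]

theorem coeff_zero_zero_invUVDiff_smul (F : A⟦X⟧⟦X⟧) :
    PowerSeries.coeff 0 (PowerSeries.coeff 0 ((invUVDiff : ℂ⟦X⟧⟦X⟧) • F)) = 0 := by
  rw [invUVDiff_eq, diff_smul, map_sub, map_sub, PowerSeries.coeff_C_mul,
    PowerSeries.coeff_zero_X_mul, PowerSeries.coeff_zero_X_mul, map_zero, sub_zero]

theorem coeff_coeff_serU_mul_serV {A : Type*} [Ring A] (f g : A⟦X⟧) (r s : ℕ) :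
    PowerSeries.coeff r (PowerSeries.coeff s (serU f * serV g)) =
      PowerSeries.coeff r f * PowerSeries.coeff s g := by
  simp [serU, serV, PowerSeries.coeff_C_mul, PowerSeries.coeff_mul_C]

theorem coeff_coeff_serV_mul_serU {A : Type*} [Ring A] (f g : A⟦X⟧) (r s : ℕ) :
    PowerSeries.coeff r (PowerSeries.coeff s (serV g * serU f)) =
      PowerSeries.coeff s g * PowerSeries.coeff r f := by
  simp [serU, serV, PowerSeries.coeff_C_mul, PowerSeries.coeff_mul_C]

end TwoVariables

/-! ### Exchange, diagonal and substitution in two variables -/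

section Homs

open Finset.HasAntidiagonal (antidiagonal)

/-- Exchange of the two variables. -/
def swapUV {A : Type*} [Ring A] : A⟦X⟧⟦X⟧ →+* A⟦X⟧⟦X⟧ where
  toFun F := PowerSeries.mk fun s => PowerSeries.mk fun r =>
    PowerSeries.coeff s (PowerSeries.coeff r F)
  map_one' := by
    ext s r
    simp only [PowerSeries.coeff_mk, PowerSeries.coeff_one]
    split_ifs <;> simp [PowerSeries.coeff_one, *]
  map_zero' := by ext; simp
  map_add' F G := by ext; simp
  map_mul' F G := by
    ext s r
    simp only [PowerSeries.coeff_mk, PowerSeries.coeff_mul, map_sum]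
    rw [Finset.sum_comm]

theorem coeff_coeff_swapUV {A : Type*} [Ring A] (F : A⟦X⟧⟦X⟧) (r s : ℕ) :
    PowerSeries.coeff r (PowerSeries.coeff s (swapUV F)) =
      PowerSeries.coeff s (PowerSeries.coeff r F) := by
  simp [swapUV]

theorem swapUV_serU {A : Type*} [Ring A] (f : A⟦X⟧) : swapUV (serU f) = serV f := by
  ext s r
  rw [coeff_coeff_swapUV]
  simp only [serU, serV, PowerSeries.coeff_C, PowerSeries.coeff_map]
  split_ifs <;> simp

theorem swapUV_serV {A : Type*} [Ring A] (f : A⟦X⟧) : swapUV (serV f) = serU f := by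
  ext s r
  rw [coeff_coeff_swapUV]
  simp only [serU, serV, PowerSeries.coeff_C, PowerSeries.coeff_map]
  split_ifs <;> simp

variable {A : Type*} [Ring A] [Algebra ℂ A]

theorem swapUV_scalarSeries₂ (s : ℂ⟦X⟧⟦X⟧) :
    swapUV (scalarSeries₂ s : A⟦X⟧⟦X⟧) = scalarSeries₂ (swapUV s) := by
  ext n m
  rw [coeff_coeff_swapUV]
  simp [scalarSeries₂, scalarSeries, coeff_coeff_swapUV]

theorem swapUV_X : swapUV (PowerSeries.X : ℂ⟦X⟧⟦X⟧) = PowerSeries.C PowerSeries.X := by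
  rw [show (PowerSeries.X : ℂ⟦X⟧⟦X⟧) = serV PowerSeries.X from (PowerSeries.map_X _).symm,
    swapUV_serV]; rfl

theorem swapUV_C_X : swapUV (PowerSeries.C PowerSeries.X : ℂ⟦X⟧⟦X⟧) = PowerSeries.X :=
  (swapUV_serU _).trans (PowerSeries.map_X _)

theorem swapUV_invUV : swapUV invUV = invUV := by
  rw [invUV, map_mul, swapUV_X, swapUV_C_X, mul_comm]

theorem swapUV_invUVDiff : swapUV invUVDiff = -invUVDiff := by
  rw [invUVDiff, map_sub, swapUV_X, swapUV_C_X, neg_sub]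

/-- The diagonal `F(u, v) ↦ F(u, u)`. -/
def diagUV {A : Type*} [Ring A] : A⟦X⟧⟦X⟧ →+* A⟦X⟧ where
  toFun F := PowerSeries.mk fun n => ∑ p ∈ antidiagonal n,
    PowerSeries.coeff p.1 (PowerSeries.coeff p.2 F)
  map_one' := by
    ext n
    simp only [PowerSeries.coeff_mk, PowerSeries.coeff_one]
    rw [Finset.sum_eq_single (n, 0)]
    · simp [PowerSeries.coeff_one]
    · rintro ⟨a, b⟩ hab hne
      have : b ≠ 0 := by
        rintro rfl
        rw [Finset.HasAntidiagonal.mem_antidiagonal] at hab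
        exact hne (by ext <;> simp_all)
      simp [this]
    · intro h; simp at h
  map_zero' := by ext; simp
  map_add' F G := by ext; simp [Finset.sum_add_distrib]
  map_mul' F G := by
    ext n
    simp only [PowerSeries.coeff_mk, PowerSeries.coeff_mul, map_sum, Finset.sum_mul_sum]
    simp only [Finset.sum_sigma']
    -- Both sides run over quadruples of exponents. The bijection regroups them from "by variable"
    -- to "by factor".
    refine Finset.sum_nbij'
      (fun x => ⟨(x.2.2.1 + x.2.1.1, x.2.2.2 + x.2.1.2), ⟨(x.2.2.1, x.2.1.1), (x.2.2.2, x.2.1.2)⟩⟩)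
      (fun x => ⟨(x.2.1.1 + x.2.2.1, x.2.1.2 + x.2.2.2), ⟨(x.2.1.2, x.2.2.2), (x.2.1.1, x.2.2.1)⟩⟩)
      ?_ ?_ ?_ ?_ ?_
    · rintro ⟨⟨a, b⟩, ⟨c, d⟩, ⟨e, f⟩⟩ h
      simp only [Finset.mem_sigma, Finset.HasAntidiagonal.mem_antidiagonal] at h ⊢
      refine ⟨?_, trivial, trivial⟩
      omega
    · rintro ⟨⟨a, b⟩, ⟨c, d⟩, ⟨e, f⟩⟩ h
      simp only [Finset.mem_sigma, Finset.HasAntidiagonal.mem_antidiagonal] at h ⊢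
      refine ⟨?_, trivial, trivial⟩
      omega
    · rintro ⟨⟨a, b⟩, ⟨c, d⟩, ⟨e, f⟩⟩ h
      simp only [Finset.mem_sigma, Finset.HasAntidiagonal.mem_antidiagonal] at h
      obtain ⟨h1, rfl, rfl⟩ := h
      rfl
    · rintro ⟨⟨a, b⟩, ⟨c, d⟩, ⟨e, f⟩⟩ h
      simp only [Finset.mem_sigma, Finset.HasAntidiagonal.mem_antidiagonal] at h
      obtain ⟨h1, rfl, rfl⟩ := h
      rfl
    · rintro ⟨⟨a, b⟩, ⟨c, d⟩, ⟨e, f⟩⟩ h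
      rfl

theorem coeff_diagUV {A : Type*} [Ring A] (F : A⟦X⟧⟦X⟧) (n : ℕ) : PowerSeries.coeff n (diagUV F) =
    ∑ p ∈ antidiagonal n, PowerSeries.coeff p.1 (PowerSeries.coeff p.2 F) := by
  simp [diagUV]

theorem diagUV_serU {A : Type*} [Ring A] (f : A⟦X⟧) : diagUV (serU f) = f := by
  ext n
  rw [coeff_diagUV, Finset.sum_eq_single (n, 0)]
  · simp [serU]
  · rintro ⟨a, b⟩ hab hne
    have : b ≠ 0 := by
      rintro rfl
      rw [Finset.HasAntidiagonal.mem_antidiagonal] at hab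
      exact hne (by ext <;> simp_all)
    simp [serU, PowerSeries.coeff_C, this]
  · intro h; simp at h

theorem diagUV_swapUV {A : Type*} [Ring A] (F : A⟦X⟧⟦X⟧) : diagUV (swapUV F) = diagUV F := by
  ext n
  rw [coeff_diagUV, coeff_diagUV, ← Finset.Nat.sum_antidiagonal_swap]
  exact Finset.sum_congr rfl fun p _ => coeff_coeff_swapUV _ _ _

theorem diagUV_serV {A : Type*} [Ring A] (f : A⟦X⟧) : diagUV (serV f) = f := by
  rw [← swapUV_serU, diagUV_swapUV, diagUV_serU]

theorem diagUV_scalarSeries₂ (s : ℂ⟦X⟧⟦X⟧) :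
    diagUV (scalarSeries₂ s : A⟦X⟧⟦X⟧) = scalarSeries (diagUV s) := by
  ext n
  simp [scalarSeries₂, scalarSeries, coeff_diagUV]

/-- The substitution `F(u, v) ↦ F(c u + a, c' v + a')`. -/
def subUV (c a c' a' : ℂ) : A⟦X⟧⟦X⟧ →+* A⟦X⟧⟦X⟧ :=
  (aff c' a').comp (PowerSeries.map (aff c a))

theorem subUV_serU (c a c' a' : ℂ) (f : A⟦X⟧) :
    subUV c a c' a' (serU f) = serU (aff c a f) := by
  simp [subUV, serU, aff_C]

theorem subUV_serV (c a c' a' : ℂ) (f : A⟦X⟧) :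
    subUV c a c' a' (serV f) = serV (aff c' a' f) := by
  have h : PowerSeries.map (aff c a) (serV f) = serV f := by
    ext1 n
    simp [serV, aff_C]
  rw [subUV, RingHom.comp_apply, h]
  ext1 n
  simp only [serV, coeff_aff, PowerSeries.coeff_map, map_sum]
  refine Finset.sum_congr rfl fun r _ => ?_
  ext m
  simp only [PowerSeries.coeff_smul, PowerSeries.coeff_C]
  split_ifs <;> simp

theorem subUV_scalarSeries₂ (c a c' a' : ℂ) (s : ℂ⟦X⟧⟦X⟧) :
    subUV c a c' a' (scalarSeries₂ s : A⟦X⟧⟦X⟧) = scalarSeries₂ (subUV c a c' a' s) := by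
  ext n m
  simp only [subUV, scalarSeries₂, RingHom.comp_apply, PowerSeries.coeff_map, coeff_aff, map_sum]
  refine Finset.sum_congr rfl fun r _ => ?_
  rw [aff_scalarSeries, PowerSeries.coeff_smul]
  simp [scalarSeries, Algebra.smul_def]

/-- The specialisation `F(u, v) ↦ F(c u + a, c' u + a')`. -/
def specUV (c a c' a' : ℂ) : A⟦X⟧⟦X⟧ →+* A⟦X⟧ := diagUV.comp (subUV c a c' a')

theorem specUV_serU (c a c' a' : ℂ) (f : A⟦X⟧) :
    specUV c a c' a' (serU f) = aff c a f := by
  rw [specUV, RingHom.comp_apply, subUV_serU, diagUV_serU]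

theorem specUV_serV (c a c' a' : ℂ) (f : A⟦X⟧) :
    specUV c a c' a' (serV f) = aff c' a' f := by
  rw [specUV, RingHom.comp_apply, subUV_serV, diagUV_serV]

theorem specUV_scalarSeries₂ (c a c' a' : ℂ) (s : ℂ⟦X⟧⟦X⟧) :
    specUV c a c' a' (scalarSeries₂ s : A⟦X⟧⟦X⟧) = scalarSeries (specUV c a c' a' s) := by
  rw [specUV, RingHom.comp_apply, subUV_scalarSeries₂, diagUV_scalarSeries₂]; rfl

end Homs

/-! ### Lowest-order terms and the equation x(2u) x(2u+1) = f(u) -/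

section Truncation

variable {A : Type*} [Ring A]

theorem coeff_mul_eq_zero_of_left {n : ℕ} {z : A⟦X⟧} (h : ∀ m < n, PowerSeries.coeff m z = 0)
    (w : A⟦X⟧) : ∀ m < n, PowerSeries.coeff m (z * w) = 0 := by
  rw [← PowerSeries.X_pow_dvd_iff] at h ⊢
  exact h.mul_right w

theorem coeff_mul_eq_zero_of_right {n : ℕ} {z : A⟦X⟧} (h : ∀ m < n, PowerSeries.coeff m z = 0)
    (w : A⟦X⟧) : ∀ m < n, PowerSeries.coeff m (w * z) = 0 := by
  rw [← PowerSeries.X_pow_dvd_iff] at h ⊢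
  obtain ⟨z', rfl⟩ := h
  exact ⟨w * z', by rw [← mul_assoc, ← mul_assoc, PowerSeries.X_pow_mul]⟩

theorem coeff_mul_of_left {n : ℕ} {z : A⟦X⟧} (h : ∀ m < n, PowerSeries.coeff m z = 0)
    (w : A⟦X⟧) : PowerSeries.coeff n (z * w) =
      PowerSeries.coeff n z * PowerSeries.constantCoeff w := by
  rw [← PowerSeries.X_pow_dvd_iff] at h
  obtain ⟨z', rfl⟩ := h
  rw [mul_assoc, PowerSeries.coeff_X_pow_mul', PowerSeries.coeff_X_pow_mul', if_pos le_rfl,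
    if_pos le_rfl, Nat.sub_self]
  simp

theorem coeff_mul_of_right {n : ℕ} {z : A⟦X⟧} (h : ∀ m < n, PowerSeries.coeff m z = 0)
    (w : A⟦X⟧) : PowerSeries.coeff n (w * z) =
      PowerSeries.constantCoeff w * PowerSeries.coeff n z := by
  rw [← PowerSeries.X_pow_dvd_iff] at h
  obtain ⟨z', rfl⟩ := h
  rw [← mul_assoc, ← PowerSeries.X_pow_mul, mul_assoc, PowerSeries.coeff_X_pow_mul',
    PowerSeries.coeff_X_pow_mul', if_pos le_rfl, if_pos le_rfl, Nat.sub_self]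
  simp

variable [Algebra ℂ A]

theorem coeff_affineInv_pow_self (c a : ℂ) (n : ℕ) :
    PowerSeries.coeff n (affineInv c a ^ n) = (c ^ n)⁻¹ := by
  unfold affineInv
  rw [mul_pow, PowerSeries.coeff_X_pow_mul', if_pos le_rfl, Nat.sub_self,
    PowerSeries.coeff_zero_eq_constantCoeff_apply, map_pow, PowerSeries.constantCoeff_inv]
  simp

theorem coeff_aff_eq_zero (c a : ℂ) {n : ℕ} {z : A⟦X⟧}
    (h : ∀ m < n, PowerSeries.coeff m z = 0) :
    ∀ m < n, PowerSeries.coeff m (aff c a z) = 0 := by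
  intro m hm
  rw [coeff_aff]
  refine Finset.sum_eq_zero fun r hr => ?_
  rw [h r (by simp at hr; omega), smul_zero]

theorem coeff_aff_leading (c a : ℂ) {n : ℕ} {z : A⟦X⟧}
    (h : ∀ m < n, PowerSeries.coeff m z = 0) :
    PowerSeries.coeff n (aff c a z) = (c ^ n)⁻¹ • PowerSeries.coeff n z := by
  rw [coeff_aff, Finset.sum_range_succ, coeff_affineInv_pow_self]
  rw [Finset.sum_eq_zero, zero_add]
  intro r hr
  rw [h r (by simpa using hr), smul_zero]

theorem constantCoeff_aff (c a : ℂ) (f : A⟦X⟧) :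
    PowerSeries.constantCoeff (aff c a f) = PowerSeries.constantCoeff f := by
  rw [← PowerSeries.coeff_zero_eq_constantCoeff_apply, coeff_aff]
  simp

theorem coeff_one_aff (c a : ℂ) (f : A⟦X⟧) :
    PowerSeries.coeff 1 (aff c a f) = c⁻¹ • PowerSeries.coeff 1 f := by
  rw [coeff_aff, Finset.sum_range_succ, Finset.sum_range_one, coeff_affineInv_pow_self]
  simp [PowerSeries.coeff_one]

theorem half_smul_cancel {n : ℕ} {t : A} (h : ((2 : ℂ) ^ n)⁻¹ • t + ((2 : ℂ) ^ n)⁻¹ • t = 0) :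
    t = 0 := by
  rw [← add_smul, ← two_mul] at h
  exact (smul_eq_zero_iff_right (mul_ne_zero two_ne_zero
    (inv_ne_zero (pow_ne_zero n two_ne_zero)))).1 h

/-- The product `x(2u) x(2u+1)`. -/
def fused (x : A⟦X⟧) : A⟦X⟧ := aff 2 0 x * aff 2 1 x

theorem fused_sub (x y : A⟦X⟧) :
    fused x - fused y = aff 2 0 (x - y) * aff 2 1 x + aff 2 0 y * aff 2 1 (x - y) := by
  simp only [fused, map_sub]
  noncomm_ring

/-- Each of the two factors contributes 2⁻ⁿ times the first difference of x and y. Fusing is thus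
triangular with the invertible diagonal entry 2 · 2⁻ⁿ, which gives injectivity and surjectivity on
series with constant term 1, even over a noncommutative algebra. -/
theorem coeff_fused_sub {x y : A⟦X⟧} (hx : PowerSeries.constantCoeff x = 1)
    (hy : PowerSeries.constantCoeff y = 1) {n : ℕ}
    (h : ∀ m < n, PowerSeries.coeff m (x - y) = 0) :
    (∀ m < n, PowerSeries.coeff m (fused x - fused y) = 0) ∧
      PowerSeries.coeff n (fused x - fused y) = ((2 : ℂ) ^ n)⁻¹ • PowerSeries.coeff n (x - y) +
        ((2 : ℂ) ^ n)⁻¹ • PowerSeries.coeff n (x - y) := by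
  rw [fused_sub]
  constructor
  · intro m hm
    rw [map_add, coeff_mul_eq_zero_of_left (coeff_aff_eq_zero 2 0 h) _ m hm,
      coeff_mul_eq_zero_of_right (coeff_aff_eq_zero 2 1 h) _ m hm, add_zero]
  · rw [map_add, coeff_mul_of_left (coeff_aff_eq_zero 2 0 h),
      coeff_mul_of_right (coeff_aff_eq_zero 2 1 h), constantCoeff_aff, constantCoeff_aff, hx, hy,
      coeff_aff_leading 2 0 h, coeff_aff_leading 2 1 h, mul_one, one_mul]

theorem fused_injective {x y : A⟦X⟧} (hx : PowerSeries.constantCoeff x = 1)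
    (hy : PowerSeries.constantCoeff y = 1) (h : fused x = fused y) : x = y := by
  rw [← sub_eq_zero]
  ext n
  induction n using Nat.strong_induction_on with
  | _ n ih =>
    have := (coeff_fused_sub hx hy (n := n) fun m hm => by simpa using ih m hm).2
    rw [h, sub_self, map_zero] at this
    simpa using half_smul_cancel this.symm

theorem exists_fused_eq (f : A⟦X⟧) (hf : PowerSeries.constantCoeff f = 1) :
    ∃ x : A⟦X⟧, PowerSeries.constantCoeff x = 1 ∧ fused x = f := by
  let Good (n : ℕ) (s : A⟦X⟧) : Prop := PowerSeries.constantCoeff s = 1 ∧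
    ∀ m < n + 1, PowerSeries.coeff m (f - fused s) = 0
  have step : ∀ n s, Good n s → ∃ s', Good (n + 1) s' ∧
      ∀ m < n + 1, PowerSeries.coeff m (s' - s) = 0 := by
    rintro n s ⟨h1, h2⟩
    -- The factor inverts the diagonal entry 2 · 2⁻⁽ⁿ⁺¹⁾ of `coeff_fused_sub`.
    set t : A := ((2 : ℂ) ^ (n + 1) * 2⁻¹) • PowerSeries.coeff (n + 1) (f - fused s)
    have hw : ∀ m < n + 1,
        PowerSeries.coeff m ((s + PowerSeries.C t * PowerSeries.X ^ (n + 1)) - s) = 0 := by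
      intro m hm
      rw [add_sub_cancel_left, PowerSeries.coeff_C_mul_X_pow, if_neg (by omega)]
    have h1' : PowerSeries.constantCoeff (s + PowerSeries.C t * PowerSeries.X ^ (n + 1)) = 1 := by
      simp [h1]
    obtain ⟨hlt, hn⟩ := coeff_fused_sub h1' h1 hw
    refine ⟨_, ⟨h1', fun m hm => ?_⟩, hw⟩
    rw [← sub_sub_sub_cancel_right f _ (fused s), map_sub]
    rcases Nat.lt_succ_iff_lt_or_eq.1 hm with hm | rfl
    · rw [h2 m hm, hlt m hm, sub_zero]
    · rw [hn, add_sub_cancel_left, PowerSeries.coeff_C_mul_X_pow, if_pos rfl, smul_smul, ← add_smul,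
        ← mul_assoc, inv_mul_cancel₀ (pow_ne_zero _ two_ne_zero), one_mul, ← two_mul,
        mul_inv_cancel₀ two_ne_zero, one_smul, sub_self]
  choose! F hF hF' using step
  let s : ℕ → A⟦X⟧ := fun n => Nat.rec 1 (fun n s => F n s) n
  have hs : ∀ n, Good n (s n) := by
    intro n
    induction n with
    | zero =>
      refine ⟨map_one _, fun m hm => ?_⟩
      obtain rfl : m = 0 := by omega
      simp [s, hf, fused]
    | succ n ih => exact hF n _ ih
  have hstab : ∀ m n, m ≤ n → PowerSeries.coeff m (s n) = PowerSeries.coeff m (s m) := by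
    intro m n hmn
    induction n, hmn using Nat.le_induction with
    | base => rfl
    | succ n hmn ih =>
      rw [← ih, ← sub_eq_zero, ← map_sub]
      exact hF' n _ (hs n) m (by omega)
  refine ⟨PowerSeries.mk fun n => PowerSeries.coeff n (s n), ?_, ?_⟩
  · rw [PowerSeries.constantCoeff_mk]; simp [s]
  · have h1 : PowerSeries.constantCoeff
        (PowerSeries.mk fun n => PowerSeries.coeff n (s n) : A⟦X⟧) = 1 := by
      rw [PowerSeries.constantCoeff_mk]; simp [s]
    ext n
    have := (coeff_fused_sub h1 (hs n).1 (n := n + 1) fun m hm => by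
      rw [map_sub, PowerSeries.coeff_mk, hstab m n (by omega), sub_self]).1 n (by omega)
    rw [map_sub, sub_eq_zero] at this
    rw [this, eq_comm, ← sub_eq_zero, ← map_sub]
    exact (hs n).2 n (by omega)

/-- The solution `x` of `x(2u) x(2u+1) = f(u)` has its coefficients in every subalgebra that
contains the coefficients of `f`. -/
theorem exists_fused_eq_mem (f : A⟦X⟧) (hf : PowerSeries.constantCoeff f = 1)
    (K : Subalgebra ℂ A) (hK : ∀ n, PowerSeries.coeff n f ∈ K) :
    ∃ x : A⟦X⟧, PowerSeries.constantCoeff x = 1 ∧ fused x = f ∧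
      ∀ n, PowerSeries.coeff n x ∈ K := by
  -- The equation is solved over the subalgebra itself, and the solution is pushed forward along the
  -- inclusion.
  obtain ⟨x, h1, h2⟩ := exists_fused_eq (A := K) (PowerSeries.mk fun n => ⟨_, hK n⟩)
    (Subtype.ext (by simpa using hf))
  refine ⟨PowerSeries.map (K.val : K →+* A) x, ?_, ?_, fun n => by simp⟩
  · rw [← PowerSeries.coeff_zero_eq_constantCoeff_apply, PowerSeries.coeff_map,
      PowerSeries.coeff_zero_eq_constantCoeff_apply, h1]; simp
  · rw [fused, ← map_aff, ← map_aff, ← map_mul]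
    change PowerSeries.map _ (fused x) = f
    rw [h2]
    ext n
    simp

end Truncation

/-! ### Square roots of intertwining relations -/

section Intertwiner

open Polynomial in
/-- A linear map applied to the coefficients of a series. -/
def coeffwise {A : Type*} [Ring A] [Algebra ℂ A] (J : ℂ[X] →ₗ[ℂ] A) : ℂ[X]⟦X⟧ →+ A⟦X⟧ where
  toFun P := PowerSeries.mk fun n => J (PowerSeries.coeff n P)
  map_zero' := by ext; simp
  map_add' P Q := by ext; simp

variable {A : Type*} [Ring A] [Algebra ℂ A] (J : Polynomial ℂ →ₗ[ℂ] A)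

theorem coeff_coeffwise (P : (Polynomial ℂ)⟦X⟧) (n : ℕ) :
    PowerSeries.coeff n (coeffwise J P) = J (PowerSeries.coeff n P) := by
  simp [coeffwise]

theorem coeffwise_C (p : Polynomial ℂ) :
    coeffwise J (PowerSeries.C p) = PowerSeries.C (J p) := by
  ext n
  rw [coeff_coeffwise, PowerSeries.coeff_C, PowerSeries.coeff_C]
  split_ifs <;> simp

theorem coeffwise_X_mul (P : (Polynomial ℂ)⟦X⟧) :
    coeffwise J (PowerSeries.X * P) = PowerSeries.X * coeffwise J P := by
  ext n
  rw [coeff_coeffwise]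
  cases n with
  | zero => simp
  | succ n => rw [PowerSeries.coeff_succ_X_mul, PowerSeries.coeff_succ_X_mul, coeff_coeffwise]

theorem coeffwise_aff (c a : ℂ) (P : (Polynomial ℂ)⟦X⟧) :
    coeffwise J (aff c a P) = aff c a (coeffwise J P) := by
  ext n
  rw [coeff_coeffwise]
  exact (coeff_aff_linear c a J P n).symm

theorem exists_eq_C_add_X_mul {R : Type*} [Semiring R] (P : R⟦X⟧) :
    ∃ Q, P = PowerSeries.C (PowerSeries.constantCoeff P) + PowerSeries.X * Q :=
  ⟨_, (PowerSeries.eq_X_mul_shift_add_const P).trans (add_comm _ _)⟩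

/-- The defect in `J(P) a = a J(P g)`. -/
def leftDefect (a : A⟦X⟧) (g : (Polynomial ℂ)⟦X⟧) : (Polynomial ℂ)⟦X⟧ →+ A⟦X⟧ where
  toFun P := coeffwise J P * a - a * coeffwise J (P * g)
  map_zero' := by simp
  map_add' P Q := by simp only [map_add, add_mul, mul_add]; abel

theorem leftDefect_apply (a : A⟦X⟧) (g P : (Polynomial ℂ)⟦X⟧) :
    leftDefect J a g P = coeffwise J P * a - a * coeffwise J (P * g) := rfl

theorem leftDefect_X_mul (a : A⟦X⟧) (g P : (Polynomial ℂ)⟦X⟧) :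
    leftDefect J a g (PowerSeries.X * P) = PowerSeries.X * leftDefect J a g P := by
  simp only [leftDefect_apply, mul_assoc, coeffwise_X_mul, mul_sub]
  rw [← mul_assoc a, ← PowerSeries.X_mul, mul_assoc]

theorem leftDefect_aff (c s : ℂ) (a : A⟦X⟧) (g P : (Polynomial ℂ)⟦X⟧) :
    leftDefect J (aff c s a) (aff c s g) (aff c s P) = aff c s (leftDefect J a g P) := by
  simp only [leftDefect_apply, map_sub, map_mul, ← coeffwise_aff]

/-- The defect in `a J(P) = J(P g) a`. -/
def rightDefect (a : A⟦X⟧) (g : (Polynomial ℂ)⟦X⟧) : (Polynomial ℂ)⟦X⟧ →+ A⟦X⟧ where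
  toFun P := a * coeffwise J P - coeffwise J (P * g) * a
  map_zero' := by simp
  map_add' P Q := by simp only [map_add, add_mul, mul_add]; abel

theorem rightDefect_apply (a : A⟦X⟧) (g P : (Polynomial ℂ)⟦X⟧) :
    rightDefect J a g P = a * coeffwise J P - coeffwise J (P * g) * a := rfl

theorem rightDefect_X_mul (a : A⟦X⟧) (g P : (Polynomial ℂ)⟦X⟧) :
    rightDefect J a g (PowerSeries.X * P) = PowerSeries.X * rightDefect J a g P := by
  simp only [rightDefect_apply, mul_assoc, coeffwise_X_mul, mul_sub]
  rw [← mul_assoc a, ← PowerSeries.X_mul, mul_assoc]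

theorem rightDefect_aff (c s : ℂ) (a : A⟦X⟧) (g P : (Polynomial ℂ)⟦X⟧) :
    rightDefect J (aff c s a) (aff c s g) (aff c s P) = aff c s (rightDefect J a g P) := by
  simp only [rightDefect_apply, map_sub, map_mul, ← coeffwise_aff]

/-- An additive map that commutes with multiplication by `u⁻¹` and whose values on constants are
divisible by `u⁻ⁿ` has all its values divisible by `u⁻ⁿ`. -/
theorem coeff_eq_zero_of_const {A : Type*} [Ring A] {δ : (Polynomial ℂ)⟦X⟧ →+ A⟦X⟧}
    (hX : ∀ P, δ (PowerSeries.X * P) = PowerSeries.X * δ P) {n : ℕ}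
    (h : ∀ p, ∀ m < n, PowerSeries.coeff m (δ (PowerSeries.C p)) = 0)
    (P : (Polynomial ℂ)⟦X⟧) : ∀ m < n, PowerSeries.coeff m (δ P) = 0 := by
  have : ∀ m, ∀ P, m < n → PowerSeries.coeff m (δ P) = 0 := by
    intro m
    induction m with
    | zero =>
      intro P hm
      obtain ⟨Q, hQ⟩ := exists_eq_C_add_X_mul P
      rw [hQ, map_add, map_add, hX, PowerSeries.coeff_zero_X_mul, h _ _ hm, add_zero]
    | succ m ih =>
      intro P hm
      obtain ⟨Q, hQ⟩ := exists_eq_C_add_X_mul P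
      rw [hQ, map_add, map_add, hX, PowerSeries.coeff_succ_X_mul, h _ _ hm, ih Q (by omega),
        add_zero]
  exact fun m hm => this m P hm

theorem eq_zero_of_const {A : Type*} [Ring A] {δ : (Polynomial ℂ)⟦X⟧ →+ A⟦X⟧}
    (hX : ∀ P, δ (PowerSeries.X * P) = PowerSeries.X * δ P)
    (h : ∀ p, δ (PowerSeries.C p) = 0) (P : (Polynomial ℂ)⟦X⟧) : δ P = 0 := by
  ext m
  exact coeff_eq_zero_of_const hX (n := m + 1) (fun p m _ => by rw [h, map_zero]) P m (by omega)

/-- Induction step for extracting the square root of an intertwining relation. -/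
theorem coeff_eq_zero_of_fused {δ δ₁ : (Polynomial ℂ)⟦X⟧ →+ A⟦X⟧} {g : (Polynomial ℂ)⟦X⟧}
    (hX : ∀ P, δ (PowerSeries.X * P) = PowerSeries.X * δ P)
    (hX₁ : ∀ P, δ₁ (PowerSeries.X * P) = PowerSeries.X * δ₁ P)
    (h₁ : ∀ p, δ₁ (PowerSeries.C p) = aff 2 1 (δ (PowerSeries.C p)))
    (hg : PowerSeries.constantCoeff g = 1)
    (hδ : ∀ p n, (∀ P, ∀ m < n, PowerSeries.coeff m (δ P) = 0) →
      PowerSeries.coeff n (aff 2 0 (δ (PowerSeries.C p))) +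
        PowerSeries.coeff n (δ₁ (PowerSeries.C p * g)) = 0)
    (P : (Polynomial ℂ)⟦X⟧) : δ P = 0 := by
  refine eq_zero_of_const hX (fun p => ?_) P
  ext n
  revert p
  induction n using Nat.strong_induction_on with
  | _ n ih =>
    intro p
    have hlt : ∀ P, ∀ m < n, PowerSeries.coeff m (δ P) = 0 := coeff_eq_zero_of_const hX
      fun p m hm => by simpa using ih m hm p
    have hlt₁ : ∀ P, ∀ m < n, PowerSeries.coeff m (δ₁ P) = 0 := coeff_eq_zero_of_const hX₁
      fun p m hm => by rw [h₁]; exact coeff_aff_eq_zero 2 1 (hlt _) m hm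
    -- As g has constant term 1 and `δ₁` vanishes below order n, the factor g does not affect the
    -- coefficient of order n. What remains is 2 · 2⁻ⁿ times the coefficient of `δ` on a constant.
    obtain ⟨Q, hQ⟩ := exists_eq_C_add_X_mul g
    have hzero : PowerSeries.coeff n (PowerSeries.X * δ₁ (PowerSeries.C p * Q)) = 0 := by
      cases n with
      | zero => simp
      | succ n => rw [PowerSeries.coeff_succ_X_mul]; exact hlt₁ _ n (by omega)
    have := hδ p n hlt
    rw [hQ, hg, map_one, mul_add, mul_one, ← mul_assoc, ← PowerSeries.X_mul, mul_assoc, map_add,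
      hX₁, map_add, hzero, add_zero, h₁, coeff_aff_leading 2 0 (hlt _),
      coeff_aff_leading 2 1 (hlt _)] at this
    simpa using half_smul_cancel this

/-- The defect δ obeys a Leibniz rule: for the product a(2u) a(2u+1) it is δ(P)(2u) a(2u+1) + a(2u)
δ₁(P g(2u)), where δ₁ is the defect of a(2u+1). If δ vanishes below order n, the coefficient of
order n of this sum is twice 2⁻ⁿ δₙ, so δₙ = 0 as well. -/
theorem left_intertwine_of_fused {a : A⟦X⟧} {g : (Polynomial ℂ)⟦X⟧}
    (ha : PowerSeries.constantCoeff a = 1) (hg : PowerSeries.constantCoeff g = 1)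
    (h : ∀ P, coeffwise J P * fused a = fused a * coeffwise J (P * fused g))
    (P : (Polynomial ℂ)⟦X⟧) : coeffwise J P * a = a * coeffwise J (P * g) := by
  rw [← sub_eq_zero, ← leftDefect_apply]
  refine coeff_eq_zero_of_fused (leftDefect_X_mul J a g)
    (leftDefect_X_mul J (aff 2 1 a) (aff 2 1 g)) (fun p => ?_) (g := aff 2 0 g)
    (by rw [constantCoeff_aff, hg]) (fun p n hlt => ?_) P
  · rw [← leftDefect_aff, aff_C]
  · have hzero : aff 2 0 (leftDefect J a g (PowerSeries.C p)) * aff 2 1 a +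
        aff 2 0 a * leftDefect J (aff 2 1 a) (aff 2 1 g) (PowerSeries.C p * aff 2 0 g) = 0 := by
      rw [← leftDefect_aff, aff_C, leftDefect_apply, leftDefect_apply, sub_mul, mul_assoc, mul_sub]
      have := h (PowerSeries.C p)
      rw [fused, fused] at this
      rw [this]
      simp only [mul_assoc]
      abel
    have hlt₁ : ∀ P, ∀ m < n, PowerSeries.coeff m
        (leftDefect J (aff 2 1 a) (aff 2 1 g) P) = 0 :=
      coeff_eq_zero_of_const (leftDefect_X_mul J _ _) fun p m hm => by
        have := leftDefect_aff J 2 1 a g (PowerSeries.C p)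
        rw [aff_C] at this
        rw [this]
        exact coeff_aff_eq_zero 2 1 (hlt _) m hm
    have := congrArg (PowerSeries.coeff n) hzero
    rwa [map_add, coeff_mul_of_left (coeff_aff_eq_zero 2 0 (hlt _)),
      coeff_mul_of_right (hlt₁ _), constantCoeff_aff, constantCoeff_aff, ha, mul_one, one_mul,
      map_zero] at this

/-- The mirror argument. The commutation hypothesis lets a(2u) meet J(P) first, so that the same
induction applies. -/
theorem right_intertwine_of_fused {a : A⟦X⟧} {g : (Polynomial ℂ)⟦X⟧}
    (hcomm : aff 2 0 a * aff 2 1 a = aff 2 1 a * aff 2 0 a)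
    (ha : PowerSeries.constantCoeff a = 1) (hg : PowerSeries.constantCoeff g = 1)
    (h : ∀ P, fused a * coeffwise J P = coeffwise J (P * fused g) * fused a)
    (P : (Polynomial ℂ)⟦X⟧) : a * coeffwise J P = coeffwise J (P * g) * a := by
  rw [← sub_eq_zero, ← rightDefect_apply]
  refine coeff_eq_zero_of_fused (rightDefect_X_mul J a g)
    (rightDefect_X_mul J (aff 2 1 a) (aff 2 1 g)) (fun p => ?_) (g := aff 2 0 g)
    (by rw [constantCoeff_aff, hg]) (fun p n hlt => ?_) P
  · rw [← rightDefect_aff, aff_C]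
  · have hzero : aff 2 1 a * aff 2 0 (rightDefect J a g (PowerSeries.C p)) +
        rightDefect J (aff 2 1 a) (aff 2 1 g) (PowerSeries.C p * aff 2 0 g) * aff 2 0 a = 0 := by
      rw [← rightDefect_aff, aff_C, rightDefect_apply, rightDefect_apply, sub_mul]
      have := h (PowerSeries.C p)
      rw [fused, fused, hcomm] at this
      rw [mul_sub, ← mul_assoc, this]
      simp only [mul_assoc]
      abel
    have hlt₁ : ∀ P, ∀ m < n, PowerSeries.coeff m
        (rightDefect J (aff 2 1 a) (aff 2 1 g) P) = 0 :=
      coeff_eq_zero_of_const (rightDefect_X_mul J _ _) fun p m hm => by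
        have := rightDefect_aff J 2 1 a g (PowerSeries.C p)
        rw [aff_C] at this
        rw [this]
        exact coeff_aff_eq_zero 2 1 (hlt _) m hm
    have := congrArg (PowerSeries.coeff n) hzero
    rwa [map_add, coeff_mul_of_right (coeff_aff_eq_zero 2 0 (hlt _)),
      coeff_mul_of_left (hlt₁ _), constantCoeff_aff, constantCoeff_aff, ha, mul_one, one_mul,
      map_zero] at this

end Intertwiner

attribute [local instance] seriesAlgebra₂

/-! ### The RTT relation entry by entry -/

section Entries

theorem permOp_apply {S : Type*} [Ring S] (N : ℕ) (i k p q : Fin N) :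
    (permOp N : Matrix _ _ S) (i, k) (p, q) = if k = p then if i = q then 1 else 0 else 0 := by
  simp only [permOp, Matrix.sum_apply, Matrix.kroneckerMap_apply, Matrix.single_apply]
  rw [Finset.sum_eq_single i, Finset.sum_eq_single k]
  · by_cases h1 : k = p <;> by_cases h2 : i = q <;> simp [h1, h2]
  · intro b _ hb; simp [hb]
  · simp
  · intro b _ hb; simp [hb]
  · simp

theorem transOp_apply {S : Type*} [Ring S] (N : ℕ) (i k p q : Fin N) :
    (transOp N : Matrix _ _ S) (i, k) (p, q) =
      if k = i.rev then if q = p.rev then 1 else 0 else 0 := by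
  simp only [transOp, Matrix.sum_apply, Matrix.kroneckerMap_apply, Matrix.single_apply]
  rw [Finset.sum_eq_single i, Finset.sum_eq_single p]
  · by_cases h1 : k = i.rev <;> by_cases h2 : q = p.rev <;> simp [h1, h2, eq_comm]
  · intro b _ hb; simp [hb]
  · simp
  · intro b _ hb; simp [hb]
  · simp

theorem clearedR_apply (N : ℕ) (i k p q : Fin N) :
    clearedR N (i, k) (p, q) =
      (if i = p then if k = q then invUVDiff * invUVDiffKappa N else 0 else 0)
      - (if k = p then if i = q then invUV * invUVDiffKappa N else 0 else 0)
      + (if k = i.rev then if q = p.rev then invUV * invUVDiff else 0 else 0) := by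
  simp only [clearedR, Matrix.add_apply, Matrix.sub_apply, Matrix.smul_apply, permOp_apply,
    transOp_apply, Matrix.one_apply, Prod.mk.injEq, smul_eq_mul, mul_ite, mul_one, mul_zero,
    ite_and]

variable {A : Type*} [Ring A] [Algebra ℂ A] {N : ℕ}

theorem kronecker_mul_kronecker_apply {S : Type*} [Ring S] {n : Type*} [Fintype n] [DecidableEq n]
    (M M' : Matrix n n S) (p q j l : n) :
    ((M ⊗ₖ (1 : Matrix n n S)) * ((1 : Matrix n n S) ⊗ₖ M')) (p, q) (j, l) = M p j * M' q l := by
  rw [Matrix.mul_apply, Fintype.sum_prod_type]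
  simp [Matrix.one_apply]

theorem kronecker_mul_kronecker_apply' {S : Type*} [Ring S] {n : Type*} [Fintype n] [DecidableEq n]
    (M M' : Matrix n n S) (p q j l : n) :
    (((1 : Matrix n n S) ⊗ₖ M') * (M ⊗ₖ (1 : Matrix n n S))) (p, q) (j, l) = M' q l * M p j := by
  rw [Matrix.mul_apply, Fintype.sum_prod_type]
  simp [Matrix.one_apply]

theorem rttLeft_apply (T : Matrix (Fin N) (Fin N) A⟦X⟧) (i k j l : Fin N) :
    rttLeft T (i, k) (j, l) =
      (invUVDiff * invUVDiffKappa N) • (serU (T i j) * serV (T k l))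
      - (invUV * invUVDiffKappa N) • (serU (T k j) * serV (T i l))
      + (invUV * invUVDiff) • (if k = i.rev then ∑ p, serU (T p j) * serV (T p.rev l) else 0) := by
  rw [rttLeft, Matrix.mul_assoc, Matrix.mul_apply, Fintype.sum_prod_type]
  simp only [kronecker_mul_kronecker_apply, Matrix.map_apply, clearedR_apply, map_add, map_sub,
    apply_ite (scalarSeries₂ : ℂ⟦X⟧⟦X⟧ →+* A⟦X⟧⟦X⟧), map_zero, add_mul, sub_mul, ite_mul, zero_mul,
    Finset.sum_add_distrib, Finset.sum_sub_distrib]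
  simp [smul_eq_scalarSeries₂_mul, Finset.mul_sum]

theorem rttRight_apply (T : Matrix (Fin N) (Fin N) A⟦X⟧) (i k j l : Fin N) :
    rttRight T (i, k) (j, l) =
      (invUVDiff * invUVDiffKappa N) • (serV (T k l) * serU (T i j))
      - (invUV * invUVDiffKappa N) • (serV (T k j) * serU (T i l))
      + (invUV * invUVDiff) • (if l = j.rev then ∑ p, serV (T k p.rev) * serU (T i p) else 0) := by
  rw [rttRight, Matrix.mul_apply, Fintype.sum_prod_type]
  simp only [kronecker_mul_kronecker_apply', Matrix.map_apply, clearedR_apply, map_add, map_sub,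
    apply_ite (scalarSeries₂ : ℂ⟦X⟧⟦X⟧ →+* A⟦X⟧⟦X⟧), map_zero, mul_add, mul_sub, mul_ite, mul_zero,
    Finset.sum_add_distrib, Finset.sum_sub_distrib, ← (scalarSeries₂_commute _ _).eq]
  simp [smul_eq_scalarSeries₂_mul, Finset.mul_sum]

end Entries

/-! ### Coefficients of powers of u⁻¹ -/

section LevelOne

variable {A : Type*} [Ring A] [Algebra ℂ A]

/-- Coefficient of `u⁻ʳ` of a series in `u⁻¹, v⁻¹`, as a series in `v⁻¹`. -/
def coeffU {A : Type*} [Ring A] (r : ℕ) : A⟦X⟧⟦X⟧ →+ A⟦X⟧ where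
  toFun F := PowerSeries.mk fun s => PowerSeries.coeff r (PowerSeries.coeff s F)
  map_zero' := by ext; simp
  map_add' F G := by ext; simp

theorem coeff_coeffU {A : Type*} [Ring A] (r s : ℕ) (F : A⟦X⟧⟦X⟧) :
    PowerSeries.coeff s (coeffU r F) = PowerSeries.coeff r (PowerSeries.coeff s F) := by
  simp [coeffU]

theorem coeffU_serU_mul_serV {A : Type*} [Ring A] (r : ℕ) (f g : A⟦X⟧) :
    coeffU r (serU f * serV g) = PowerSeries.C (PowerSeries.coeff r f) * g := by
  ext s
  rw [coeff_coeffU, coeff_coeff_serU_mul_serV, PowerSeries.coeff_C_mul]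

theorem coeffU_serV_mul_serU {A : Type*} [Ring A] (r : ℕ) (f g : A⟦X⟧) :
    coeffU r (serV g * serU f) = g * PowerSeries.C (PowerSeries.coeff r f) := by
  ext s
  rw [coeff_coeffU, coeff_coeff_serV_mul_serU, PowerSeries.coeff_mul_C]

theorem coeffU_succ_C_X_mul {A : Type*} [Ring A] (r : ℕ) (F : A⟦X⟧⟦X⟧) :
    coeffU (r + 1) (PowerSeries.C PowerSeries.X * F) = coeffU r F := by
  ext s
  rw [coeff_coeffU, PowerSeries.coeff_C_mul, PowerSeries.coeff_succ_X_mul, coeff_coeffU]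

theorem coeffU_zero_C_X_mul {A : Type*} [Ring A] (F : A⟦X⟧⟦X⟧) :
    coeffU 0 (PowerSeries.C PowerSeries.X * F) = 0 := by
  ext s
  rw [coeff_coeffU, PowerSeries.coeff_C_mul, PowerSeries.coeff_zero_X_mul, map_zero]

theorem coeffU_X_mul {A : Type*} [Ring A] (r : ℕ) (F : A⟦X⟧⟦X⟧) :
    coeffU r (PowerSeries.X * F) = PowerSeries.X * coeffU r F := by
  ext s
  rw [coeff_coeffU]
  cases s with
  | zero => simp
  | succ s => rw [PowerSeries.coeff_succ_X_mul, PowerSeries.coeff_succ_X_mul, coeff_coeffU]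

theorem coeffU_zero_invUV_smul (F : A⟦X⟧⟦X⟧) : coeffU 0 ((invUV : ℂ⟦X⟧⟦X⟧) • F) = 0 := by
  rw [invUV_smul, coeffU_zero_C_X_mul]

theorem coeffU_one_invUV_smul (F : A⟦X⟧⟦X⟧) :
    coeffU 1 ((invUV : ℂ⟦X⟧⟦X⟧) • F) = PowerSeries.X * coeffU 0 F := by
  rw [invUV_smul, coeffU_succ_C_X_mul, coeffU_X_mul]

theorem invUVDiff_sub_smul (c : ℂ) (F : A⟦X⟧⟦X⟧) : (invUVDiff - c • invUV : ℂ⟦X⟧⟦X⟧) • F =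
    PowerSeries.X * F - PowerSeries.C PowerSeries.X * F - c • ((invUV : ℂ⟦X⟧⟦X⟧) • F) := by
  rw [sub_smul]
  congr 1
  · rw [invUVDiff_eq, diff_smul]; simp
  · rw [smul_eq_scalarSeries₂_mul, smul_eq_scalarSeries₂_mul, ← smul_mul_assoc]
    congr 1
    ext
    simp [scalarSeries₂, scalarSeries]
    rw [Algebra.smul_def]

theorem coeffU_smul (r : ℕ) (c : ℂ) (F : A⟦X⟧⟦X⟧) : coeffU r (c • F) = c • coeffU r F := by
  ext; simp [coeff_coeffU]

theorem coeffU_zero_diff_smul (c : ℂ) (F : A⟦X⟧⟦X⟧) :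
    coeffU 0 ((invUVDiff - c • invUV : ℂ⟦X⟧⟦X⟧) • F) = PowerSeries.X * coeffU 0 F := by
  rw [invUVDiff_sub_smul, map_sub, map_sub, coeffU_X_mul, coeffU_zero_C_X_mul, coeffU_smul,
    coeffU_zero_invUV_smul]
  simp

theorem coeffU_zero_invUVDiff_smul (F : A⟦X⟧⟦X⟧) :
    coeffU 0 ((invUVDiff : ℂ⟦X⟧⟦X⟧) • F) = PowerSeries.X * coeffU 0 F := by
  simpa using coeffU_zero_diff_smul 0 F

theorem coeffU_one_diff_smul (c : ℂ) (F : A⟦X⟧⟦X⟧) :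
    coeffU 1 ((invUVDiff - c • invUV : ℂ⟦X⟧⟦X⟧) • F) =
      PowerSeries.X * coeffU 1 F - coeffU 0 F - c • (PowerSeries.X * coeffU 0 F) := by
  rw [invUVDiff_sub_smul, map_sub, map_sub, coeffU_X_mul, coeffU_succ_C_X_mul, coeffU_smul,
    coeffU_one_invUV_smul]

theorem coeffU_one_invUVDiff_smul (F : A⟦X⟧⟦X⟧) :
    coeffU 1 ((invUVDiff : ℂ⟦X⟧⟦X⟧) • F) = PowerSeries.X * coeffU 1 F - coeffU 0 F := by
  simpa using coeffU_one_diff_smul 0 F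

end LevelOne

/-! ### Consequences of the relations of the extended Yangian -/

section OrthogonalRelations

variable {A : Type*} [Ring A] [Algebra ℂ A]

/-- The matrix `T` satisfies the defining relations of the extended Yangian `X(o_N)`. -/
structure IsExtYangianMatrix {N : ℕ} (T : Matrix (Fin N) (Fin N) A⟦X⟧) : Prop where
  constantCoeff_eq : ∀ i j, PowerSeries.constantCoeff (T i j) = if i = j then 1 else 0
  rtt : rttLeft T = rttRight T

namespace IsExtYangianMatrix

variable {N : ℕ} {T : Matrix (Fin N) (Fin N) A⟦X⟧}

theorem entry (hT : IsExtYangianMatrix T) (i j k l : Fin N) :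
    (invUVDiff * invUVDiffKappa N) • (serU (T i j) * serV (T k l) - serV (T k l) * serU (T i j)) =
      (invUV * invUVDiffKappa N) • (serU (T k j) * serV (T i l) - serV (T k j) * serU (T i l))
      - (invUV * invUVDiff) • ((if k = i.rev then ∑ p, serU (T p j) * serV (T p.rev l) else 0)
        - (if l = j.rev then ∑ p, serV (T k p.rev) * serU (T i p) else 0)) := by
  have h := congrFun (congrFun hT.rtt (i, k)) (j, l)
  rw [rttLeft_apply, rttRight_apply] at h
  simp only [smul_sub]
  linear_combination (norm := abel) h

/-- The relations in which the operator `Q` does not enter. -/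
theorem entry_of_ne (hT : IsExtYangianMatrix T) {i j k l : Fin N} (h1 : k ≠ i.rev)
    (h2 : l ≠ j.rev) :
    invUVDiff • (serU (T i j) * serV (T k l) - serV (T k l) * serU (T i j)) =
      invUV • (serU (T k j) * serV (T i l) - serV (T k j) * serU (T i l)) := by
  have h := hT.entry i j k l
  rw [if_neg h1, if_neg h2, sub_zero, smul_zero, sub_zero, mul_comm, mul_comm invUV, mul_smul,
    mul_smul, ← sub_eq_zero, ← smul_sub] at h
  exact sub_eq_zero.1 (invUVDiff_sub_smul_cancel _ h)

/-- The commutators with the coefficients of `u⁻¹`. -/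
theorem levelOne (hT : IsExtYangianMatrix T) (i j k l : Fin N) :
    PowerSeries.C (PowerSeries.coeff 1 (T i j)) * T k l -
      T k l * PowerSeries.C (PowerSeries.coeff 1 (T i j)) =
    (if k = j then T i l else 0) - (if i = l then T k j else 0)
      - (if k = i.rev then T j.rev l else 0) + (if l = j.rev then T k i.rev else 0) := by
  have h := congrArg (coeffU 1) (hT.entry i j k l)
  have h0 : ∀ a b c d : Fin N, coeffU 0 (serU (T a b) * serV (T c d)) =
      if a = b then T c d else 0 := fun a b c d => by
    rw [coeffU_serU_mul_serV, PowerSeries.coeff_zero_eq_constantCoeff_apply, hT.constantCoeff_eq]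
    split_ifs <;> simp
  have h0' : ∀ a b c d : Fin N, coeffU 0 (serV (T a b) * serU (T c d)) =
      if c = d then T a b else 0 := fun a b c d => by
    rw [coeffU_serV_mul_serU, PowerSeries.coeff_zero_eq_constantCoeff_apply, hT.constantCoeff_eq]
    split_ifs <;> simp
  -- In the coefficient of u⁻¹ the constant κ only meets u⁰-terms of commutators. These vanish
  -- because the constant terms of T(u) are scalars, so κ drops out.
  rw [map_sub, mul_smul, mul_smul, mul_smul, coeffU_one_invUV_smul, coeffU_one_invUV_smul,
    invUVDiffKappa, coeffU_one_invUVDiff_smul, coeffU_zero_diff_smul, coeffU_one_diff_smul,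
    coeffU_zero_diff_smul, coeffU_zero_invUVDiff_smul] at h
  simp only [map_sub, apply_ite (coeffU _), map_sum, map_zero, h0, h0', coeffU_serU_mul_serV,
    coeffU_serV_mul_serU, sub_zero, sub_self, mul_zero, smul_zero] at h
  simp only [← mul_sub] at h
  have h := PowerSeries.X_mul_cancel (PowerSeries.X_mul_cancel h)
  rw [h]
  simp [eq_comm]
  abel

end IsExtYangianMatrix

end OrthogonalRelations

/-! ### Gauss decomposition of relations of type `gl_2` -/

section GaussAlgebra

variable {k S : Type*} [CommRing k] [Ring S] [Algebra k S] {d m : k}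

/-- Unprimed letters stand for series in u, primed ones for series in v; d and m stand for u - v and
1 with denominators cleared. The relation between a(u) and a(v) e(v) can be divided by a(v) on the
left, since a(u) and a(v) commute. -/
theorem gauss_upper {a a' ai' e e' : S} (haa : a * a' = a' * a) (hinv : ai' * a' = 1)
    (h : d • (a * (a' * e') - a' * e' * a) = m • (a * (a' * e') - a' * (a * e))) :
    d • (a * e' - e' * a) = m • (a * (e' - e)) := by
  have haa' : ∀ z, a * (a' * z) = a' * (a * z) := fun z => by rw [← mul_assoc, haa, mul_assoc]
  have hi : ∀ z, ai' * (a' * z) = z := fun z => by rw [← mul_assoc, hinv, one_mul]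
  have h' := congrArg (ai' * ·) h
  simp only [haa', mul_assoc, mul_smul_comm, mul_sub, hi] at h'
  simpa only [mul_sub] using h'

theorem gauss_lower {a a' ai' f f' : S} (haa : a * a' = a' * a) (hinv : a' * ai' = 1)
    (h : d • (a * (f' * a') - f' * a' * a) = m • (f * a * a' - f' * a' * a)) :
    d • (a * f' - f' * a) = m • ((f - f') * a) := by
  have hi : ∀ z, z * a' * ai' = z := fun z => by rw [mul_assoc, hinv, mul_one]
  have haa' : ∀ z, z * a' * a = z * a * a' := fun z => by rw [mul_assoc, mul_assoc, haa]
  have h' := congrArg (· * ai') h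
  simp only [haa', ← mul_assoc, smul_mul_assoc, sub_mul, hi] at h'
  simpa only [sub_mul] using h'

/-- Subtracting the relations of a with f and with e, multiplied by the remaining factors of f a e,
cancels the right-hand side of the relation between a and D. Hence a commutes with the Cartan factor
D - f a e. -/
theorem gauss_cartan {a a' e e' f f' D' : S} (haa : a * a' = a' * a)
    (hae : d • (a * e' - e' * a) = m • (a * (e' - e)))
    (haf : d • (a * f' - f' * a) = m • ((f - f') * a))
    (had : d • (a * D' - D' * a) = m • (f * a * (a' * e') - f' * a' * (a * e))) :
    d • (a * (D' - f' * a' * e') - (D' - f' * a' * e') * a) = 0 := by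
  have haa' : ∀ z, a * (a' * z) = a' * (a * z) := fun z => by rw [← mul_assoc, haa, mul_assoc]
  linear_combination (norm := skip) had - haf * (a' * e') - (f' * a') * hae
  simp only [mul_sub, sub_mul, smul_sub, smul_mul_assoc, mul_smul_comm, mul_assoc, haa']
  module

/-- Compares the relation between a e and f a with the commutator of e and f alone; here h is the
factor D - f a e. The extra factor d appears because a is moved past e and f by relations that hold
only after multiplication by d. The identity is read both ways: to extract the current relation from
T, and to build matrix relations from currents. -/
theorem gauss_commutator {a a' e e' f f' h h' : S} (haa : a * a' = a' * a)
    (hae : d • (a * e' - e' * a) = m • (a * (e' - e)))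
    (hae' : d • (a' * e - e * a') = m • (a' * (e' - e)))
    (haf : d • (a * f' - f' * a) = m • ((f - f') * a)) :
    d • (d • (a * e * (f' * a') - f' * a' * (a * e)) -
      m • ((h + f * a * e) * a' - (h' + f' * a' * e') * a)) =
    d • (d • (a * (e * f' - f' * e) * a') - m • (h * a' - h' * a)) := by
  have haa' : ∀ z, a * (a' * z) = a' * (a * z) := fun z => by rw [← mul_assoc, haa, mul_assoc]
  linear_combination (norm := skip) d • (haf * (a' * e)) - d • ((a * f') * hae')
    + m • ((f * a) * hae') - m • ((f' * a') * hae) + m • (haf * (a' * (e - e')))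
  simp only [mul_sub, sub_mul, add_mul, smul_sub, smul_add, smul_mul_assoc, mul_smul_comm,
    mul_assoc, haa']
  module

end GaussAlgebra

/-! ### Current relations as relations between coefficients -/

section Currents

variable {A : Type*} [Ring A] [Algebra ℂ A]

theorem swapUV_smul (s : ℂ⟦X⟧⟦X⟧) (F : A⟦X⟧⟦X⟧) : swapUV (s • F) = swapUV s • swapUV F := by
  rw [smul_eq_scalarSeries₂_mul, map_mul, swapUV_scalarSeries₂]; rfl

/-- Exchange of variables in a relation of the form `(u - v) F(u, v) = G(u, v)`. -/
theorem swapUV_relation {F G : A⟦X⟧⟦X⟧} (h : (invUVDiff : ℂ⟦X⟧⟦X⟧) • F = (invUV : ℂ⟦X⟧⟦X⟧) • G) :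
    (invUVDiff : ℂ⟦X⟧⟦X⟧) • swapUV F = (invUV : ℂ⟦X⟧⟦X⟧) • -swapUV G := by
  have := congrArg swapUV h
  rw [swapUV_smul, swapUV_smul, swapUV_invUV, swapUV_invUVDiff, neg_smul] at this
  rw [smul_neg, ← this, neg_neg]

theorem coeff_succ_invUVDiff_smul (F : A⟦X⟧⟦X⟧) (s : ℕ) :
    PowerSeries.coeff (s + 1) ((invUVDiff : ℂ⟦X⟧⟦X⟧) • F) =
      PowerSeries.coeff s F - PowerSeries.X * PowerSeries.coeff (s + 1) F := by
  rw [invUVDiff_eq, diff_smul, map_sub, PowerSeries.coeff_succ_X_mul, PowerSeries.coeff_C_mul,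
    map_one, one_mul, PowerSeries.coeff_C_mul]

theorem coeff_zero_invUVDiff_smul (F : A⟦X⟧⟦X⟧) :
    PowerSeries.coeff 0 ((invUVDiff : ℂ⟦X⟧⟦X⟧) • F) =
      -(PowerSeries.X * PowerSeries.coeff 0 F) := by
  rw [invUVDiff_eq, diff_smul, map_sub, PowerSeries.coeff_zero_X_mul, PowerSeries.coeff_C_mul,
    zero_sub]

theorem coeff_succ_invUV_smul (F : A⟦X⟧⟦X⟧) (s : ℕ) :
    PowerSeries.coeff (s + 1) ((invUV : ℂ⟦X⟧⟦X⟧) • F) =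
      PowerSeries.X * PowerSeries.coeff s F := by
  rw [invUV_smul, PowerSeries.coeff_C_mul, PowerSeries.coeff_succ_X_mul]

theorem relation_iff_coeff {F G : A⟦X⟧⟦X⟧} :
    (invUVDiff : ℂ⟦X⟧⟦X⟧) • F = (invUV : ℂ⟦X⟧⟦X⟧) • G ↔ PowerSeries.coeff 0 F = 0 ∧
      ∀ s, PowerSeries.coeff s F - PowerSeries.X * PowerSeries.coeff (s + 1) F =
        PowerSeries.X * PowerSeries.coeff s G := by
  constructor
  · intro h
    refine ⟨?_, fun s => ?_⟩
    · have := congrArg (PowerSeries.coeff 0) h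
      rw [coeff_zero_invUVDiff_smul, coeff_zero_right_invUV_smul, neg_eq_zero] at this
      exact PowerSeries.X_mul_cancel (this.trans (mul_zero _).symm)
    · rw [← coeff_succ_invUVDiff_smul, h, coeff_succ_invUV_smul]
  · rintro ⟨h0, h⟩
    ext1 s
    cases s with
    | zero => rw [coeff_zero_invUVDiff_smul, coeff_zero_right_invUV_smul, h0, mul_zero, neg_zero]
    | succ s => rw [coeff_succ_invUVDiff_smul, h, coeff_succ_invUV_smul]

theorem coeff_serU_mul {A : Type*} [Ring A] (f : A⟦X⟧) (F : A⟦X⟧⟦X⟧) (s : ℕ) :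
    PowerSeries.coeff s (serU f * F) = f * PowerSeries.coeff s F := by
  rw [serU, PowerSeries.coeff_C_mul]

theorem coeff_mul_serU {A : Type*} [Ring A] (f : A⟦X⟧) (F : A⟦X⟧⟦X⟧) (s : ℕ) :
    PowerSeries.coeff s (F * serU f) = PowerSeries.coeff s F * f := by
  rw [serU, PowerSeries.coeff_mul_C]

theorem coeff_serV {A : Type*} [Ring A] (f : A⟦X⟧) (s : ℕ) :
    PowerSeries.coeff s (serV f) = PowerSeries.C (PowerSeries.coeff s f) := by
  rw [serV, PowerSeries.coeff_map]

theorem coeff_zero_serU {A : Type*} [Ring A] (f : A⟦X⟧) :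
    PowerSeries.coeff 0 (serU f) = f := by
  rw [serU, PowerSeries.coeff_zero_C]

theorem coeff_succ_serU {A : Type*} [Ring A] (f : A⟦X⟧) (s : ℕ) :
    PowerSeries.coeff (s + 1) (serU f) = 0 := by
  rw [serU, PowerSeries.coeff_succ_C]

/-- Comparing coefficients of powers of v⁻¹: the lowest one recovers a(u) e(u) from the commutator
with e_1, and the others give a recursion between neighbouring coefficients of e. In terms of
moments, that recursion is the intertwining relation with denominators cleared. -/
theorem upper_relation_iff {a e : A⟦X⟧} (he : PowerSeries.coeff 0 e = 0) :
    (invUVDiff : ℂ⟦X⟧⟦X⟧) • (serU a * serV e - serV e * serU a) =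
      (invUV : ℂ⟦X⟧⟦X⟧) • (serU a * (serV e - serU e)) ↔
    a * PowerSeries.C (PowerSeries.coeff 1 e) - PowerSeries.C (PowerSeries.coeff 1 e) * a = a * e ∧
    ∀ r, PowerSeries.C (PowerSeries.coeff (r + 1) e) * a
        - PowerSeries.X * (PowerSeries.C (PowerSeries.coeff (r + 2) e) * a) =
      a * PowerSeries.C (PowerSeries.coeff (r + 1) e) - PowerSeries.X *
        (a * PowerSeries.C (PowerSeries.coeff (r + 1) e + PowerSeries.coeff (r + 2) e)) := by
  simp only [relation_iff_coeff, map_sub, coeff_serU_mul, coeff_mul_serU, coeff_serV]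
  constructor
  · rintro ⟨-, h⟩
    constructor
    · have := h 0
      rw [he, map_zero, coeff_zero_serU, mul_zero, zero_mul, sub_zero, zero_sub, ← mul_neg] at this
      have := PowerSeries.X_mul_cancel this
      rw [zero_sub, mul_neg, neg_inj] at this
      exact this
    · intro r
      have := h (r + 1)
      rw [coeff_succ_serU, sub_zero] at this
      rw [map_add, mul_add, mul_add, ← this]
      noncomm_ring
  · rintro ⟨h0, h⟩
    refine ⟨by rw [he]; simp, fun s => ?_⟩
    cases s with
    | zero => rw [he, zero_add, h0, coeff_zero_serU]; simp
    | succ s =>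
      rw [coeff_succ_serU, sub_zero]
      have := h s
      rw [map_add, mul_add, mul_add] at this
      linear_combination (norm := noncomm_ring) -this

theorem lower_relation_iff {a f : A⟦X⟧} (hf : PowerSeries.coeff 0 f = 0) :
    (invUVDiff : ℂ⟦X⟧⟦X⟧) • (serU a * serV f - serV f * serU a) =
      (invUV : ℂ⟦X⟧⟦X⟧) • ((serU f - serV f) * serU a) ↔
    PowerSeries.C (PowerSeries.coeff 1 f) * a - a * PowerSeries.C (PowerSeries.coeff 1 f) = f * a ∧
    ∀ r, a * PowerSeries.C (PowerSeries.coeff (r + 1) f)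
        - PowerSeries.X * (a * PowerSeries.C (PowerSeries.coeff (r + 2) f)) =
      PowerSeries.C (PowerSeries.coeff (r + 1) f) * a - PowerSeries.X *
        (PowerSeries.C (PowerSeries.coeff (r + 1) f + PowerSeries.coeff (r + 2) f) * a) := by
  simp only [relation_iff_coeff, map_sub, coeff_serU_mul, coeff_mul_serU, coeff_serV]
  constructor
  · rintro ⟨-, h⟩
    constructor
    · have := h 0
      rw [hf, map_zero, coeff_zero_serU, mul_zero, zero_mul, sub_zero, zero_sub, ← mul_neg] at this
      have := PowerSeries.X_mul_cancel this
      rw [sub_zero, neg_sub] at this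
      exact this
    · intro r
      have := h (r + 1)
      rw [coeff_succ_serU, zero_sub] at this
      rw [map_add, add_mul, mul_add]
      linear_combination (norm := noncomm_ring) this
  · rintro ⟨h0, h⟩
    refine ⟨by rw [hf]; simp, fun s => ?_⟩
    cases s with
    | zero => rw [hf, coeff_zero_serU, map_zero, sub_zero, ← h0]; noncomm_ring
    | succ s =>
      rw [coeff_succ_serU, zero_sub]
      have := h s
      rw [map_add, add_mul, mul_add] at this
      linear_combination (norm := noncomm_ring) this

theorem relation_iff_coeff_coeff {F G : A⟦X⟧⟦X⟧} (h1 : PowerSeries.coeff 0 F = 0)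
    (h2 : coeffU 0 F = 0) :
    (invUVDiff : ℂ⟦X⟧⟦X⟧) • F = (invUV : ℂ⟦X⟧⟦X⟧) • G ↔ ∀ r s,
      PowerSeries.coeff (r + 1) (PowerSeries.coeff s F) -
        PowerSeries.coeff r (PowerSeries.coeff (s + 1) F) =
      PowerSeries.coeff r (PowerSeries.coeff s G) := by
  have h2' : ∀ s, PowerSeries.coeff 0 (PowerSeries.coeff s F) = 0 := fun s => by
    rw [← coeff_coeffU, h2, map_zero]
  constructor
  · intro h r s
    rw [← coeff_invUVDiff_smul, h, coeff_coeff_invUV_smul]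
  · intro h
    ext s r
    cases s with
    | zero =>
      cases r with
      | zero => rw [coeff_zero_zero_invUVDiff_smul, coeff_zero_left_invUV_smul]
      | succ r => rw [coeff_zero_right_invUVDiff_smul, coeff_zero_right_invUV_smul, h1]; simp
    | succ s =>
      cases r with
      | zero => rw [coeff_zero_left_invUVDiff_smul, coeff_zero_left_invUV_smul, h2']
      | succ r => rw [coeff_invUVDiff_smul, h, coeff_coeff_invUV_smul]

/-- For positive exponents of both u⁻¹ and v⁻¹ the right-hand side has no terms. So the commutator
is unchanged when an index unit passes from e to f and depends only on r + s. The boundary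
coefficients identify its value. -/
theorem commutator_relation_iff {e f κ : A⟦X⟧} (he : PowerSeries.coeff 0 e = 0)
    (hf : PowerSeries.coeff 0 f = 0) :
    (invUVDiff : ℂ⟦X⟧⟦X⟧) • (serU e * serV f - serV f * serU e) =
      (invUV : ℂ⟦X⟧⟦X⟧) • (serU κ - serV κ) ↔
    ∀ r s, PowerSeries.coeff (r + 1) e * PowerSeries.coeff (s + 1) f -
        PowerSeries.coeff (s + 1) f * PowerSeries.coeff (r + 1) e =
      - PowerSeries.coeff (r + s + 1) κ := by
  rw [relation_iff_coeff_coeff]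
  rotate_left
  · rw [map_sub, coeff_serU_mul, coeff_mul_serU, coeff_serV, hf]; simp
  · rw [map_sub, coeffU_serU_mul_serV, coeffU_serV_mul_serU, he]; simp
  have hU : ∀ r s, PowerSeries.coeff r (PowerSeries.coeff s (serU κ)) =
      if s = 0 then PowerSeries.coeff r κ else 0 := fun r s => by
    rw [serU, PowerSeries.coeff_C]; split_ifs <;> simp
  have hV : ∀ r s, PowerSeries.coeff r (PowerSeries.coeff s (serV κ)) =
      if r = 0 then PowerSeries.coeff s κ else 0 := fun r s => by
    rw [coeff_serV, PowerSeries.coeff_C]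
  simp only [map_sub, coeff_coeff_serU_mul_serV, coeff_coeff_serV_mul_serU, hU, hV]
  constructor
  · intro h r
    induction r with
    | zero =>
      intro s
      have := h 0 (s + 1)
      simp only [he, zero_mul, mul_zero, sub_zero, zero_add] at this
      simpa [Nat.add_comm] using this
    | succ r ih =>
      intro s
      have := h (r + 1) (s + 1)
      rw [if_neg (by omega), if_neg (by omega), sub_zero, sub_eq_zero] at this
      rw [this, ih (s + 1)]
      congr 3; omega
  · intro h r s
    rcases r with _ | r <;> rcases s with _ | s
    · simp [he, hf]
    · rw [h, he]; simp
    · rw [hf, h]; simp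
    · rw [h, h, if_neg (by omega), if_neg (by omega)]
      simp only [show r + 1 + s = r + (s + 1) by omega, sub_self]

theorem commute_coeff_of_commute_serU_serV {A : Type*} [Ring A] {f g : A⟦X⟧}
    (h : Commute (serU f) (serV g)) (r s : ℕ) :
    Commute (PowerSeries.coeff r f) (PowerSeries.coeff s g) := by
  have := congrArg (fun F => PowerSeries.coeff r (PowerSeries.coeff s F)) h.eq
  simp only [coeff_coeff_serU_mul_serV, coeff_coeff_serV_mul_serU] at this
  exact this

theorem commute_serU_serV {A : Type*} [Ring A] {f g : A⟦X⟧}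
    (h : ∀ r s, Commute (PowerSeries.coeff r f) (PowerSeries.coeff s g)) :
    Commute (serU f) (serV g) := by
  ext s r
  rw [coeff_coeff_serU_mul_serV, coeff_coeff_serV_mul_serU, (h r s).eq]

theorem commute_of_coeff {A : Type*} [Ring A] {f g : A⟦X⟧}
    (h : ∀ r s, Commute (PowerSeries.coeff r f) (PowerSeries.coeff s g)) : Commute f g := by
  ext n
  rw [PowerSeries.coeff_mul, PowerSeries.coeff_mul, ← Finset.Nat.sum_antidiagonal_swap]
  exact Finset.sum_congr rfl fun p _ => (h _ _).eq

end Currents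

/-! ### Specialization at u = v + 1 -/

section Shift

variable {A : Type*} [Ring A] [Algebra ℂ A]

theorem affineInv_one_zero : affineInv 1 0 = PowerSeries.X := by
  simp [affineInv]

theorem aff_one_zero (f : A⟦X⟧) : aff 1 0 f = f := by
  ext n
  rw [coeff_aff, affineInv_one_zero, Finset.sum_eq_single n]
  · simp
  · intro b _ hb; simp [PowerSeries.coeff_X_pow, hb.symm]
  · simp

theorem affineInv_mul_denom {c : ℂ} (hc : c ≠ 0) (a : ℂ) :
    affineInv c a * (PowerSeries.C c + PowerSeries.C a * PowerSeries.X) = PowerSeries.X := by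
  rw [affineInv, mul_assoc, PowerSeries.inv_mul_cancel _ (by simpa using hc), mul_one]

theorem aff_injective {c : ℂ} (hc : c ≠ 0) (a : ℂ) :
    Function.Injective (aff c a : A⟦X⟧ →+* A⟦X⟧) := by
  rw [injective_iff_map_eq_zero]
  intro z hz
  ext n
  induction n using Nat.strong_induction_on with
  | _ n ih =>
    have := coeff_aff_leading c a (n := n) (z := z) fun m hm => by simpa using ih m hm
    rw [hz, map_zero, eq_comm] at this
    simpa using (smul_eq_zero_iff_right (inv_ne_zero (pow_ne_zero n hc))).1 this

/-- Cancellation of the scalar that `u⁻¹ v⁻¹` becomes at `u = v + 1`. -/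
theorem shift_scalar_cancel {f : A⟦X⟧}
    (h : scalarSeries (affineInv 1 1 * PowerSeries.X) * f = 0) : f = 0 := by
  have h2 := congrArg (scalarSeries (PowerSeries.C 1 + PowerSeries.C 1 * PowerSeries.X) * ·) h
  simp only [mul_zero] at h2
  rw [← mul_assoc, ← map_mul, ← mul_assoc, mul_comm _ (affineInv 1 1),
    affineInv_mul_denom one_ne_zero, map_mul, scalarSeries_X, mul_assoc] at h2
  have h3 := PowerSeries.X_mul_cancel (h2.trans (mul_zero _).symm)
  exact PowerSeries.X_mul_cancel (h3.trans (mul_zero _).symm)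

theorem subUV_X (c a c' a' : ℂ) :
    subUV c a c' a' (PowerSeries.X : ℂ⟦X⟧⟦X⟧) = serV (affineInv c' a') := by
  rw [show (PowerSeries.X : ℂ⟦X⟧⟦X⟧) = serV PowerSeries.X from (PowerSeries.map_X _).symm,
    subUV_serV, aff_X_scalar]

theorem subUV_C_X (c a c' a' : ℂ) :
    subUV c a c' a' (PowerSeries.C PowerSeries.X : ℂ⟦X⟧⟦X⟧) = serU (affineInv c a) := by
  rw [show (PowerSeries.C PowerSeries.X : ℂ⟦X⟧⟦X⟧) = serU PowerSeries.X from rfl,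
    subUV_serU, aff_X_scalar]

theorem subUV_invUV (c a c' a' : ℂ) :
    subUV c a c' a' invUV = serU (affineInv c a) * serV (affineInv c' a') := by
  rw [invUV, map_mul, subUV_X, subUV_C_X]

theorem subUV_invUVDiff (c a c' a' : ℂ) :
    subUV c a c' a' invUVDiff = serV (affineInv c' a') - serU (affineInv c a) := by
  rw [invUVDiff, map_sub, subUV_X, subUV_C_X]

theorem specUV_invUV (c a c' a' : ℂ) :
    specUV c a c' a' invUV = affineInv c a * affineInv c' a' := by
  rw [specUV, RingHom.comp_apply, subUV_invUV, map_mul, diagUV_serU, diagUV_serV]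

theorem specUV_invUVDiff (c a c' a' : ℂ) :
    specUV c a c' a' invUVDiff = affineInv c' a' - affineInv c a := by
  rw [specUV, RingHom.comp_apply, subUV_invUVDiff, map_sub, diagUV_serU, diagUV_serV]

theorem specUV_smul (c a c' a' : ℂ) (s : ℂ⟦X⟧⟦X⟧) (F : A⟦X⟧⟦X⟧) :
    specUV c a c' a' (s • F) = scalarSeries (specUV c a c' a' s) * specUV c a c' a' F := by
  rw [smul_eq_scalarSeries₂_mul, map_mul, specUV_scalarSeries₂]

theorem subUV_smul (c a c' a' : ℂ) (s : ℂ⟦X⟧⟦X⟧) (F : A⟦X⟧⟦X⟧) :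
    subUV c a c' a' (s • F) = subUV c a c' a' s • subUV c a c' a' F := by
  rw [smul_eq_scalarSeries₂_mul, map_mul, subUV_scalarSeries₂, smul_eq_scalarSeries₂_mul]

theorem specUV_shift_invUV : specUV 1 1 1 0 invUV = affineInv 1 1 * PowerSeries.X := by
  rw [specUV_invUV, affineInv_one_zero]

/-- At u = v + 1 the factor u - v is 1, so the cleared u - v and the cleared 1 coincide there. -/
theorem specUV_shift_invUVDiff : specUV 1 1 1 0 invUVDiff = affineInv 1 1 * PowerSeries.X := by
  rw [specUV_invUVDiff, affineInv_one_zero]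
  have := affineInv_mul_denom one_ne_zero 1
  simp only [map_one, mul_add, mul_one, one_mul] at this
  linear_combination -this

theorem specUV_smul_complex (c a c' a' : ℂ) (z : ℂ) (F : A⟦X⟧⟦X⟧) :
    specUV c a c' a' (z • F) = z • specUV c a c' a' F := by
  have h1 : (z • F : A⟦X⟧⟦X⟧) = serU (PowerSeries.C (algebraMap ℂ A z)) * F := by
    ext; simp [coeff_serU_mul, PowerSeries.coeff_C_mul]; rw [Algebra.smul_def]
  rw [h1, map_mul, specUV_serU, aff_C]
  ext; simp [PowerSeries.coeff_C_mul]; rw [Algebra.smul_def]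

theorem specUV_shift_invUVDiffKappa :
    specUV 1 1 1 0 (invUVDiffKappa 3) = (2⁻¹ : ℂ) • (affineInv 1 1 * PowerSeries.X) := by
  rw [invUVDiffKappa, map_sub, specUV_smul_complex, specUV_shift_invUV, specUV_shift_invUVDiff]
  rw [show kappa 3 = 2⁻¹ by norm_num [kappa]]
  module

theorem specUV_shift_serU (f : A⟦X⟧) : specUV 1 1 1 0 (serU f) = aff 1 1 f :=
  specUV_serU _ _ _ _ _

theorem specUV_shift_serV (f : A⟦X⟧) : specUV 1 1 1 0 (serV f) = f := by
  rw [specUV_serV, aff_one_zero]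

/-- A relation of the form `(u - v) F(u, v) = G(u, v)` at `u = v + 1`. -/
theorem specUV_shift_relation {F G : A⟦X⟧⟦X⟧}
    (h : (invUVDiff : ℂ⟦X⟧⟦X⟧) • F = (invUV : ℂ⟦X⟧⟦X⟧) • G) :
    specUV 1 1 1 0 F = specUV 1 1 1 0 G := by
  have := congrArg (specUV 1 1 1 0) h
  rw [specUV_smul, specUV_smul, specUV_shift_invUV, specUV_shift_invUVDiff, ← sub_eq_zero,
    ← mul_sub] at this
  exact sub_eq_zero.1 (shift_scalar_cancel this)

theorem scalarSeries_smul (c : ℂ) (s : ℂ⟦X⟧) :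
    (scalarSeries (c • s) : A⟦X⟧) = c • scalarSeries s := by
  ext; simp [scalarSeries]; rw [Algebra.smul_def]

/-- The defining relations of `X(o_3)` at `u = v + 1`. -/
theorem IsExtYangianMatrix.entry_shift {T : Matrix (Fin 3) (Fin 3) A⟦X⟧}
    (hT : IsExtYangianMatrix T) (i j k l : Fin 3) :
    aff 1 1 (T i j) * T k l - T k l * aff 1 1 (T i j) =
      aff 1 1 (T k j) * T i l - T k j * aff 1 1 (T i l)
      - (2 : ℂ) • ((if k = i.rev then ∑ p, aff 1 1 (T p j) * T p.rev l else 0)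
        - (if l = j.rev then ∑ p, T k p.rev * aff 1 1 (T i p) else 0)) := by
  have h := congrArg (specUV 1 1 1 0) (hT.entry i j k l)
  obtain ⟨ν, hν⟩ : ∃ ν, ν = affineInv 1 1 * PowerSeries.X := ⟨_, rfl⟩
  simp only [map_sub, map_mul, specUV_smul, specUV_shift_invUV, specUV_shift_invUVDiff,
    specUV_shift_invUVDiffKappa, ← hν, specUV_shift_serU, specUV_shift_serV,
    apply_ite (specUV 1 1 1 0 : A⟦X⟧⟦X⟧ →+* A⟦X⟧), map_zero, map_sum, scalarSeries_smul] at h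
  have hμ : ∀ z : A⟦X⟧, scalarSeries ν * z = 0 → z = 0 := fun z hz =>
    shift_scalar_cancel (by rwa [← hν])
  set μ : A⟦X⟧ := scalarSeries ν
  have h' : μ * (μ * ((aff 1 1 (T i j) * T k l - T k l * aff 1 1 (T i j)) -
      (aff 1 1 (T k j) * T i l - T k j * aff 1 1 (T i l)
      - (2 : ℂ) • ((if k = i.rev then ∑ p, aff 1 1 (T p j) * T p.rev l else 0)
        - (if l = j.rev then ∑ p, T k p.rev * aff 1 1 (T i p) else 0))))) = 0 := by
    -- Doubling clears u - v - κ = 1 - 1/2. This is the source of the coefficient 2 in front of the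
    -- Q-terms.
    have h2 := congrArg ((2 : ℂ) • ·) (sub_eq_zero.2 h)
    simp only [smul_zero] at h2
    refine Eq.trans ?_ h2
    simp only [mul_sub, smul_sub, mul_smul_comm, smul_mul_assoc, mul_assoc]
    module
  exact sub_eq_zero.1 (hμ _ (hμ _ h'))

end Shift

/-! ### Gauss currents of `X(o_3)` -/

section Gauss

variable {A : Type*} [Ring A] [Algebra ℂ A]

namespace IsExtYangianMatrix

variable {T : Matrix (Fin 3) (Fin 3) A⟦X⟧}

/-- The relation of the first entry with itself reads (u - v - 1) [t(u), t(v)] = 0, and u - v - 1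
can be cancelled. -/
theorem commute_coeff (hT : IsExtYangianMatrix T) (r s : ℕ) :
    Commute (PowerSeries.coeff r (T 0 0)) (PowerSeries.coeff s (T 0 0)) := by
  refine commute_coeff_of_commute_serU_serV ?_ r s
  have h := hT.entry_of_ne (i := 0) (j := 0) (k := 0) (l := 0) (by decide) (by decide)
  have h3 : (invUVDiff - (1 : ℂ) • invUV : ℂ⟦X⟧⟦X⟧) • (serU (T 0 0) * serV (T 0 0) -
      serV (T 0 0) * serU (T 0 0)) = 0 := by
    rw [one_smul, sub_smul, h, sub_self]
  exact sub_eq_zero.1 (invUVDiff_sub_smul_cancel 1 h3)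

theorem commute_serU_serV (hT : IsExtYangianMatrix T) :
    serU (T 0 0) * serV (T 0 0) = serV (T 0 0) * serU (T 0 0) :=
  LowRankYangian.commute_serU_serV hT.commute_coeff

/-- The inverse of `t₋₁₋₁(u)`. -/
def inv (T : Matrix (Fin 3) (Fin 3) A⟦X⟧) : A⟦X⟧ := PowerSeries.invOfUnit (T 0 0) 1

/-- The current `e(u) = t₋₁₋₁(u)⁻¹ t₋₁₀(u)`. -/
def e (T : Matrix (Fin 3) (Fin 3) A⟦X⟧) : A⟦X⟧ := inv T * T 0 1

/-- The current `f(u) = t₀₋₁(u) t₋₁₋₁(u)⁻¹`. -/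
def f (T : Matrix (Fin 3) (Fin 3) A⟦X⟧) : A⟦X⟧ := T 1 0 * inv T

/-- The Cartan current `t₋₁₋₁(u)⁻¹ (t₀₀(u) - f(u) t₋₁₋₁(u) e(u))`. -/
def h (T : Matrix (Fin 3) (Fin 3) A⟦X⟧) : A⟦X⟧ := inv T * (T 1 1 - f T * T 0 0 * e T)

theorem mul_inv (hT : IsExtYangianMatrix T) : T 0 0 * inv T = 1 :=
  PowerSeries.mul_invOfUnit _ _ (by simp [hT.constantCoeff_eq])

theorem inv_mul (hT : IsExtYangianMatrix T) : inv T * T 0 0 = 1 :=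
  PowerSeries.invOfUnit_mul _ _ (by simp [hT.constantCoeff_eq])

theorem mul_e (hT : IsExtYangianMatrix T) : T 0 0 * e T = T 0 1 := by
  rw [e, ← mul_assoc, hT.mul_inv, one_mul]

theorem f_mul (hT : IsExtYangianMatrix T) : f T * T 0 0 = T 1 0 := by
  rw [f, mul_assoc, hT.inv_mul, mul_one]

theorem mul_left_cancel (hT : IsExtYangianMatrix T) {x y : A⟦X⟧} (h : T 0 0 * x = T 0 0 * y) :
    x = y := by
  have := congrArg (inv T * ·) h
  simpa only [← mul_assoc, hT.inv_mul, one_mul] using this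

theorem mul_right_cancel (hT : IsExtYangianMatrix T) {x y : A⟦X⟧} (h : x * T 0 0 = y * T 0 0) :
    x = y := by
  have := congrArg (· * inv T) h
  simpa only [mul_assoc, hT.mul_inv, mul_one] using this

theorem coeff_zero_e (hT : IsExtYangianMatrix T) : PowerSeries.coeff 0 (e T) = 0 := by
  simp [e, hT.constantCoeff_eq]

theorem coeff_zero_f (hT : IsExtYangianMatrix T) : PowerSeries.coeff 0 (f T) = 0 := by
  simp [f, hT.constantCoeff_eq]

/-- For these indices neither k = -i nor l = -j, so Q is absent and the relation is the one of
`Y(gl_2)`. -/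
theorem upper (hT : IsExtYangianMatrix T) :
    (invUVDiff : ℂ⟦X⟧⟦X⟧) • (serU (T 0 0) * serV (e T) - serV (e T) * serU (T 0 0)) =
      (invUV : ℂ⟦X⟧⟦X⟧) • (serU (T 0 0) * (serV (e T) - serU (e T))) := by
  refine gauss_upper (ai' := serV (inv T)) hT.commute_serU_serV
    (by rw [← map_mul, hT.inv_mul, map_one]) ?_
  rw [← map_mul, ← map_mul, hT.mul_e]
  exact hT.entry_of_ne (i := 0) (j := 0) (k := 0) (l := 1) (by decide) (by decide)

theorem lower (hT : IsExtYangianMatrix T) :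
    (invUVDiff : ℂ⟦X⟧⟦X⟧) • (serU (T 0 0) * serV (f T) - serV (f T) * serU (T 0 0)) =
      (invUV : ℂ⟦X⟧⟦X⟧) • ((serU (f T) - serV (f T)) * serU (T 0 0)) := by
  refine gauss_lower (ai' := serV (inv T)) hT.commute_serU_serV
    (by rw [← map_mul, hT.mul_inv, map_one]) ?_
  rw [← map_mul, ← map_mul, hT.f_mul]
  exact hT.entry_of_ne (i := 0) (j := 0) (k := 1) (l := 0) (by decide) (by decide)

theorem cartan_aux (hT : IsExtYangianMatrix T) (r s : ℕ) :
    Commute (PowerSeries.coeff r (T 0 0)) (PowerSeries.coeff s (T 1 1 - f T * T 0 0 * e T)) := by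
  refine commute_coeff_of_commute_serU_serV ?_ r s
  have := gauss_cartan (D' := serV (T 1 1)) hT.commute_serU_serV hT.upper hT.lower (by
    rw [← map_mul, ← map_mul, ← map_mul, ← map_mul, hT.f_mul, hT.mul_e]
    exact hT.entry_of_ne (i := 0) (j := 0) (k := 1) (l := 1) (by decide) (by decide))
  have := sub_eq_zero.1 (invUVDiff_smul_cancel this)
  rw [Commute, SemiconjBy, map_sub, map_mul, map_mul]
  exact this

theorem commute_inv (hT : IsExtYangianMatrix T) {z : A}
    (hz : ∀ r, Commute (PowerSeries.coeff r (T 0 0)) z) (s : ℕ) :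
    Commute (PowerSeries.coeff s (inv T)) z := by
  have h1 : Commute (T 0 0) (PowerSeries.C z) := by
    refine commute_of_coeff fun r s => ?_
    rw [PowerSeries.coeff_C]
    split_ifs
    · exact hz r
    · exact Commute.zero_right _
  have h2 : inv T * PowerSeries.C z = PowerSeries.C z * inv T := by
    apply hT.mul_left_cancel
    rw [← mul_assoc, ← mul_assoc, h1.eq, hT.mul_inv, mul_assoc, hT.mul_inv]
    simp
  have := congrArg (PowerSeries.coeff s) h2
  rwa [PowerSeries.coeff_mul_C, PowerSeries.coeff_C_mul] at this

theorem commute_coeff_h (hT : IsExtYangianMatrix T) (r s : ℕ) :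
    Commute (PowerSeries.coeff r (T 0 0)) (PowerSeries.coeff s (h T)) := by
  rw [h, PowerSeries.coeff_mul]
  refine Commute.sum_right _ _ _ fun p _ => Commute.mul_right ?_ (hT.cartan_aux _ _)
  exact (hT.commute_inv (fun r' => hT.commute_coeff _ _) _).symm

theorem commutator (hT : IsExtYangianMatrix T) :
    (invUVDiff : ℂ⟦X⟧⟦X⟧) • (serU (e T) * serV (f T) - serV (f T) * serU (e T)) =
      (invUV : ℂ⟦X⟧⟦X⟧) • (serU (h T) - serV (h T)) := by
  -- The relation of a(v) with e(u), obtained by exchanging u and v.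
  have hsw := swapUV_relation hT.upper
  simp only [map_sub, map_mul, swapUV_serU, swapUV_serV] at hsw
  rw [← mul_neg, neg_sub] at hsw
  have key := gauss_commutator (h := serU (T 0 0 * h T)) (h' := serV (T 0 0 * h T))
    hT.commute_serU_serV hT.upper hsw hT.lower
  have hD : T 0 0 * h T = T 1 1 - f T * T 0 0 * e T := by
    rw [h, ← mul_assoc, hT.mul_inv, one_mul]
  have hBC := hT.entry_of_ne (i := 0) (j := 1) (k := 1) (l := 0) (by decide) (by decide)
  have h1 : serU (T 0 0 * h T) + serU (f T) * serU (T 0 0) * serU (e T) = serU (T 1 1) := by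
    rw [hD, ← map_mul, ← map_mul, ← map_add, sub_add_cancel]
  have h2 : serV (T 0 0 * h T) + serV (f T) * serV (T 0 0) * serV (e T) = serV (T 1 1) := by
    rw [hD, ← map_mul, ← map_mul, ← map_add, sub_add_cancel]
  rw [h1, h2, ← map_mul serU (T 0 0) (e T), ← map_mul serV (f T), hT.mul_e, hT.f_mul, hBC,
    sub_self, smul_zero] at key
  have key := sub_eq_zero.1 (invUVDiff_smul_cancel key.symm)
  have c1 : serV (h T) * serV (T 0 0) = serV (T 0 0) * serV (h T) := by
    rw [← map_mul, ← map_mul, (commute_of_coeff hT.commute_coeff_h).eq]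
  have c2 : serU (T 0 0) * serV (h T) = serV (h T) * serU (T 0 0) :=
    LowRankYangian.commute_serU_serV hT.commute_coeff_h
  have key2 : serU (T 0 0) * ((invUVDiff : ℂ⟦X⟧⟦X⟧) • (serU (e T) * serV (f T) -
      serV (f T) * serU (e T))) * serV (T 0 0) =
      serU (T 0 0) * ((invUV : ℂ⟦X⟧⟦X⟧) • (serU (h T) - serV (h T))) * serV (T 0 0) := by
    rw [mul_smul_comm, smul_mul_assoc, key, mul_smul_comm, smul_mul_assoc, mul_sub, sub_mul,
      ← map_mul serU, mul_assoc, c1, ← mul_assoc, hT.commute_serU_serV, mul_assoc, c2, ← mul_assoc,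
      map_mul serV]
  have := congrArg (fun z => serU (inv T) * z * serV (inv T)) key2
  have hl : ∀ z, serU (inv T) * (serU (T 0 0) * z) = z := fun z => by
    rw [← mul_assoc, ← map_mul, hT.inv_mul, map_one, one_mul]
  have hr : serV (T 0 0) * serV (inv T) = 1 := by rw [← map_mul, hT.mul_inv, map_one]
  simpa only [mul_assoc, hl, hr, mul_one] using this

theorem coeff_one_e (hT : IsExtYangianMatrix T) :
    PowerSeries.coeff 1 (e T) = PowerSeries.coeff 1 (T 0 1) := by
  rw [← hT.mul_e, coeff_mul_of_right (n := 1) (z := e T)]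
  · simp [hT.constantCoeff_eq]
  · intro m hm
    obtain rfl : m = 0 := by omega
    exact hT.coeff_zero_e

theorem coeff_one_f (hT : IsExtYangianMatrix T) :
    PowerSeries.coeff 1 (f T) = PowerSeries.coeff 1 (T 1 0) := by
  rw [← hT.f_mul, coeff_mul_of_left (n := 1) (z := f T)]
  · simp [hT.constantCoeff_eq]
  · intro m hm
    obtain rfl : m = 0 := by omega
    exact hT.coeff_zero_f

/-- At u = v + 1 the relation of T_01 with itself says that T_02(v) T_00(v+1) + T_01(v) T_01(v+1) +
T_00(v) T_02(v+1) vanishes, and the relation of T_00 with T_02 says that the two outer terms agree.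
Moving e(v) past T_00(v+1) then leaves T_00(v) times the shifted identity, and the shift is
injective. -/
theorem corner_upper (hT : IsExtYangianMatrix T) :
    (2 : ℂ) • T 0 2 = -(T 0 0 * (e T * e T)) := by
  apply aff_injective one_ne_zero 1
  have hBB := hT.entry_shift 0 1 0 1
  have hAG := hT.entry_shift 0 0 0 2
  simp only [Fin.sum_univ_three, show (0 : Fin 3).rev = 2 from rfl,
    show (1 : Fin 3).rev = 1 from rfl, show (2 : Fin 3).rev = 0 from rfl, if_true,
    show ((0 : Fin 3) = 2) = False by decide, if_false, zero_sub] at hBB hAG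
  have hE := specUV_shift_relation hT.upper
  simp only [map_sub, map_mul, specUV_shift_serU, specUV_shift_serV, mul_sub] at hE
  have hE' : e T * aff 1 1 (T 0 0) = aff 1 1 (T 0 0) * aff 1 1 (e T) := by
    rwa [sub_right_inj] at hE
  have hW : T 0 2 * aff 1 1 (T 0 0) + T 0 1 * aff 1 1 (T 0 1) + T 0 0 * aff 1 1 (T 0 2) = 0 := by
    have : (2 : ℂ) • (T 0 2 * aff 1 1 (T 0 0) + T 0 1 * aff 1 1 (T 0 1) +
        T 0 0 * aff 1 1 (T 0 2)) = 0 := by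
      linear_combination (norm := module) -hBB
    exact (smul_eq_zero_iff_right two_ne_zero).1 this
  rw [hW] at hAG
  have hAG' : T 0 2 * aff 1 1 (T 0 0) = T 0 0 * aff 1 1 (T 0 2) := by
    linear_combination (norm := module) -hAG
  rw [hAG'] at hW
  apply hT.mul_left_cancel
  have hB : T 0 1 * aff 1 1 (T 0 1) =
      T 0 0 * (aff 1 1 (T 0 0) * (aff 1 1 (e T) * aff 1 1 (e T))) := by
    rw [← hT.mul_e, map_mul, mul_assoc, ← mul_assoc (e T), hE', mul_assoc]
  rw [hB] at hW
  rw [two_smul, map_add, map_neg, map_mul, map_mul, mul_add, mul_neg]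
  linear_combination (norm := module) hW

/-- The mirror image of `corner_upper`, with the relations of T_10 with itself and of T_00 with
T_20. -/
theorem corner_lower (hT : IsExtYangianMatrix T) :
    (2 : ℂ) • T 2 0 = -(f T * f T * T 0 0) := by
  have hCC := hT.entry_shift 1 0 1 0
  have hAG := hT.entry_shift 0 0 2 0
  simp only [Fin.sum_univ_three, show (0 : Fin 3).rev = 2 from rfl,
    show (1 : Fin 3).rev = 1 from rfl, show (2 : Fin 3).rev = 0 from rfl, if_true,
    show ((0 : Fin 3) = 2) = False by decide, if_false, sub_zero] at hCC hAG
  have hF := specUV_shift_relation hT.lower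
  simp only [map_sub, map_mul, specUV_shift_serU, specUV_shift_serV, sub_mul] at hF
  have hF' : aff 1 1 (T 0 0) * f T = aff 1 1 (f T) * aff 1 1 (T 0 0) := by
    rwa [sub_left_inj] at hF
  have hW : aff 1 1 (T 0 0) * T 2 0 + aff 1 1 (T 1 0) * T 1 0 + aff 1 1 (T 2 0) * T 0 0 = 0 := by
    have : (2 : ℂ) • (aff 1 1 (T 0 0) * T 2 0 + aff 1 1 (T 1 0) * T 1 0 +
        aff 1 1 (T 2 0) * T 0 0) = 0 := by
      linear_combination (norm := module) hCC
    exact (smul_eq_zero_iff_right two_ne_zero).1 this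
  rw [hW] at hAG
  have hAG' : aff 1 1 (T 0 0) * T 2 0 = aff 1 1 (T 2 0) * T 0 0 := by
    linear_combination (norm := module) hAG
  rw [hAG'] at hW
  have hC : aff 1 1 (T 1 0) * T 1 0 =
      aff 1 1 (f T) * aff 1 1 (f T) * aff 1 1 (T 0 0) * T 0 0 := by
    rw [← hT.f_mul, map_mul, mul_assoc, ← mul_assoc (aff 1 1 (T 0 0)), hF']
    simp only [mul_assoc]
  rw [hC] at hW
  apply aff_injective one_ne_zero 1
  apply hT.mul_right_cancel
  rw [two_smul, map_add, map_neg, map_mul, map_mul, add_mul, neg_mul]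
  linear_combination (norm := module) hW

/-- Commuting twice with the leading coefficient of e leads from T_00 through -T_01 = -T_00 e to
T_02, up to sign. Since `corner_upper` knows T_02 in terms of T_00 and e, the commutator of this
coefficient with e is determined. -/
theorem serre_upper (hT : IsExtYangianMatrix T) :
    (2 : ℂ) • (PowerSeries.C (PowerSeries.coeff 1 (e T)) * e T -
      e T * PowerSeries.C (PowerSeries.coeff 1 (e T))) = e T * e T := by
  rw [hT.coeff_one_e]
  set b := PowerSeries.C (PowerSeries.coeff 1 (T 0 1))
  have h1 : b * T 0 0 - T 0 0 * b = -T 0 1 := by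
    simpa using hT.levelOne 0 1 0 0
  have h2 : b * T 0 1 - T 0 1 * b = T 0 2 := by
    simpa using hT.levelOne 0 1 0 1
  have h3 := hT.corner_upper
  rw [← h2, ← hT.mul_e] at h3
  rw [← hT.mul_e] at h1
  apply hT.mul_left_cancel
  rw [mul_smul_comm]
  linear_combination (norm := skip) h3 - (2 : ℂ) • (h1 * e T)
  simp only [mul_sub, sub_mul, smul_sub, neg_mul, mul_assoc]
  module

theorem serre_lower (hT : IsExtYangianMatrix T) :
    (2 : ℂ) • (f T * PowerSeries.C (PowerSeries.coeff 1 (f T)) -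
      PowerSeries.C (PowerSeries.coeff 1 (f T)) * f T) = f T * f T := by
  rw [hT.coeff_one_f]
  set c := PowerSeries.C (PowerSeries.coeff 1 (T 1 0))
  have h1 : c * T 0 0 - T 0 0 * c = T 1 0 := by
    simpa using hT.levelOne 1 0 0 0
  have h2 : c * T 1 0 - T 1 0 * c = -T 2 0 := by
    simpa using hT.levelOne 1 0 1 0
  have h3 := hT.corner_lower
  rw [← neg_eq_iff_eq_neg.2 h2, ← hT.f_mul] at h3
  rw [← hT.f_mul] at h1
  apply hT.mul_right_cancel
  rw [smul_mul_assoc]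
  linear_combination (norm := skip) h3 + (2 : ℂ) • (f T * h1)
  simp only [mul_sub, sub_mul, smul_sub, mul_assoc]
  module

end IsExtYangianMatrix

end Gauss

/-! ### The relations of `Y(gl_2)` from a few of them and covariance -/

section GLCovariance

/-- Two elements `z`, `w` act by commutators on `a, b, c, d` as the elements `e₁₂`, `e₂₁` of `gl_2`
act on the matrix units. -/
structure IsCovariant {S : Type*} [Ring S] (z w a b c d : S) : Prop where
  za : z * a = a * z - b
  zb : z * b = b * z
  zc : z * c = c * z + (a - d)
  zd : z * d = d * z + b
  wa : w * a = a * w + c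
  wb : w * b = b * w + (d - a)
  wc : w * c = c * w
  wd : w * d = d * w - c

/-- The action on d need not be assumed. The brackets of z with c and of w with b express d through
a, b, c, and the relations of `sl_2` for z, w then fix the action on d. -/
theorem IsCovariant.of_sl2 {S : Type*} [Ring S] {z w a b c d : S}
    (za : z * a - a * z = -b) (wa : w * a - a * w = c) (zb : z * b - b * z = 0)
    (wc : w * c - c * w = 0) (zc : z * c - c * z = a - d) (wb : w * b - b * w = d - a)
    (hz : z * (z * w - w * z) - (z * w - w * z) * z = -(2 * z))
    (hw : w * (w * z - z * w) - (w * z - z * w) * w = -(2 * w)) :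
    IsCovariant z w a b c d := by
  have hd : d = a - (z * c - c * z) := by rw [zc]; abel
  have hd' : d = a + (w * b - b * w) := by rw [wb]; abel
  have zd : z * d - d * z = b := by
    have h1 : (z * w - w * z) * b - b * (z * w - w * z) = (z * d - d * z) + b := by
      have : w * b - b * w = d - a := wb
      linear_combination (norm := noncomm_ring) z * wb - wb * z - w * zb + zb * w - za
    -- With c = [w, a], the relation [z, [z, w]] = -2z gives a second expression for [z, [z, c]] =
    -- [z, a - d]. Comparing the two forces [z, d] = b.
    have h2 : z * (z * c - c * z) - (z * c - c * z) * z =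
        2 * b - 2 * ((z * d - d * z) + b) := by
      rw [← h1, ← wa]
      linear_combination (norm := noncomm_ring) hz * a - a * hz + w * (z * za - za * z - zb)
        - (z * za - za * z - zb) * w + 2 * ((z * w - w * z) * za - za * (z * w - w * z)) - 2 * za
    rw [zc] at h2
    linear_combination (norm := noncomm_ring) h2 - za
  have wd : w * d - d * w = -c := by
    have h1 : (w * z - z * w) * c - c * (w * z - z * w) = -(w * d - d * w) + c := by
      linear_combination (norm := noncomm_ring) w * zc - zc * w - z * wc + wc * z + wa
    have h2 : w * (w * b - b * w) - (w * b - b * w) * w =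
        2 * c - 2 * (-(w * d - d * w) + c) := by
      rw [← h1, ← neg_eq_iff_eq_neg.2 za]
      linear_combination (norm := noncomm_ring) -(hw * a) + a * hw - z * (w * wa - wa * w + wc)
        + (w * wa - wa * w + wc) * z - 2 * ((w * z - z * w) * wa - wa * (w * z - z * w)) + 2 * wa
    rw [wb] at h2
    linear_combination (norm := noncomm_ring) -h2 - wa
  exact ⟨by linear_combination (norm := abel) za, by linear_combination (norm := abel) zb,
    by linear_combination (norm := abel) zc, by linear_combination (norm := abel) zd,
    by linear_combination (norm := abel) wa, by linear_combination (norm := abel) wb,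
    by linear_combination (norm := abel) wc, by linear_combination (norm := abel) wd⟩

theorem IsCovariant.map {S S' : Type*} [Ring S] [Ring S'] (σ : S →+* S') {z w a b c d : S}
    (h : IsCovariant z w a b c d) : IsCovariant (σ z) (σ w) (σ a) (σ b) (σ c) (σ d) := by
  obtain ⟨h1, h2, h3, h4, h5, h6, h7, h8⟩ := h
  constructor <;> simp only [← map_mul, ← map_sub, ← map_add, *]

set_option linter.unusedSimpArgs false in
/-- All relations of type `gl_2` between two covariant families follow from the commutation
relations of `a` with `a`, `b`, `c` and of `b` with `c`. -/
theorem IsCovariant.relations {k S : Type*} [CommRing k] [Ring S] [Algebra k S] {d m : k}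
    {z w : S} {t t' : Matrix (Fin 2) (Fin 2) S}
    (h : IsCovariant z w (t 0 0) (t 0 1) (t 1 0) (t 1 1))
    (h' : IsCovariant z w (t' 0 0) (t' 0 1) (t' 1 0) (t' 1 1))
    (aa : t 0 0 * t' 0 0 = t' 0 0 * t 0 0)
    (ab : d • (t 0 0 * t' 0 1 - t' 0 1 * t 0 0) = m • (t 0 0 * t' 0 1 - t' 0 0 * t 0 1))
    (ac : d • (t 0 0 * t' 1 0 - t' 1 0 * t 0 0) = m • (t 1 0 * t' 0 0 - t' 1 0 * t 0 0))
    (bc : d • (t 0 1 * t' 1 0 - t' 1 0 * t 0 1) = m • (t 1 1 * t' 0 0 - t' 1 1 * t 0 0)) :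
    ∀ i j k l, d • (t i j * t' k l - t' k l * t i j) =
      m • (t k j * t' i l - t' k j * t i l) := by
  obtain ⟨za, zb, zc, zd, wa, wb, wc, wd⟩ := h
  obtain ⟨za', zb', zc', zd', wa', wb', wc', wd'⟩ := h'
  have ext : ∀ {p q r : S}, p * q = r → ∀ x, p * (q * x) = r * x :=
    fun e x => by rw [← mul_assoc, e]
  generalize ha : t 0 0 = a, hb : t 0 1 = b, hc : t 1 0 = c, he : t 1 1 = e,
    ha' : t' 0 0 = a', hb' : t' 0 1 = b', hc' : t' 1 0 = c', he' : t' 1 1 = e' at *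
  -- The strategy throughout: commute an established relation with z or w and rewrite by covariance.
  -- Scalars d, m are unaffected. Each commutator produces the next relation, possibly plus known
  -- ones to be subtracted.
  have hz : b * a' + a * b' - b' * a - a' * b = 0 := by
    linear_combination (norm := skip) -(z * aa - aa * z)
    simp only [mul_add, add_mul, mul_sub, sub_mul, mul_smul_comm, smul_mul_assoc, mul_assoc, smul_add,
      smul_sub,
      za, zb, zc, zd, za', zb', zc', zd', ext za, ext zb, ext zc, ext zd, ext za', ext zb', ext zc',
      ext zd']
    simp only [← aa, ext aa.symm, mul_assoc]
    module
  have hw : c * a' + a * c' - c' * a - a' * c = 0 := by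
    linear_combination (norm := skip) w * aa - aa * w
    simp only [mul_add, add_mul, mul_sub, sub_mul, mul_smul_comm, smul_mul_assoc, mul_assoc, smul_add,
      smul_sub,
      wa, wb, wc, wd, wa', wb', wc', wd', ext wa, ext wb, ext wc, ext wd, ext wa', ext wb', ext wc',
      ext wd']
    simp only [← aa, ext aa.symm, mul_assoc]
    module
  have ad : d • (a * e' - e' * a) = m • (c * b' - c' * b) := by
    linear_combination (norm := skip) -(z * ac - ac * z) - bc
    simp only [mul_add, add_mul, mul_sub, sub_mul, mul_smul_comm, smul_mul_assoc, mul_assoc, smul_add,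
      smul_sub, ← aa, ext aa.symm,
      za, zb, zc, zd, za', zb', zc', zd', ext za, ext zb, ext zc, ext zd, ext za', ext zb', ext zc',
      ext zd']
    module
  have cb : d • (c * b' - b' * c) = m • (a * e' - a' * e) := by
    linear_combination (norm := skip) w * ab - ab * w - ad
    simp only [mul_add, add_mul, mul_sub, sub_mul, mul_smul_comm, smul_mul_assoc, mul_assoc, smul_add,
      smul_sub, ← aa, ext aa.symm,
      wa, wb, wc, wd, wa', wb', wc', wd', ext wa, ext wb, ext wc, ext wd, ext wa', ext wb', ext wc',
      ext wd']
    module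
  have ba : d • (b * a' - a' * b) = m • (b * a' - b' * a) := by
    linear_combination (norm := skip) d • hz - ab - m • hz
    simp only [mul_add, add_mul, mul_sub, sub_mul, mul_smul_comm, smul_mul_assoc, mul_assoc, smul_add,
      smul_sub, ← aa, ext aa.symm]
    module
  have ca : d • (c * a' - a' * c) = m • (a * c' - a' * c) := by
    linear_combination (norm := skip) d • hw - ac - m • hw
    simp only [mul_add, add_mul, mul_sub, sub_mul, mul_smul_comm, smul_mul_assoc, mul_assoc, smul_add,
      smul_sub, ← aa, ext aa.symm]
    module
  have da : d • (e * a' - a' * e) = m • (b * c' - b' * c) := by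
    linear_combination (norm := skip) w * ba - ba * w - bc
    simp only [mul_add, add_mul, mul_sub, sub_mul, mul_smul_comm, smul_mul_assoc, mul_assoc, smul_add,
      smul_sub, ← aa, ext aa.symm,
      wa, wb, wc, wd, wa', wb', wc', wd', ext wa, ext wb, ext wc, ext wd, ext wa', ext wb', ext wc',
      ext wd']
    module
  have bb : d • (b * b' - b' * b) = m • (b * b' - b' * b) := by
    linear_combination (norm := skip) -(z * ab - ab * z)
    simp only [mul_add, add_mul, mul_sub, sub_mul, mul_smul_comm, smul_mul_assoc, mul_assoc, smul_add,
      smul_sub, ← aa, ext aa.symm,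
      za, zb, zc, zd, za', zb', zc', zd', ext za, ext zb, ext zc, ext zd, ext za', ext zb', ext zc',
      ext zd']
    module
  have cc : d • (c * c' - c' * c) = m • (c * c' - c' * c) := by
    linear_combination (norm := skip) w * ac - ac * w
    simp only [mul_add, add_mul, mul_sub, sub_mul, mul_smul_comm, smul_mul_assoc, mul_assoc, smul_add,
      smul_sub, ← aa, ext aa.symm,
      wa, wb, wc, wd, wa', wb', wc', wd', ext wa, ext wb, ext wc, ext wd, ext wa', ext wb', ext wc',
      ext wd']
    module
  have bd : d • (b * e' - e' * b) = m • (e * b' - e' * b) := by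
    linear_combination (norm := skip) ab - (z * ad - ad * z)
    simp only [mul_add, add_mul, mul_sub, sub_mul, mul_smul_comm, smul_mul_assoc, mul_assoc, smul_add,
      smul_sub, ← aa, ext aa.symm,
      za, zb, zc, zd, za', zb', zc', zd', ext za, ext zb, ext zc, ext zd, ext za', ext zb', ext zc',
      ext zd']
    module
  have db : d • (e * b' - b' * e) = m • (b * e' - b' * e) := by
    linear_combination (norm := skip) ba - (z * da - da * z)
    simp only [mul_add, add_mul, mul_sub, sub_mul, mul_smul_comm, smul_mul_assoc, mul_assoc, smul_add,
      smul_sub, ← aa, ext aa.symm,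
      za, zb, zc, zd, za', zb', zc', zd', ext za, ext zb, ext zc, ext zd, ext za', ext zb', ext zc',
      ext zd']
    module
  have cd : d • (c * e' - e' * c) = m • (c * e' - c' * e) := by
    linear_combination (norm := skip) ac + (w * ad - ad * w)
    simp only [mul_add, add_mul, mul_sub, sub_mul, mul_smul_comm, smul_mul_assoc, mul_assoc, smul_add,
      smul_sub, ← aa, ext aa.symm,
      wa, wb, wc, wd, wa', wb', wc', wd', ext wa, ext wb, ext wc, ext wd, ext wa', ext wb', ext wc',
      ext wd']
    module
  have dc : d • (e * c' - c' * e) = m • (e * c' - e' * c) := by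
    linear_combination (norm := skip) ca + (w * da - da * w)
    simp only [mul_add, add_mul, mul_sub, sub_mul, mul_smul_comm, smul_mul_assoc, mul_assoc, smul_add,
      smul_sub, ← aa, ext aa.symm,
      wa, wb, wc, wd, wa', wb', wc', wd', ext wa, ext wb, ext wc, ext wd, ext wa', ext wb', ext wc',
      ext wd']
    module
  have dd : d • (e * e' - e' * e) = m • (e * e' - e' * e) := by
    linear_combination (norm := skip) ad + cb - (z * cd - cd * z)
    simp only [mul_add, add_mul, mul_sub, sub_mul, mul_smul_comm, smul_mul_assoc, mul_assoc, smul_add,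
      smul_sub, ← aa, ext aa.symm,
      za, zb, zc, zd, za', zb', zc', zd', ext za, ext zb, ext zc, ext zd, ext za', ext zb', ext zc',
      ext zd']
    module
  intro i j k l
  fin_cases i <;> fin_cases j <;> fin_cases k <;> fin_cases l <;>
    simp only [Fin.mk_one, Fin.zero_eta, ha, hb, hc, he, ha', hb', hc', he'] <;>
    first | assumption | simp only [aa, sub_self, smul_zero]

end GLCovariance

/-! ### Stretching the currents -/

section Stretch

variable {A : Type*} [Ring A] [Algebra ℂ A]

theorem C_smul (z : ℂ) (x : A) : PowerSeries.C (z • x) = z • (PowerSeries.C x : A⟦X⟧) := by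
  ext n
  simp only [PowerSeries.coeff_C, PowerSeries.coeff_smul]
  split_ifs <;> simp

/-- The linear map `S ^ r ↦ f_{r+1}`, so that `f(u)` is the image of `1 / (u - S)`. -/
def moment (f : A⟦X⟧) : Polynomial ℂ →ₗ[ℂ] A :=
  Polynomial.lsum fun r => LinearMap.toSpanSingleton ℂ A (PowerSeries.coeff (r + 1) f)

theorem moment_monomial (f : A⟦X⟧) (r : ℕ) (z : ℂ) :
    moment f (Polynomial.monomial r z) = z • PowerSeries.coeff (r + 1) f := by
  simp [moment, Polynomial.lsum_apply, Polynomial.sum_monomial_index]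

theorem moment_X_pow (f : A⟦X⟧) (r : ℕ) :
    moment f (Polynomial.X ^ r) = PowerSeries.coeff (r + 1) f := by
  rw [Polynomial.X_pow_eq_monomial, moment_monomial, one_smul]

/-- `(1 - q u⁻¹)⁻¹` -/
def geom (q : Polynomial ℂ) : (Polynomial ℂ)⟦X⟧ := PowerSeries.mk fun n => q ^ n

theorem geom_mul (q : Polynomial ℂ) :
    geom q * (1 - PowerSeries.X * PowerSeries.C q) = 1 := by
  ext1 n
  rw [mul_sub, mul_one, ← mul_assoc, map_sub, PowerSeries.coeff_mul_C]
  rcases n with _ | n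
  · simp [geom]
  · simp [geom, PowerSeries.coeff_succ_mul_X, PowerSeries.coeff_one, pow_succ]

/-- `(1 - (1 + q) u⁻¹) / (1 - q u⁻¹)` -/
def ratio (q : Polynomial ℂ) : (Polynomial ℂ)⟦X⟧ := 1 - PowerSeries.X * geom q

theorem ratio_mul (q : Polynomial ℂ) :
    ratio q * (1 - PowerSeries.X * PowerSeries.C q) =
      1 - PowerSeries.X * PowerSeries.C (1 + q) := by
  have := geom_mul q
  rw [ratio, map_add, map_one]
  linear_combination (-PowerSeries.X) * this

theorem constantCoeff_ratio (q : Polynomial ℂ) : PowerSeries.constantCoeff (ratio q) = 1 := by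
  simp [ratio]

/-- `1 + 2 S` -/
def stretchVar : Polynomial ℂ := 1 + 2 * Polynomial.X

theorem two_mul_aff_two_zero_X :
    2 * aff 2 0 (PowerSeries.X : A⟦X⟧) = PowerSeries.X := by
  have h := congrArg (scalarSeries (A := A)) (affineInv_mul_denom (c := 2) two_ne_zero 0)
  rw [map_mul, scalarSeries_X, map_zero, zero_mul, add_zero] at h
  rw [aff_X, ← h, (scalarSeries_commute _ _).eq]
  rw [show PowerSeries.C (2 : ℂ) = 2 from map_ofNat _ 2, map_ofNat]

theorem aff_two_one_X_mul :
    aff 2 1 (PowerSeries.X : A⟦X⟧) * (2 + PowerSeries.X) = PowerSeries.X := by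
  have h := congrArg (scalarSeries (A := A)) (affineInv_mul_denom (c := 2) two_ne_zero 1)
  rw [map_mul, scalarSeries_X, map_one, one_mul, map_add, scalarSeries_X] at h
  rwa [show PowerSeries.C (2 : ℂ) = 2 from map_ofNat _ 2, map_ofNat, ← aff_X] at h

/-- The product telescopes: (2u - 2 - 2S)/(2u - 1 - 2S) · (2u - 1 - 2S)/(2u - 2S) = (u - 1 - S)/(u -
S). This dictates the choice of 1 + 2S as stretch variable. -/
theorem fused_ratio : fused (ratio stretchVar) = ratio Polynomial.X := by
  have h := ratio_mul stretchVar
  have h0 := congrArg (aff 2 0) h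
  have h1 := congrArg (aff 2 1) h
  have h2 := ratio_mul Polynomial.X
  have y0 := two_mul_aff_two_zero_X (A := Polynomial ℂ)
  have y1 := aff_two_one_X_mul (A := Polynomial ℂ)
  rw [fused]
  simp only [stretchVar, map_mul, map_sub, map_one, map_add, map_ofNat, aff_C] at h0 h1 h2 ⊢
  have e2 : (PowerSeries.constantCoeff : (Polynomial ℂ)⟦X⟧ →+* _) 2 = 2 := map_ofNat _ 2
  have n1 : (2 - PowerSeries.X - 2 * PowerSeries.X * PowerSeries.C Polynomial.X :
      (Polynomial ℂ)⟦X⟧) ≠ 0 := fun H => by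
    simpa [e2] using congrArg PowerSeries.constantCoeff H
  have n2 : (2 - 2 * PowerSeries.X * PowerSeries.C Polynomial.X : (Polynomial ℂ)⟦X⟧) ≠ 0 :=
    fun H => by simpa [e2] using congrArg PowerSeries.constantCoeff H
  generalize aff 2 0 (ratio (1 + 2 * Polynomial.X)) = G0,
    aff 2 1 (ratio (1 + 2 * Polynomial.X)) = G1,
    aff 2 0 (PowerSeries.X : (Polynomial ℂ)⟦X⟧) = Y0,
    aff 2 1 (PowerSeries.X : (Polynomial ℂ)⟦X⟧) = Y1 at *
  have k0 : G0 * (2 - PowerSeries.X - 2 * PowerSeries.X * PowerSeries.C Polynomial.X) =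
      2 - 2 * PowerSeries.X - 2 * PowerSeries.X * PowerSeries.C Polynomial.X := by
    linear_combination 2 * h0 + (G0 * (1 + 2 * PowerSeries.C Polynomial.X) -
      (2 + 2 * PowerSeries.C Polynomial.X)) * y0
  have k1 : G1 * (2 - 2 * PowerSeries.X * PowerSeries.C Polynomial.X) =
      2 - PowerSeries.X - 2 * PowerSeries.X * PowerSeries.C Polynomial.X := by
    linear_combination (2 + PowerSeries.X) * h1 + (G1 * (1 + 2 * PowerSeries.C Polynomial.X) -
      (2 + 2 * PowerSeries.C Polynomial.X)) * y1
  refine mul_right_cancel₀ (mul_ne_zero n1 n2) ?_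
  linear_combination G1 * (2 - 2 * PowerSeries.X * PowerSeries.C Polynomial.X) * k0 +
    (2 - 2 * PowerSeries.X - 2 * PowerSeries.X * PowerSeries.C Polynomial.X) * k1 -
    2 * (2 - PowerSeries.X - 2 * PowerSeries.X * PowerSeries.C Polynomial.X) * h2

variable (J : Polynomial ℂ →ₗ[ℂ] A)

/-- The series u⁻¹ J((1 - q u⁻¹)⁻¹) is J(1/(u - q)). The intertwining relation for P = 1 is the
lowest coefficient of the current relation; for P = q^r (1 - q u⁻¹), which cancels the denominator
of the ratio, it is the recursion. -/
theorem upper_relation_of_intertwine {a : A⟦X⟧} {q : Polynomial ℂ}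
    (h : ∀ P, coeffwise J P * a = a * coeffwise J (P * ratio q)) :
    (invUVDiff : ℂ⟦X⟧⟦X⟧) • (serU a * serV (PowerSeries.X * coeffwise J (geom q)) -
        serV (PowerSeries.X * coeffwise J (geom q)) * serU a) =
      (invUV : ℂ⟦X⟧⟦X⟧) • (serU a * (serV (PowerSeries.X * coeffwise J (geom q)) -
        serU (PowerSeries.X * coeffwise J (geom q)))) := by
  have hc (r : ℕ) : PowerSeries.C (PowerSeries.coeff (r + 1)
      (PowerSeries.X * coeffwise J (geom q))) = coeffwise J (PowerSeries.C (q ^ r)) := by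
    rw [PowerSeries.coeff_succ_X_mul, coeff_coeffwise, coeffwise_C, geom, PowerSeries.coeff_mk]
  rw [upper_relation_iff (by simp)]
  constructor
  · have := h 1
    rw [one_mul, ratio, map_sub, coeffwise_X_mul, mul_sub] at this
    rw [show (1 : ℕ) = 0 + 1 from rfl, hc, pow_zero, map_one, this]
    abel
  · intro r
    have := h (PowerSeries.C (q ^ r) * (1 - PowerSeries.X * PowerSeries.C q))
    rw [mul_assoc, mul_comm _ (ratio q), ratio_mul] at this
    rw [map_add, hc, hc]
    have e1 : PowerSeries.C (q ^ r) * (1 - PowerSeries.X * PowerSeries.C q) =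
        PowerSeries.C (q ^ r) - PowerSeries.X * PowerSeries.C (q ^ (r + 1)) := by
      rw [pow_succ, map_mul]; ring
    have e2 : PowerSeries.C (q ^ r) * (1 - PowerSeries.X * PowerSeries.C (1 + q)) =
        PowerSeries.C (q ^ r) - PowerSeries.X *
          (PowerSeries.C (q ^ r) + PowerSeries.C (q ^ (r + 1))) := by
      rw [pow_succ, map_mul, map_add, map_one]; ring
    rw [e1, e2, map_sub, map_sub, coeffwise_X_mul, coeffwise_X_mul, map_add] at this
    rw [sub_mul, mul_sub, mul_assoc, ← mul_assoc a, (PowerSeries.commute_X a).eq, mul_assoc]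
      at this
    exact this

theorem lower_relation_of_intertwine {a : A⟦X⟧} {q : Polynomial ℂ}
    (h : ∀ P, a * coeffwise J P = coeffwise J (P * ratio q) * a) :
    (invUVDiff : ℂ⟦X⟧⟦X⟧) • (serU a * serV (PowerSeries.X * coeffwise J (geom q)) -
        serV (PowerSeries.X * coeffwise J (geom q)) * serU a) =
      (invUV : ℂ⟦X⟧⟦X⟧) • ((serU (PowerSeries.X * coeffwise J (geom q)) -
        serV (PowerSeries.X * coeffwise J (geom q))) * serU a) := by
  have hc (r : ℕ) : PowerSeries.C (PowerSeries.coeff (r + 1)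
      (PowerSeries.X * coeffwise J (geom q))) = coeffwise J (PowerSeries.C (q ^ r)) := by
    rw [PowerSeries.coeff_succ_X_mul, coeff_coeffwise, coeffwise_C, geom, PowerSeries.coeff_mk]
  rw [lower_relation_iff (by simp)]
  constructor
  · have := h 1
    rw [one_mul, ratio, map_sub, coeffwise_X_mul, sub_mul] at this
    rw [show (1 : ℕ) = 0 + 1 from rfl, hc, pow_zero, map_one, this]
    abel
  · intro r
    have := h (PowerSeries.C (q ^ r) * (1 - PowerSeries.X * PowerSeries.C q))
    rw [mul_assoc, mul_comm _ (ratio q), ratio_mul] at this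
    rw [map_add, hc, hc]
    have e1 : PowerSeries.C (q ^ r) * (1 - PowerSeries.X * PowerSeries.C q) =
        PowerSeries.C (q ^ r) - PowerSeries.X * PowerSeries.C (q ^ (r + 1)) := by
      rw [pow_succ, map_mul]; ring
    have e2 : PowerSeries.C (q ^ r) * (1 - PowerSeries.X * PowerSeries.C (1 + q)) =
        PowerSeries.C (q ^ r) - PowerSeries.X *
          (PowerSeries.C (q ^ r) + PowerSeries.C (q ^ (r + 1))) := by
      rw [pow_succ, map_mul, map_add, map_one]; ring
    rw [e1, e2, map_sub, map_sub, coeffwise_X_mul, coeffwise_X_mul, map_add] at this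
    rw [mul_sub, sub_mul, mul_assoc, ← mul_assoc a, (PowerSeries.commute_X a).eq, mul_assoc]
      at this
    exact this

theorem addHom_C_eq_zero {B : Type*} [Ring B] [Algebra ℂ B] {δ : (Polynomial ℂ)⟦X⟧ →+ B⟦X⟧}
    (h : ∀ (z : ℂ) r, δ (PowerSeries.C (Polynomial.monomial r z)) = 0) (p : Polynomial ℂ) :
    δ (PowerSeries.C p) = 0 := by
  induction p using Polynomial.induction_on' with
  | add p q hp hq => rw [map_add, map_add, hp, hq, add_zero]
  | monomial r z => exact h z r

/-- The recursion for the coefficients of e is the intertwining relation for P = S^r (1 - S u⁻¹). It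
extends to P = P' (1 - S u⁻¹) for every P' by additivity and linearity in u⁻¹. All series have this
form, because 1 - S u⁻¹ is invertible. -/
theorem intertwine_of_upper_relation {a e : A⟦X⟧} (he : PowerSeries.coeff 0 e = 0)
    (h : (invUVDiff : ℂ⟦X⟧⟦X⟧) • (serU a * serV e - serV e * serU a) =
      (invUV : ℂ⟦X⟧⟦X⟧) • (serU a * (serV e - serU e))) (P : (Polynomial ℂ)⟦X⟧) :
    coeffwise (moment e) P * a = a * coeffwise (moment e) (P * ratio Polynomial.X) := by
  have h2 := ((upper_relation_iff he).1 h).2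
  -- The defect with the denominator 1 - S u⁻¹ cleared, so that on monomials it involves only two
  -- neighbouring moments.
  let δ : (Polynomial ℂ)⟦X⟧ →+ A⟦X⟧ :=
    { toFun := fun P => coeffwise (moment e) (P * (1 - PowerSeries.X * PowerSeries.C Polynomial.X))
          * a - a * coeffwise (moment e)
            (P * (1 - PowerSeries.X * PowerSeries.C (1 + Polynomial.X)))
      map_zero' := by simp
      map_add' := fun P Q => by simp only [add_mul, mul_add, map_add]; abel }
  have hδ : ∀ P, δ P = 0 := by
    refine eq_zero_of_const (fun P => ?_) (addHom_C_eq_zero fun z r => ?_)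
    · change coeffwise _ (PowerSeries.X * P * _) * a - a * coeffwise _ (PowerSeries.X * P * _) =
        PowerSeries.X * (_ - _)
      rw [mul_assoc, mul_assoc, coeffwise_X_mul, coeffwise_X_mul, ← mul_assoc a,
        (PowerSeries.commute_X a).eq, mul_sub (PowerSeries.X : A⟦X⟧), mul_assoc, mul_assoc]
    · change coeffwise _ _ * a - a * coeffwise _ _ = 0
      have e1 : PowerSeries.C (Polynomial.monomial r z) *
          (1 - PowerSeries.X * PowerSeries.C Polynomial.X) =
          PowerSeries.C (Polynomial.monomial r z) -
            PowerSeries.X * PowerSeries.C (Polynomial.monomial (r + 1) z) := by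
        rw [← Polynomial.monomial_mul_X, map_mul]; ring
      have e2 : PowerSeries.C (Polynomial.monomial r z) *
          (1 - PowerSeries.X * PowerSeries.C (1 + Polynomial.X)) =
          PowerSeries.C (Polynomial.monomial r z) - PowerSeries.X *
            (PowerSeries.C (Polynomial.monomial r z) +
              PowerSeries.C (Polynomial.monomial (r + 1) z)) := by
        rw [← Polynomial.monomial_mul_X, map_mul, map_add, map_one]; ring
      rw [e1, e2, map_sub, map_sub, coeffwise_X_mul, coeffwise_X_mul, map_add, coeffwise_C,
        coeffwise_C, moment_monomial, moment_monomial, sub_mul, mul_sub, ← mul_assoc a,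
        (PowerSeries.commute_X a).eq, mul_assoc, mul_assoc, ← map_add, ← smul_add]
      have := congrArg (z • ·) (h2 r)
      simp only [C_smul, smul_mul_assoc, mul_smul_comm] at this ⊢
      rw [← smul_sub, ← smul_sub, this, sub_self]
  have := hδ (P * geom Polynomial.X)
  change coeffwise _ _ * a - a * coeffwise _ _ = 0 at this
  rw [mul_assoc, geom_mul, mul_one, sub_eq_zero] at this
  rw [this, ← ratio_mul]
  congr 2
  linear_combination (P * ratio Polynomial.X) * geom_mul Polynomial.X

theorem intertwine_of_lower_relation {a f : A⟦X⟧} (hf : PowerSeries.coeff 0 f = 0)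
    (h : (invUVDiff : ℂ⟦X⟧⟦X⟧) • (serU a * serV f - serV f * serU a) =
      (invUV : ℂ⟦X⟧⟦X⟧) • ((serU f - serV f) * serU a)) (P : (Polynomial ℂ)⟦X⟧) :
    a * coeffwise (moment f) P = coeffwise (moment f) (P * ratio Polynomial.X) * a := by
  have h2 := ((lower_relation_iff hf).1 h).2
  let δ : (Polynomial ℂ)⟦X⟧ →+ A⟦X⟧ :=
    { toFun := fun P => a * coeffwise (moment f)
          (P * (1 - PowerSeries.X * PowerSeries.C Polynomial.X)) - coeffwise (moment f)
            (P * (1 - PowerSeries.X * PowerSeries.C (1 + Polynomial.X))) * a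
      map_zero' := by simp
      map_add' := fun P Q => by simp only [add_mul, mul_add, map_add]; abel }
  have hδ : ∀ P, δ P = 0 := by
    refine eq_zero_of_const (fun P => ?_) (addHom_C_eq_zero fun z r => ?_)
    · change a * coeffwise _ (PowerSeries.X * P * _) - coeffwise _ (PowerSeries.X * P * _) * a =
        PowerSeries.X * (_ - _)
      rw [mul_assoc, mul_assoc, coeffwise_X_mul, coeffwise_X_mul, ← mul_assoc a,
        (PowerSeries.commute_X a).eq, mul_sub (PowerSeries.X : A⟦X⟧), mul_assoc, mul_assoc]
    · change a * coeffwise _ _ - coeffwise _ _ * a = 0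
      have e1 : PowerSeries.C (Polynomial.monomial r z) *
          (1 - PowerSeries.X * PowerSeries.C Polynomial.X) =
          PowerSeries.C (Polynomial.monomial r z) -
            PowerSeries.X * PowerSeries.C (Polynomial.monomial (r + 1) z) := by
        rw [← Polynomial.monomial_mul_X, map_mul]; ring
      have e2 : PowerSeries.C (Polynomial.monomial r z) *
          (1 - PowerSeries.X * PowerSeries.C (1 + Polynomial.X)) =
          PowerSeries.C (Polynomial.monomial r z) - PowerSeries.X *
            (PowerSeries.C (Polynomial.monomial r z) +
              PowerSeries.C (Polynomial.monomial (r + 1) z)) := by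
        rw [← Polynomial.monomial_mul_X, map_mul, map_add, map_one]; ring
      rw [e1, e2, map_sub, map_sub, coeffwise_X_mul, coeffwise_X_mul, map_add, coeffwise_C,
        coeffwise_C, moment_monomial, moment_monomial, sub_mul, mul_sub, ← mul_assoc a,
        (PowerSeries.commute_X a).eq, mul_assoc, mul_assoc, ← map_add, ← smul_add]
      have := congrArg (z • ·) (h2 r)
      simp only [C_smul, smul_mul_assoc, mul_smul_comm] at this ⊢
      rw [← smul_sub, ← smul_sub, this, sub_self]
  have := hδ (P * geom Polynomial.X)
  change a * coeffwise _ _ - coeffwise _ _ * a = 0 at this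
  rw [mul_assoc, geom_mul, mul_one, sub_eq_zero] at this
  rw [this, ← ratio_mul]
  congr 2
  linear_combination (P * ratio Polynomial.X) * geom_mul Polynomial.X

/-- The series `f̃(u)` with `f̃(2u + 1) = f(u) / 2`. -/
def stretch (f : A⟦X⟧) : A⟦X⟧ := PowerSeries.X * coeffwise (moment f) (geom stretchVar)

theorem coeff_zero_stretch (f : A⟦X⟧) : PowerSeries.coeff 0 (stretch f) = 0 := by
  simp [stretch]

theorem coeff_succ_stretch (f : A⟦X⟧) (r : ℕ) :
    PowerSeries.coeff (r + 1) (stretch f) = moment f (stretchVar ^ r) := by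
  rw [stretch, PowerSeries.coeff_succ_X_mul, coeff_coeffwise, geom, PowerSeries.coeff_mk]

theorem coeff_one_stretch (f : A⟦X⟧) :
    PowerSeries.coeff 1 (stretch f) = PowerSeries.coeff 1 f := by
  rw [coeff_succ_stretch, pow_zero, ← pow_zero Polynomial.X, moment_X_pow]

theorem X_mul_coeffwise_geom_X {f : A⟦X⟧} (hf : PowerSeries.coeff 0 f = 0) :
    PowerSeries.X * coeffwise (moment f) (geom Polynomial.X) = f := by
  ext n
  rcases n with _ | n
  · rw [hf, PowerSeries.coeff_zero_X_mul]
  · rw [PowerSeries.coeff_succ_X_mul, coeff_coeffwise, geom, PowerSeries.coeff_mk, moment_X_pow]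

/-- At 2u + 1 the kernel 1/(u - (1 + 2S)) becomes 1/(2(u - S)). -/
theorem aff_stretch {f : A⟦X⟧} (hf : PowerSeries.coeff 0 f = 0) :
    (2 : ℂ) • aff 2 1 (stretch f) = f := by
  have y1 := aff_two_one_X_mul (A := Polynomial ℂ)
  have h := congrArg (aff 2 1) (geom_mul stretchVar)
  simp only [stretchVar, map_mul, map_sub, map_one, map_add, map_ofNat, aff_C] at h
  have e : (2 : ℂ) • (aff 2 1 (PowerSeries.X * geom stretchVar)) =
      PowerSeries.X * geom Polynomial.X := by
    have h2 := geom_mul Polynomial.X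
    rw [two_smul, map_mul]
    simp only [stretchVar]
    have e2 : (PowerSeries.constantCoeff : (Polynomial ℂ)⟦X⟧ →+* _) 2 = 2 := map_ofNat _ 2
    have n2 : (2 - 2 * PowerSeries.X * PowerSeries.C Polynomial.X : (Polynomial ℂ)⟦X⟧) ≠ 0 :=
      fun H => by simpa [e2] using congrArg PowerSeries.constantCoeff H
    generalize aff 2 1 (geom (1 + 2 * Polynomial.X)) = G,
      aff 2 1 (PowerSeries.X : (Polynomial ℂ)⟦X⟧) = Y at *
    have k : G * (2 - 2 * PowerSeries.X * PowerSeries.C Polynomial.X) = 2 + PowerSeries.X := by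
      linear_combination (2 + PowerSeries.X) * h +
        (G * (1 + 2 * PowerSeries.C Polynomial.X)) * y1
    refine mul_right_cancel₀ n2 ?_
    linear_combination 2 * Y * k + 2 * y1 - 2 * PowerSeries.X * h2
  rw [stretch, ← coeffwise_X_mul, ← coeffwise_aff]
  conv_rhs => rw [← X_mul_coeffwise_geom_X hf, ← coeffwise_X_mul, ← e]
  ext n
  simp [coeff_coeffwise]

/-- The right-hand side depends only on the product p q, so replacing S by any polynomial in all
three currents preserves commutator relations of this kind. -/
theorem moment_commutator {e f h : A⟦X⟧} (H : ∀ r s, PowerSeries.coeff (r + 1) e *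
      PowerSeries.coeff (s + 1) f - PowerSeries.coeff (s + 1) f * PowerSeries.coeff (r + 1) e =
      - PowerSeries.coeff (r + s + 1) h) (p q : Polynomial ℂ) :
    moment e p * moment f q - moment f q * moment e p = -moment h (p * q) := by
  induction p using Polynomial.induction_on' with
  | add p p' hp hp' =>
    rw [map_add, add_mul, mul_add, add_mul, map_add, neg_add, ← hp, ← hp']
    abel
  | monomial r z =>
    induction q using Polynomial.induction_on' with
    | add p p' hp hp' =>
      rw [map_add, add_mul, mul_add, mul_add, map_add, neg_add, ← hp, ← hp']
      abel
    | monomial s w =>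
      rw [Polynomial.monomial_mul_monomial, moment_monomial, moment_monomial, moment_monomial,
        ← smul_neg, ← H]
      simp only [smul_mul_assoc, mul_smul_comm, smul_sub, smul_smul, mul_comm w]

end Stretch

/-! ### From Gauss factors to a matrix satisfying the `gl_2` relations -/

section GLMatrix

variable {A : Type*} [Ring A] [Algebra ℂ A]

/-- The matrix `t` satisfies the defining relations of the Yangian `Y(gl_N)`. -/
structure IsGLMatrix {N : ℕ} (t : Matrix (Fin N) (Fin N) A⟦X⟧) : Prop where
  constantCoeff_eq : ∀ i j, PowerSeries.constantCoeff (t i j) = if i = j then 1 else 0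
  relation : ∀ i j k l,
    (invUVDiff : ℂ⟦X⟧⟦X⟧) • (serU (t i j) * serV (t k l) - serV (t k l) * serU (t i j)) =
      (invUV : ℂ⟦X⟧⟦X⟧) • (serU (t k j) * serV (t i l) - serV (t k j) * serU (t i l))

/-- The factors of the Gauss decomposition of a `2 × 2` matrix satisfying the relations of
`Y(gl_2)`. -/
structure IsGaussData (a E F K : A⟦X⟧) : Prop where
  const_a : PowerSeries.constantCoeff a = 1
  const_E : PowerSeries.coeff 0 E = 0
  const_F : PowerSeries.coeff 0 F = 0
  const_K : PowerSeries.constantCoeff K = 1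
  commute_a : ∀ r s, Commute (PowerSeries.coeff r a) (PowerSeries.coeff s a)
  commute_K : ∀ r s, Commute (PowerSeries.coeff r a) (PowerSeries.coeff s K)
  upper : (invUVDiff : ℂ⟦X⟧⟦X⟧) • (serU a * serV E - serV E * serU a) =
    (invUV : ℂ⟦X⟧⟦X⟧) • (serU a * (serV E - serU E))
  lower : (invUVDiff : ℂ⟦X⟧⟦X⟧) • (serU a * serV F - serV F * serU a) =
    (invUV : ℂ⟦X⟧⟦X⟧) • ((serU F - serV F) * serU a)
  commutator : (invUVDiff : ℂ⟦X⟧⟦X⟧) • (serU E * serV F - serV F * serU E) =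
    (invUV : ℂ⟦X⟧⟦X⟧) • (serU K - serV K)
  serre_upper : PowerSeries.C (PowerSeries.coeff 1 E) * E -
    E * PowerSeries.C (PowerSeries.coeff 1 E) = E * E
  serre_lower : F * PowerSeries.C (PowerSeries.coeff 1 F) -
    PowerSeries.C (PowerSeries.coeff 1 F) * F = F * F
  weight_E : PowerSeries.coeff 1 E * PowerSeries.coeff 1 K -
    PowerSeries.coeff 1 K * PowerSeries.coeff 1 E = 2 * PowerSeries.coeff 1 E
  weight_F : PowerSeries.coeff 1 F * PowerSeries.coeff 1 K -
    PowerSeries.coeff 1 K * PowerSeries.coeff 1 F = -(2 * PowerSeries.coeff 1 F)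

/-- The matrix with a given Gauss decomposition. -/
def gaussMatrix (a E F K : A⟦X⟧) : Matrix (Fin 2) (Fin 2) A⟦X⟧ :=
  !![a, a * E; F * a, a * K + F * a * E]

theorem commutator_coeff_one {b c : A⟦X⟧} {G : A⟦X⟧⟦X⟧} (hb : PowerSeries.coeff 0 b = 0)
    (h : (invUVDiff : ℂ⟦X⟧⟦X⟧) • (serU b * serV c - serV c * serU b) =
      (invUV : ℂ⟦X⟧⟦X⟧) • G) :
    PowerSeries.C (PowerSeries.coeff 1 b) * c - c * PowerSeries.C (PowerSeries.coeff 1 b) =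
      coeffU 0 G := by
  have := congrArg (coeffU 1) h
  rw [coeffU_one_invUVDiff_smul, coeffU_one_invUV_smul, map_sub, map_sub,
    coeffU_serU_mul_serV, coeffU_serV_mul_serU, coeffU_serU_mul_serV, coeffU_serV_mul_serU, hb]
    at this
  simp only [map_zero, zero_mul, mul_zero, sub_zero] at this
  ext n
  simpa [PowerSeries.coeff_succ_X_mul] using congrArg (PowerSeries.coeff (n + 1)) this

namespace IsGaussData

variable {a E F K : A⟦X⟧}

theorem relation_aa (H : IsGaussData a E F K) : serU a * serV a = serV a * serU a :=
  commute_serU_serV H.commute_a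

theorem relation_ab (H : IsGaussData a E F K) : (invUVDiff : ℂ⟦X⟧⟦X⟧) •
    (serU a * serV (a * E) - serV (a * E) * serU a) =
      (invUV : ℂ⟦X⟧⟦X⟧) • (serU a * serV (a * E) - serV a * serU (a * E)) := by
  have := congrArg (serV a * ·) H.upper
  simp only [mul_smul_comm, mul_sub, map_mul, ← mul_assoc, ← H.relation_aa] at this ⊢
  exact this

theorem relation_ac (H : IsGaussData a E F K) : (invUVDiff : ℂ⟦X⟧⟦X⟧) •
    (serU a * serV (F * a) - serV (F * a) * serU a) =
      (invUV : ℂ⟦X⟧⟦X⟧) • (serU (F * a) * serV a - serV (F * a) * serU a) := by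
  have := congrArg (· * serV a) H.lower
  simp only [smul_mul_assoc, sub_mul, map_mul, mul_assoc, H.relation_aa] at this ⊢
  exact this

/-- `gauss_commutator` read from right to left: its right-hand side vanishes by the commutator
relation of E and F, as K commutes with a. -/
theorem relation_bc (H : IsGaussData a E F K) : (invUVDiff : ℂ⟦X⟧⟦X⟧) •
    (serU (a * E) * serV (F * a) - serV (F * a) * serU (a * E)) =
      (invUV : ℂ⟦X⟧⟦X⟧) • (serU (a * K + F * a * E) * serV a -
        serV (a * K + F * a * E) * serU a) := by
  have hsw := swapUV_relation H.upper
  simp only [map_sub, map_mul, swapUV_serU, swapUV_serV] at hsw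
  rw [← mul_neg, neg_sub] at hsw
  have key := gauss_commutator (h := serU (a * K)) (h' := serV (a * K)) H.relation_aa H.upper hsw
    H.lower
  have c1 : serV K * serV a = serV a * serV K := by
    rw [← map_mul, ← map_mul, (commute_of_coeff H.commute_K).eq]
  have c2 : serU a * serV K = serV K * serU a := commute_serU_serV H.commute_K
  have key2 := congrArg (fun z => serU a * z * serV a) H.commutator
  simp only [mul_smul_comm, smul_mul_assoc] at key2
  rw [key2, ← smul_sub, map_mul, map_mul,
    show serU a * (serU K - serV K) * serV a - (serU a * serU K * serV a -
      serV a * serV K * serU a) = 0 by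
    rw [mul_sub, sub_mul, mul_assoc (serU a) (serV K), c1, ← mul_assoc, H.relation_aa,
      mul_assoc (serV a), c2, ← mul_assoc]
    abel, smul_zero, smul_zero] at key
  simpa only [map_add, map_mul] using sub_eq_zero.1 (invUVDiff_smul_cancel key)

theorem coeff_one_b (H : IsGaussData a E F K) :
    PowerSeries.coeff 1 (a * E) = PowerSeries.coeff 1 E := by
  rw [coeff_mul_of_right (n := 1) (z := E), H.const_a, one_mul]
  intro m hm
  obtain rfl : m = 0 := by omega
  exact H.const_E

theorem coeff_one_c (H : IsGaussData a E F K) :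
    PowerSeries.coeff 1 (F * a) = PowerSeries.coeff 1 F := by
  rw [coeff_mul_of_left (n := 1) (z := F), H.const_a, mul_one]
  intro m hm
  obtain rfl : m = 0 := by omega
  exact H.const_F

/-- The level-one coefficients of E and F play the roles of e_12 and e_21. The lowest coefficients
of the upper and lower relations give the action on a, and the Serre relations then give commutation
with a E and F a respectively. Level one of `relation_bc`, in both orders of the variables, brings
in the last entry. The weights provide the `sl_2` relations needed by `IsCovariant.of_sl2`. -/
theorem isCovariant (H : IsGaussData a E F K) :
    IsCovariant (PowerSeries.C (PowerSeries.coeff 1 E)) (PowerSeries.C (PowerSeries.coeff 1 F))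
      a (a * E) (F * a) (a * K + F * a * E) := by
  have hu := ((upper_relation_iff H.const_E).1 H.upper).1
  have hl := ((lower_relation_iff H.const_F).1 H.lower).1
  have hsE := H.serre_upper
  have hsF := H.serre_lower
  have h11 := (commutator_relation_iff H.const_E H.const_F).1 H.commutator 0 0
  have a0 : PowerSeries.coeff 0 a = 1 := by simpa using H.const_a
  have b0 : PowerSeries.coeff 0 (a * E) = 0 := by
    have := H.const_E
    simp only [PowerSeries.coeff_zero_eq_constantCoeff, map_mul] at this ⊢
    rw [this, mul_zero]
  have c0 : PowerSeries.coeff 0 (F * a) = 0 := by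
    have := H.const_F
    simp only [PowerSeries.coeff_zero_eq_constantCoeff, map_mul] at this ⊢
    rw [this, zero_mul]
  have d0 : PowerSeries.coeff 0 (a * K + F * a * E) = 1 := by
    have := H.const_F
    simp only [PowerSeries.coeff_zero_eq_constantCoeff, map_mul, map_add, H.const_a,
      H.const_K] at this ⊢
    rw [this, zero_mul, zero_mul, one_mul, add_zero]
  have hz := commutator_coeff_one b0 H.relation_bc
  have hw := swapUV_relation H.relation_bc
  simp only [map_sub (swapUV (A := A)), map_mul (swapUV (A := A)), swapUV_serU, swapUV_serV] at hw
  have hw := commutator_coeff_one c0 (by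
    rw [← neg_sub, smul_neg, hw, ← smul_neg, neg_neg])
  rw [map_sub, coeffU_serU_mul_serV, coeffU_serV_mul_serU, a0, d0, map_one, one_mul, mul_one]
    at hz hw
  rw [H.coeff_one_b] at hz
  rw [H.coeff_one_c] at hw
  have hzw : PowerSeries.C (PowerSeries.coeff 1 E) * PowerSeries.C (PowerSeries.coeff 1 F) -
      PowerSeries.C (PowerSeries.coeff 1 F) * PowerSeries.C (PowerSeries.coeff 1 E) =
      -PowerSeries.C (PowerSeries.coeff 1 K) := by
    simpa only [map_sub, map_mul, map_neg, zero_add] using congrArg PowerSeries.C h11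
  have wE := congrArg (PowerSeries.C : A →+* A⟦X⟧) H.weight_E
  have wF := congrArg (PowerSeries.C : A →+* A⟦X⟧) H.weight_F
  simp only [map_sub, map_mul, map_neg, map_ofNat] at wE wF
  generalize PowerSeries.C (PowerSeries.coeff 1 E) = z,
    PowerSeries.C (PowerSeries.coeff 1 F) = w, PowerSeries.C (PowerSeries.coeff 1 K) = k at *
  refine IsCovariant.of_sl2 ?_ hl ?_ ?_ hz ?_ ?_ ?_
  · rw [← hu, neg_sub]
  · linear_combination (norm := noncomm_ring) -hu * E + a * hsE
  · linear_combination (norm := noncomm_ring) F * hl - hsF * a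
  · exact hw
  · rw [hzw]
    linear_combination (norm := noncomm_ring) -wE
  · rw [← neg_sub (z * w), hzw]
    linear_combination (norm := noncomm_ring) wF

theorem isGLMatrix (H : IsGaussData a E F K) : IsGLMatrix (gaussMatrix a E F K) where
  constantCoeff_eq i j := by
    have h1 := H.const_E
    have h2 := H.const_F
    rw [PowerSeries.coeff_zero_eq_constantCoeff] at h1 h2
    fin_cases i <;> fin_cases j <;> simp [gaussMatrix, H.const_a, H.const_K, h1, h2]
  relation := by
    have hU := H.isCovariant.map serU
    have hV := H.isCovariant.map serV
    -- Constants are the same series in u and in v, so one pair z, w acts on both families.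
    have hC (x : A) : serV (PowerSeries.C x) = serU (PowerSeries.C x) := by
      rw [serV, serU, PowerSeries.map_C]
    rw [hC, hC] at hV
    exact IsCovariant.relations (t := (gaussMatrix a E F K).map serU)
      (t' := (gaussMatrix a E F K).map serV) hU hV H.relation_aa H.relation_ab H.relation_ac
      H.relation_bc

end IsGaussData

end GLMatrix

/-! ### Gauss data of `Y(gl_2)` inside `X(o_3)` -/

section Root

variable {A : Type*} [Ring A] [Algebra ℂ A]

/-- The complex number `√2`. -/
def sqrtTwo : ℂ := ((Real.sqrt 2 : ℝ) : ℂ)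

theorem sqrtTwo_mul_self : sqrtTwo * sqrtTwo = 2 := by
  rw [sqrtTwo, ← Complex.ofReal_mul, Real.mul_self_sqrt zero_le_two, Complex.ofReal_ofNat]

theorem sqrtTwo_ne_zero : sqrtTwo ≠ 0 := fun h => by
  have := sqrtTwo_mul_self
  rw [h, zero_mul] at this
  exact two_ne_zero this.symm

theorem commute_of_mem_adjoin {s : Set A} {z x : A} (h : ∀ y ∈ s, Commute y z)
    (hx : x ∈ Algebra.adjoin ℂ s) : Commute x z := by
  have : Algebra.adjoin ℂ s ≤ Subalgebra.centralizer ℂ {z} := by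
    refine Algebra.adjoin_le fun y hy => ?_
    rw [SetLike.mem_coe, Subalgebra.mem_centralizer_iff]
    rintro _ rfl
    exact (h y hy).symm.eq
  have := this hx
  rw [Subalgebra.mem_centralizer_iff] at this
  exact (this z rfl).symm

theorem commute_moment {f : A⟦X⟧} {x : A} (h : ∀ r, Commute x (PowerSeries.coeff r f))
    (p : Polynomial ℂ) : Commute x (moment f p) := by
  induction p using Polynomial.induction_on' with
  | add p q hp hq => rw [map_add]; exact hp.add_right hq
  | monomial r z => rw [moment_monomial]; exact (h _).smul_right z

theorem commute_coeff_stretch {f : A⟦X⟧} {x : A} (h : ∀ r, Commute x (PowerSeries.coeff r f))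
    (s : ℕ) : Commute x (PowerSeries.coeff s (stretch f)) := by
  rcases s with _ | s
  · rw [coeff_zero_stretch]; exact Commute.zero_right x
  · rw [coeff_succ_stretch]; exact commute_moment h _

theorem serV_smul (z : ℂ) (f : A⟦X⟧) : serV (z • f) = z • serV f := by
  ext m n
  rw [coeff_serV, PowerSeries.coeff_smul, PowerSeries.coeff_smul, coeff_serV, C_smul]

theorem serU_smul (z : ℂ) (f : A⟦X⟧) : serU (z • f) = z • serU f := C_smul z f

theorem smul_smul_comm (s : ℂ⟦X⟧⟦X⟧) (z : ℂ) (F : A⟦X⟧⟦X⟧) : s • (z • F) = z • (s • F) := by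
  rw [smul_eq_scalarSeries₂_mul, mul_smul_comm, ← smul_eq_scalarSeries₂_mul]

theorem relation_smul {F G : A⟦X⟧⟦X⟧} (z : ℂ)
    (h : (invUVDiff : ℂ⟦X⟧⟦X⟧) • F = (invUV : ℂ⟦X⟧⟦X⟧) • G) :
    (invUVDiff : ℂ⟦X⟧⟦X⟧) • (z • F) = (invUV : ℂ⟦X⟧⟦X⟧) • (z • G) := by
  rw [smul_smul_comm, smul_smul_comm, h]

/-- The injective substitution u ↦ 2u + 1 turns the stretched series s into e/2, so the hypothesis
becomes 4 [c, s] = 4 s². The unstretched factor 2 is absorbed. -/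
theorem stretch_commutator_self {e : A⟦X⟧} (he : PowerSeries.coeff 0 e = 0)
    (h : (2 : ℂ) • (PowerSeries.C (PowerSeries.coeff 1 e) * e -
      e * PowerSeries.C (PowerSeries.coeff 1 e)) = e * e) :
    PowerSeries.C (PowerSeries.coeff 1 e) * stretch e -
      stretch e * PowerSeries.C (PowerSeries.coeff 1 e) = stretch e * stretch e := by
  apply aff_injective (c := 2) two_ne_zero 1
  have hs := aff_stretch he
  rw [map_sub, map_mul, map_mul, map_mul, aff_C]
  generalize PowerSeries.C (PowerSeries.coeff 1 e) = c, aff 2 1 (stretch e) = s at *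
  subst hs
  have h4 : (4 : ℂ) • (c * s - s * c) = (4 : ℂ) • (s * s) := by
    simp only [mul_smul_comm, smul_mul_assoc, smul_sub, smul_smul] at h ⊢
    norm_num at h
    exact h
  exact smul_right_injective _ (by norm_num : (4 : ℂ) ≠ 0) h4

theorem stretch_commutator_self' {e : A⟦X⟧} (he : PowerSeries.coeff 0 e = 0)
    (h : (2 : ℂ) • (e * PowerSeries.C (PowerSeries.coeff 1 e) -
      PowerSeries.C (PowerSeries.coeff 1 e) * e) = e * e) :
    stretch e * PowerSeries.C (PowerSeries.coeff 1 e) -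
      PowerSeries.C (PowerSeries.coeff 1 e) * stretch e = stretch e * stretch e := by
  apply aff_injective (c := 2) two_ne_zero 1
  have hs := aff_stretch he
  rw [map_sub, map_mul, map_mul, map_mul, aff_C]
  generalize PowerSeries.C (PowerSeries.coeff 1 e) = c, aff 2 1 (stretch e) = s at *
  subst hs
  have h4 : (4 : ℂ) • (s * c - c * s) = (4 : ℂ) • (s * s) := by
    simp only [mul_smul_comm, smul_mul_assoc, smul_sub, smul_smul] at h ⊢
    norm_num at h
    exact h
  exact smul_right_injective _ (by norm_num : (4 : ℂ) ≠ 0) h4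

theorem coeff_one_mul_eq {A : Type*} [Ring A] (x y : A⟦X⟧) : PowerSeries.coeff 1 (x * y) =
    PowerSeries.coeff 1 x * PowerSeries.constantCoeff y +
      PowerSeries.constantCoeff x * PowerSeries.coeff 1 y := by
  simp [PowerSeries.coeff_mul, Finset.Nat.antidiagonal_succ, add_comm]

namespace IsExtYangianMatrix

variable {T : Matrix (Fin 3) (Fin 3) A⟦X⟧}

theorem mul_h (hT : IsExtYangianMatrix T) : T 0 0 * h T = T 1 1 - T 1 0 * e T := by
  rw [h, ← mul_assoc, hT.mul_inv, one_mul, hT.f_mul]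

theorem constantCoeff_h (hT : IsExtYangianMatrix T) : PowerSeries.constantCoeff (h T) = 1 := by
  have := congrArg PowerSeries.constantCoeff hT.mul_h
  simpa [hT.constantCoeff_eq] using this

theorem coeff_one_h (hT : IsExtYangianMatrix T) : PowerSeries.coeff 1 (h T) =
    PowerSeries.coeff 1 (T 1 1) - PowerSeries.coeff 1 (T 0 0) := by
  have := congrArg (PowerSeries.coeff 1) hT.mul_h
  have h0 := hT.constantCoeff_h
  have e0 := hT.coeff_zero_e
  rw [PowerSeries.coeff_zero_eq_constantCoeff] at e0
  rw [map_sub, coeff_one_mul_eq, coeff_one_mul_eq] at this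
  simp [hT.constantCoeff_eq, h0, e0] at this
  rw [← this, add_sub_cancel_left]

/-- The middle index is its own negative, so the P- and Q-contributions of the middle diagonal
generator cancel and the weight is 1. The factor 2 in `K` below restores the weight 2 of `gl_2`. -/
theorem weight_e (hT : IsExtYangianMatrix T) :
    PowerSeries.coeff 1 (e T) * PowerSeries.coeff 1 (h T) -
      PowerSeries.coeff 1 (h T) * PowerSeries.coeff 1 (e T) = PowerSeries.coeff 1 (e T) := by
  rw [hT.coeff_one_h, hT.coeff_one_e]
  have h1 := congrArg (PowerSeries.coeff 1) (hT.levelOne 1 1 0 1)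
  have h2 := congrArg (PowerSeries.coeff 1) (hT.levelOne 0 1 0 0)
  simp at h1 h2
  linear_combination (norm := noncomm_ring) -h1 - h2

theorem weight_f (hT : IsExtYangianMatrix T) :
    PowerSeries.coeff 1 (f T) * PowerSeries.coeff 1 (h T) -
      PowerSeries.coeff 1 (h T) * PowerSeries.coeff 1 (f T) = -PowerSeries.coeff 1 (f T) := by
  rw [hT.coeff_one_h, hT.coeff_one_f]
  have h1 := congrArg (PowerSeries.coeff 1) (hT.levelOne 1 1 1 0)
  have h2 := congrArg (PowerSeries.coeff 1) (hT.levelOne 1 0 0 0)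
  simp at h1 h2
  linear_combination (norm := noncomm_ring) -h1 - h2

theorem exists_gaussData (hT : IsExtYangianMatrix T) :
    ∃ a E F K : A⟦X⟧, IsGaussData a E F K ∧ fused a = T 0 0 ∧
      PowerSeries.coeff 1 E = sqrtTwo • PowerSeries.coeff 1 (T 0 1) ∧
      PowerSeries.coeff 1 F = sqrtTwo • PowerSeries.coeff 1 (T 1 0) := by
  -- The solution a is taken with coefficients in the subalgebra generated by those of T_00, so it
  -- commutes with everything they commute with.
  obtain ⟨a, ha, hfa, hmem⟩ := exists_fused_eq_mem (T 0 0) (by simp [hT.constantCoeff_eq])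
    (Algebra.adjoin ℂ (Set.range fun n => PowerSeries.coeff n (T 0 0)))
    (fun n => Algebra.subset_adjoin ⟨n, rfl⟩)
  have hc (z : A) (hz : ∀ r, Commute (PowerSeries.coeff r (T 0 0)) z) (r : ℕ) :
      Commute (PowerSeries.coeff r a) z :=
    commute_of_mem_adjoin (by rintro _ ⟨n, rfl⟩; exact hz n) (hmem r)
  have hcA (r s : ℕ) : Commute (PowerSeries.coeff r a) (PowerSeries.coeff s (T 0 0)) :=
    hc _ (fun n => hT.commute_coeff n s) r
  have hca (r s : ℕ) : Commute (PowerSeries.coeff r a) (PowerSeries.coeff s a) :=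
    hc _ (fun n => (hcA s n).symm) r
  have hcomm : aff 2 0 a * aff 2 1 a = aff 2 1 a * aff 2 0 a := by
    have h := congrArg (specUV 2 0 2 1) (LowRankYangian.commute_serU_serV hca).eq
    simpa only [map_mul, specUV_serU, specUV_serV] using h
  have hup : ∀ P, coeffwise (moment (e T)) P * a =
      a * coeffwise (moment (e T)) (P * ratio stretchVar) := by
    refine left_intertwine_of_fused _ ha (constantCoeff_ratio _) fun P => ?_
    rw [hfa, fused_ratio]
    exact intertwine_of_upper_relation hT.coeff_zero_e hT.upper P
  have hlo : ∀ P, a * coeffwise (moment (f T)) P =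
      coeffwise (moment (f T)) (P * ratio stretchVar) * a := by
    refine right_intertwine_of_fused _ hcomm ha (constantCoeff_ratio _) fun P => ?_
    rw [hfa, fused_ratio]
    exact intertwine_of_lower_relation hT.coeff_zero_f hT.lower P
  -- Stretching halves a current at 2u + 1, so the values there are e/√2, f/√2 and h. Moments ignore
  -- the constant term of h, and the summand 1 restores it. The scalars are consistent with the
  -- commutator relation since √2 · √2 = 2.
  refine ⟨a, sqrtTwo • stretch (e T), sqrtTwo • stretch (f T), 1 + (2 : ℂ) • stretch (h T),
    ⟨ha, ?_, ?_, ?_, hca, ?_, ?_, ?_, ?_, ?_, ?_, ?_, ?_⟩, hfa, ?_, ?_⟩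
  · rw [PowerSeries.coeff_smul, coeff_zero_stretch, smul_zero]
  · rw [PowerSeries.coeff_smul, coeff_zero_stretch, smul_zero]
  · rw [← PowerSeries.coeff_zero_eq_constantCoeff_apply, map_add, PowerSeries.coeff_smul,
      coeff_zero_stretch, smul_zero]
    simp
  · intro r s
    rw [map_add, PowerSeries.coeff_smul, PowerSeries.coeff_one]
    refine Commute.add_right ?_ (Commute.smul_right ?_ _)
    · split_ifs
      · exact Commute.one_right _
      · exact Commute.zero_right _
    · exact commute_coeff_stretch (fun n => hc _ (fun m => hT.commute_coeff_h m n) r) s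
  · have := relation_smul sqrtTwo (upper_relation_of_intertwine _ hup)
    simpa only [serU_smul, serV_smul, stretch, mul_smul_comm, smul_mul_assoc, ← smul_sub] using this
  · have := relation_smul sqrtTwo (lower_relation_of_intertwine _ hlo)
    simpa only [serU_smul, serV_smul, stretch, mul_smul_comm, smul_mul_assoc, ← smul_sub] using this
  · rw [commutator_relation_iff]
    · intro r s
      have := moment_commutator ((commutator_relation_iff hT.coeff_zero_e hT.coeff_zero_f).1
        hT.commutator) (stretchVar ^ r) (stretchVar ^ s)
      rw [map_add, PowerSeries.coeff_one, if_neg (by omega), zero_add]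
      simp only [PowerSeries.coeff_smul, coeff_succ_stretch, smul_mul_assoc, mul_smul_comm,
        smul_smul, sqrtTwo_mul_self]
      rw [← smul_sub, this, pow_add, smul_neg]
    · rw [PowerSeries.coeff_smul, coeff_zero_stretch, smul_zero]
    · rw [PowerSeries.coeff_smul, coeff_zero_stretch, smul_zero]
  · rw [PowerSeries.coeff_smul, coeff_one_stretch, C_smul]
    simp only [smul_mul_assoc, mul_smul_comm]
    rw [← smul_sub, ← smul_sub, stretch_commutator_self hT.coeff_zero_e hT.serre_upper]
  · rw [PowerSeries.coeff_smul, coeff_one_stretch, C_smul]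
    simp only [smul_mul_assoc, mul_smul_comm]
    rw [← smul_sub, ← smul_sub, stretch_commutator_self' hT.coeff_zero_f hT.serre_lower]
  · have := hT.weight_e
    rw [map_add, PowerSeries.coeff_smul, PowerSeries.coeff_smul, coeff_one_stretch,
      coeff_one_stretch, PowerSeries.coeff_one, if_neg (by omega), zero_add]
    simp only [smul_mul_assoc, mul_smul_comm]
    rw [smul_comm sqrtTwo (2 : ℂ), ← smul_sub, ← smul_sub, this, two_smul, two_mul, smul_add]
  · have := hT.weight_f
    rw [map_add, PowerSeries.coeff_smul, PowerSeries.coeff_smul, coeff_one_stretch,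
      coeff_one_stretch, PowerSeries.coeff_one, if_neg (by omega), zero_add]
    simp only [smul_mul_assoc, mul_smul_comm]
    rw [smul_comm sqrtTwo (2 : ℂ), ← smul_sub, ← smul_sub, this, two_smul, two_mul, smul_add, smul_neg, neg_add]
  · rw [PowerSeries.coeff_smul, coeff_one_stretch, hT.coeff_one_e]
  · rw [PowerSeries.coeff_smul, coeff_one_stretch, hT.coeff_one_f]

end IsExtYangianMatrix

end Root

/-! ### Fusion -/

section FusionAlgebra

/-- Tensors of rank two over `S²`. -/
abbrev Tensor₂ (S : Type*) : Type _ := Fin 2 → Fin 2 → S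

/-- Tensors of rank four over `S²`. -/
abbrev Tensor₄ (S : Type*) : Type _ := Fin 2 → Fin 2 → Fin 2 → Fin 2 → S

variable {k S : Type*} [CommRing k] [Ring S] [Algebra k S]

/-- The operator `α - m P₁₃`. -/
def exch₁₃ (α m : k) (G : Tensor₄ S) : Tensor₄ S :=
  fun p q r s => α • G p q r s - m • G r q p s

/-- The operator `α - m P₁₄`. -/
def exch₁₄ (α m : k) (G : Tensor₄ S) : Tensor₄ S :=
  fun p q r s => α • G p q r s - m • G s q r p

/-- The operator `α - m P₂₃`. -/
def exch₂₃ (α m : k) (G : Tensor₄ S) : Tensor₄ S :=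
  fun p q r s => α • G p q r s - m • G p r q s

/-- The operator `α - m P₂₄`. -/
def exch₂₄ (α m : k) (G : Tensor₄ S) : Tensor₄ S :=
  fun p q r s => α • G p q r s - m • G p s r q

/-- The product of the four operators exchanging the first two tensor factors with the last two. -/
def exchange (d m : k) (G : Tensor₄ S) : Tensor₄ S :=
  exch₁₄ (2 * d - m) m (exch₁₃ (2 * d) m (exch₂₄ (2 * d) m (exch₂₃ (2 * d + m) m G)))

/-- The components of the symmetrization of a tensor of rank two, not normalized. -/
def symPart (a : Fin 3) (F : Tensor₂ S) : S := ![F 0 0, F 0 1 + F 1 0, -F 1 1] a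

/-- The components of the symmetrization of a tensor of rank four in the first two and in the
last two factors. -/
def symPart₂ (a b : Fin 3) (G : Tensor₄ S) : S := symPart a fun p q => symPart b fun r s => G p q r s

/-- The arguments 2d, 2d - m, 2d + m are those of the pairs formed from 2u, 2u+1 and 2v, 2v+1. With
these shifts the result depends only on the symmetrized components of G and is the R-matrix of
`o_3`, because 2d - m is the cleared 2(u - v - κ) with κ = 1/2. The case a = 1 carries a factor 2
because the middle component is not normalized. -/
theorem symPart₂_exchange (d m : k) (G : Tensor₄ S) (a b : Fin 3) :
    symPart₂ a b (exchange d m G) = (4 * d * (2 * d - m)) •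
      ((d * (2 * d - m)) • symPart₂ a b G - (m * (2 * d - m)) • symPart₂ b a G +
        (m * d) • (if b = a.rev then (if a = 1 then (2 : k) else 1) •
          (symPart₂ 1 1 G + (2 : k) • symPart₂ 0 2 G + (2 : k) • symPart₂ 2 0 G) else 0)) := by
  fin_cases a <;> fin_cases b <;>
    simp [symPart₂, symPart, exchange, exch₁₃, exch₁₄, exch₂₃, exch₂₄] <;> module

/-- The action of a matrix on the first tensor factor. -/
def leg₁ (U : Matrix (Fin 2) (Fin 2) S) (G : Tensor₄ S) : Tensor₄ S :=
  fun p q r s => ∑ j, U p j * G j q r s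

/-- The action of a matrix on the second tensor factor. -/
def leg₂ (U : Matrix (Fin 2) (Fin 2) S) (G : Tensor₄ S) : Tensor₄ S :=
  fun p q r s => ∑ j, U q j * G p j r s

/-- The action of a matrix on the third tensor factor. -/
def leg₃ (U : Matrix (Fin 2) (Fin 2) S) (G : Tensor₄ S) : Tensor₄ S :=
  fun p q r s => ∑ j, U r j * G p q j s

/-- The action of a matrix on the fourth tensor factor. -/
def leg₄ (U : Matrix (Fin 2) (Fin 2) S) (G : Tensor₄ S) : Tensor₄ S :=
  fun p q r s => ∑ j, U s j * G p q r j

section Legs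

variable {α m : k} {U U' V V' : Matrix (Fin 2) (Fin 2) S}

theorem exch₁₃_leg₂ (G : Tensor₄ S) : exch₁₃ α m (leg₂ U G) = leg₂ U (exch₁₃ α m G) := by
  ext p q r s
  simp only [exch₁₃, leg₂, mul_sub, mul_smul_comm, Finset.sum_sub_distrib, Finset.smul_sum]

theorem exch₁₃_leg₄ (G : Tensor₄ S) : exch₁₃ α m (leg₄ U G) = leg₄ U (exch₁₃ α m G) := by
  ext p q r s
  simp only [exch₁₃, leg₄, mul_sub, mul_smul_comm, Finset.sum_sub_distrib, Finset.smul_sum]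

theorem exch₁₄_leg₂ (G : Tensor₄ S) : exch₁₄ α m (leg₂ U G) = leg₂ U (exch₁₄ α m G) := by
  ext p q r s
  simp only [exch₁₄, leg₂, mul_sub, mul_smul_comm, Finset.sum_sub_distrib, Finset.smul_sum]

theorem exch₁₄_leg₃ (G : Tensor₄ S) : exch₁₄ α m (leg₃ U G) = leg₃ U (exch₁₄ α m G) := by
  ext p q r s
  simp only [exch₁₄, leg₃, mul_sub, mul_smul_comm, Finset.sum_sub_distrib, Finset.smul_sum]

theorem exch₂₃_leg₁ (G : Tensor₄ S) : exch₂₃ α m (leg₁ U G) = leg₁ U (exch₂₃ α m G) := by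
  ext p q r s
  simp only [exch₂₃, leg₁, mul_sub, mul_smul_comm, Finset.sum_sub_distrib, Finset.smul_sum]

theorem exch₂₃_leg₄ (G : Tensor₄ S) : exch₂₃ α m (leg₄ U G) = leg₄ U (exch₂₃ α m G) := by
  ext p q r s
  simp only [exch₂₃, leg₄, mul_sub, mul_smul_comm, Finset.sum_sub_distrib, Finset.smul_sum]

theorem exch₂₄_leg₁ (G : Tensor₄ S) : exch₂₄ α m (leg₁ U G) = leg₁ U (exch₂₄ α m G) := by
  ext p q r s
  simp only [exch₂₄, leg₁, mul_sub, mul_smul_comm, Finset.sum_sub_distrib, Finset.smul_sum]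

theorem exch₂₄_leg₃ (G : Tensor₄ S) : exch₂₄ α m (leg₃ U G) = leg₃ U (exch₂₄ α m G) := by
  ext p q r s
  simp only [exch₂₄, leg₃, mul_sub, mul_smul_comm, Finset.sum_sub_distrib, Finset.smul_sum]

/-- The relation `(α - m P) U₁ V₂ = V₂ U₁ (α - m P)`. -/
def ExchangeRel (α m : k) (U V : Matrix (Fin 2) (Fin 2) S) : Prop := ∀ i j k l,
  α • (U i j * V k l - V k l * U i j) = m • (U k j * V i l - V k j * U i l)

theorem ExchangeRel.apply (h : ExchangeRel α m U V) (g : Tensor₂ S) (i k : Fin 2) :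
    α • (∑ j, U i j * ∑ l, V k l * g j l) - m • (∑ j, U k j * ∑ l, V i l * g j l) =
      ∑ l, V k l * ∑ j, U i j * (α • g j l - m • g l j) := by
  simp only [Fin.sum_univ_two]
  linear_combination (norm := skip) h i 0 k 0 * g 0 0 + h i 0 k 1 * g 0 1 + h i 1 k 0 * g 1 0 +
    h i 1 k 1 * g 1 1
  simp only [mul_add, mul_sub, sub_mul, smul_mul_assoc, mul_smul_comm, smul_sub, smul_add,
    mul_assoc]
  module

/-- Each exchange operator commutes with the matrices on the two factors it does not touch, and
swaps the other two by its exchange relation. The order of the four operators lets these moves be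
made one after another. -/
theorem exchange_legs {d m : k} (h13 : ExchangeRel (2 * d) m U V)
    (h14 : ExchangeRel (2 * d - m) m U V') (h23 : ExchangeRel (2 * d + m) m U' V)
    (h24 : ExchangeRel (2 * d) m U' V') (G : Tensor₄ S) :
    exchange d m (leg₁ U (leg₂ U' (leg₃ V (leg₄ V' G)))) =
      leg₃ V (leg₄ V' (leg₁ U (leg₂ U' (exchange d m G)))) := by
  have e13 (G : Tensor₄ S) : exch₁₃ (2 * d) m (leg₁ U (leg₃ V G)) =
      leg₃ V (leg₁ U (exch₁₃ (2 * d) m G)) := by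
    ext p q r s
    exact h13.apply (fun j l => G j q l s) p r
  have e14 (G : Tensor₄ S) : exch₁₄ (2 * d - m) m (leg₁ U (leg₄ V' G)) =
      leg₄ V' (leg₁ U (exch₁₄ (2 * d - m) m G)) := by
    ext p q r s
    exact h14.apply (fun j l => G j q r l) p s
  have e23 (G : Tensor₄ S) : exch₂₃ (2 * d + m) m (leg₂ U' (leg₃ V G)) =
      leg₃ V (leg₂ U' (exch₂₃ (2 * d + m) m G)) := by
    ext p q r s
    exact h23.apply (fun j l => G p j l s) q r
  have e24 (G : Tensor₄ S) : exch₂₄ (2 * d) m (leg₂ U' (leg₄ V' G)) =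
      leg₄ V' (leg₂ U' (exch₂₄ (2 * d) m G)) := by
    ext p q r s
    exact h24.apply (fun j l => G p j r l) q s
  simp only [exchange]
  rw [exch₂₃_leg₁, e23, exch₂₃_leg₄, exch₂₄_leg₁, exch₂₄_leg₃, e24, e13, exch₁₃_leg₄, exch₁₃_leg₂,
    exch₁₄_leg₃, e14, exch₁₄_leg₂]

/-- The entries of the fusion of two matrices, not normalized. -/
def fuseEntry (U U' : Matrix (Fin 2) (Fin 2) S) (a c : Fin 3) : S :=
  symPart a fun p q => symPart c fun j l => U p j * U' q l

/-- The norms of the vectors of the basis of the space of symmetric tensors. -/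
def basisNorm (s : k) : Fin 3 → k := ![1, s, 1]

/-- The hypothesis on U, U' says that the symmetrized product kills antisymmetric tensors. Hence
only the symmetric part of F matters, and the squared norms arise from expanding it in the basis. -/
theorem symPart_apply {s : k} (hs : 2 * s * s = 1)
    (hU : ∀ p q, U p 0 * U' q 1 + U q 0 * U' p 1 = U p 1 * U' q 0 + U q 1 * U' p 0)
    (a : Fin 3) (F : Tensor₂ S) :
    symPart a (fun p q => ∑ j, U p j * ∑ l, U' q l * F j l) =
      ∑ c, (basisNorm s c * basisNorm s c) • (fuseEntry U U' a c * symPart c F) := by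
  obtain ⟨c, hc0, hc1⟩ : ∃ c, symPart a (fun p q => U p 0 * U' q 1) = c ∧
      symPart a (fun p q => U p 1 * U' q 0) = c := by
    refine ⟨_, rfl, ?_⟩
    have h00 := hU 0 0
    have h01 := hU 0 1
    have h11 := hU 1 1
    have half {x y : S} (h : x + x = y + y) : y = x := by
      have := congrArg ((s * s) • ·) h
      simpa only [← two_smul k, smul_smul, show s * s * 2 = 1 by rw [← hs]; ring, one_smul] using
        this.symm
    fin_cases a
    · exact half h00
    · exact h01.symm
    · exact congrArg Neg.neg (half h11)
  have hl : symPart a (fun p q => ∑ j, U p j * ∑ l, U' q l * F j l) =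
      symPart a (fun p q => U p 0 * U' q 0) * F 0 0 + c * F 0 1 + c * F 1 0 +
        symPart a (fun p q => U p 1 * U' q 1) * F 1 1 := by
    rw [← hc0]
    nth_rw 2 [hc0]
    rw [← hc1]
    fin_cases a <;> simp [symPart] <;> noncomm_ring
  have h1 : fuseEntry U U' a 1 = c + c := by
    nth_rw 1 [← hc0]
    rw [← hc1]
    fin_cases a <;> simp [symPart, fuseEntry] <;> abel
  have h0 : fuseEntry U U' a 0 = symPart a (fun p q => U p 0 * U' q 0) := rfl
  have h2 : fuseEntry U U' a 2 = -symPart a (fun p q => U p 1 * U' q 1) := by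
    fin_cases a <;> simp [symPart, fuseEntry]
    abel
  rw [hl, Fin.sum_univ_three, h0, h1, h2]
  have h3 : (s * s) • ((c + c) * (F 0 1 + F 1 0)) = c * F 0 1 + c * F 1 0 := by
    rw [← two_smul k, smul_mul_assoc, smul_smul, show s * s * 2 = 1 by rw [← hs]; ring, one_smul,
      mul_add]
  simp only [basisNorm, symPart]
  simp [h3]
  abel

/-- The entries of the fusion of two matrices. -/
def fuseMatrix (s : k) (U U' : Matrix (Fin 2) (Fin 2) S) : Matrix (Fin 3) (Fin 3) S :=
  Matrix.of fun a c => (basisNorm s a * basisNorm s c) • fuseEntry U U' a c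

/-- The normalized components of the symmetrization of a tensor of rank four. -/
def symComp (s : k) (a b : Fin 3) (G : Tensor₄ S) : S :=
  (basisNorm s a * basisNorm s b) • symPart₂ a b G

theorem symPart_mul_left (x : S) (a : Fin 3) (F : Tensor₂ S) :
    symPart a (fun p q => x * F p q) = x * symPart a F := by
  fin_cases a <;> simp [symPart, mul_add]

theorem symPart_sum {ι : Type*} (t : Finset ι) (a : Fin 3) (F : ι → Tensor₂ S) :
    symPart a (fun p q => ∑ i ∈ t, F i p q) = ∑ i ∈ t, symPart a (F i) := by
  fin_cases a <;> simp [symPart, Finset.sum_add_distrib]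

theorem symPart_smul (z : k) (a : Fin 3) (F : Tensor₂ S) :
    symPart a (fun p q => z • F p q) = z • symPart a F := by
  fin_cases a <;> simp [symPart]

theorem symComp_leg₁_leg₂ {s : k} (hs : 2 * s * s = 1)
    (hU : ∀ p q, U p 0 * U' q 1 + U q 0 * U' p 1 = U p 1 * U' q 0 + U q 1 * U' p 0)
    (a b : Fin 3) (G : Tensor₄ S) : symComp s a b (leg₁ U (leg₂ U' G)) =
      ∑ c, fuseMatrix s U U' a c * symComp s c b G := by
  have h := symPart_apply hs hU a fun j l => symPart b fun r t => G j l r t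
  have h2 : symPart₂ a b (leg₁ U (leg₂ U' G)) = symPart a (fun p q =>
      ∑ j, U p j * ∑ l, U' q l * symPart b fun r t => G j l r t) := by
    simp only [symPart₂, leg₁, leg₂, symPart_sum, symPart_mul_left]
  rw [symComp, h2, h, Finset.smul_sum]
  refine Finset.sum_congr rfl fun c _ => ?_
  simp only [fuseMatrix, symComp, Matrix.of_apply, smul_mul_assoc, mul_smul_comm, smul_smul,
    symPart₂]
  congr 1
  ring

theorem symComp_leg₃_leg₄ {s : k} (hs : 2 * s * s = 1)
    (hV : ∀ p q, V p 0 * V' q 1 + V q 0 * V' p 1 = V p 1 * V' q 0 + V q 1 * V' p 0)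
    (a b : Fin 3) (G : Tensor₄ S) : symComp s a b (leg₃ V (leg₄ V' G)) =
      ∑ c, fuseMatrix s V V' b c * symComp s a c G := by
  have h2 : symPart₂ a b (leg₃ V (leg₄ V' G)) =
      ∑ c, (basisNorm s c * basisNorm s c) • (fuseEntry V V' b c * symPart₂ a c G) := by
    have h (p q : Fin 2) := symPart_apply hs hV b fun j l => G p q j l
    simp only [symPart₂, leg₃, leg₄, h, symPart_sum, symPart_mul_left, symPart_smul]
  rw [symComp, h2, Finset.smul_sum]
  refine Finset.sum_congr rfl fun c _ => ?_
  simp only [fuseMatrix, symComp, Matrix.of_apply, smul_mul_assoc, mul_smul_comm, smul_smul]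
  congr 1
  ring

theorem symComp_exchange {s : k} (hs : 2 * s * s = 1) (d m : k) (G : Tensor₄ S) (a b : Fin 3) :
    symComp s a b (exchange d m G) = (4 * d * (2 * d - m)) •
      ((d * (2 * d - m)) • symComp s a b G - (m * (2 * d - m)) • symComp s b a G +
        (2 * (m * d)) • (if b = a.rev then ∑ p, symComp s p p.rev G else 0)) := by
  simp only [symComp]
  rw [symPart₂_exchange]
  by_cases hab : b = a.rev
  · rw [if_pos hab, if_pos hab, Fin.sum_univ_three]
    have hq : (basisNorm s a * basisNorm s b) • ((m * d) • (if a = 1 then (2 : k) else 1) •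
        (symPart₂ 1 1 G + (2 : k) • symPart₂ 0 2 G + (2 : k) • symPart₂ 2 0 G)) =
        (2 * (m * d)) • ((basisNorm s 0 * basisNorm s (Fin.rev 0)) • symPart₂ 0 (Fin.rev 0) G +
          (basisNorm s 1 * basisNorm s (Fin.rev 1)) • symPart₂ 1 (Fin.rev 1) G +
          (basisNorm s 2 * basisNorm s (Fin.rev 2)) • symPart₂ 2 (Fin.rev 2) G) := by
      simp only [show (0 : Fin 3).rev = 2 from rfl,
        show (1 : Fin 3).rev = 1 from rfl, show (2 : Fin 3).rev = 0 from rfl]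
      have hb : basisNorm s a * basisNorm s b * (if a = 1 then (2 : k) else 1) = 1 := by
        subst hab
        fin_cases a
        · simp [basisNorm]
        · simp [basisNorm]; rw [← hs]; ring
        · simp [basisNorm]
      rw [smul_comm _ (m * d), smul_smul _ (ite _ _ _), hb, one_smul, mul_comm 2, mul_smul (m * d)]
      simp only [smul_add, smul_smul]
      rw [show m * d * (2 * (basisNorm s 1 * basisNorm s 1)) = m * d * (2 * s * s) by
        simp [basisNorm]; ring, hs]
      simp [basisNorm]
      abel
    rw [← hq]
    module
  · rw [if_neg hab, if_neg hab]
    module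

/-- The basis of the space of symmetric tensors of rank two. -/
def basisTensor (s : k) (c : Fin 3) : Tensor₂ S := fun p q =>
  basisNorm s c • ![!![1, 0; 0, 0], !![0, 1; 1, 0], !![0, 0; 0, -1]] c p q

theorem symPart_basisTensor {s : k} (hs : 2 * s * s = 1) (a c : Fin 3) :
    basisNorm s a • symPart a (basisTensor s c : Tensor₂ S) = if a = c then 1 else 0 := by
  have h : s • s • (1 : S) + s • s • (1 : S) = 1 := by
    rw [← two_smul k, smul_smul, smul_smul, hs, one_smul]
  fin_cases a <;> fin_cases c <;> simp [symPart, basisTensor, basisNorm, h]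

theorem symComp_basisTensor {s : k} (hs : 2 * s * s = 1) (a b c e : Fin 3) :
    symComp s a b (fun p q r t => basisTensor s c p q * basisTensor s e r t : Tensor₄ S) =
      if a = c then if b = e then 1 else 0 else 0 := by
  have h : symPart₂ a b (fun p q r t => basisTensor s c p q * basisTensor s e r t : Tensor₄ S) =
      symPart a (basisTensor s c) * symPart b (basisTensor s e) := by
    rw [symPart₂]
    simp only [symPart_mul_left]
    fin_cases a <;> simp [symPart, add_mul]
  rw [symComp, h, mul_smul, ← mul_smul_comm, ← smul_mul_assoc, symPart_basisTensor hs,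
    symPart_basisTensor hs]
  split_ifs <;> simp

/-- Apply `exchange_legs` to the tensor product of the basis vectors c and e and take the
symmetrized components a, b: both sides become matrix entries of the RTT relation, with the common
scalar still in place. -/
theorem fuseMatrix_rtt {s : k} (hs : 2 * s * s = 1) {d m : k} (h13 : ExchangeRel (2 * d) m U V)
    (h14 : ExchangeRel (2 * d - m) m U V') (h23 : ExchangeRel (2 * d + m) m U' V)
    (h24 : ExchangeRel (2 * d) m U' V')
    (hU : ∀ p q, U p 0 * U' q 1 + U q 0 * U' p 1 = U p 1 * U' q 0 + U q 1 * U' p 0)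
    (hV : ∀ p q, V p 0 * V' q 1 + V q 0 * V' p 1 = V p 1 * V' q 0 + V q 1 * V' p 0)
    (a b c e : Fin 3) :
    (4 * d * (2 * d - m)) • ((d * (2 * d - m)) • (fuseMatrix s U U' a c * fuseMatrix s V V' b e) -
      (m * (2 * d - m)) • (fuseMatrix s U U' b c * fuseMatrix s V V' a e) +
      (2 * (m * d)) • (if b = a.rev then
        ∑ p, fuseMatrix s U U' p c * fuseMatrix s V V' p.rev e else 0)) =
    (4 * d * (2 * d - m)) • ((d * (2 * d - m)) • (fuseMatrix s V V' b e * fuseMatrix s U U' a c) -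
      (m * (2 * d - m)) • (fuseMatrix s V V' b c * fuseMatrix s U U' a e) +
      (2 * (m * d)) • (if e = c.rev then
        ∑ p, fuseMatrix s V V' b p.rev * fuseMatrix s U U' a p else 0)) := by
  let G : Tensor₄ S := fun p q r t => basisTensor s c p q * basisTensor s e r t
  have key := congrArg (symComp s a b) (exchange_legs h13 h14 h23 h24 G)
  have hG (a b : Fin 3) : symComp s a b G = if a = c then if b = e then 1 else 0 else 0 :=
    symComp_basisTensor hs a b c e
  have hL (a b : Fin 3) : symComp s a b (leg₁ U (leg₂ U' (leg₃ V (leg₄ V' G)))) =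
      fuseMatrix s U U' a c * fuseMatrix s V V' b e := by
    simp only [symComp_leg₁_leg₂ hs hU, symComp_leg₃_leg₄ hs hV, hG, mul_ite, mul_one, mul_zero]
    simp
  rw [symComp_exchange hs, hL, hL, symComp_leg₃_leg₄ hs hV] at key
  simp only [hL] at key
  rw [key]
  simp only [symComp_leg₁_leg₂ hs hU, symComp_exchange hs, hG]
  generalize fuseMatrix s V V' = N, fuseMatrix s U U' = M
  fin_cases c <;> fin_cases e <;>
    simp [Fin.sum_univ_three, show (0 : Fin 3).rev = 2 from rfl, show (1 : Fin 3).rev = 1 from rfl,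
      show (2 : Fin 3).rev = 0 from rfl, mul_add, mul_sub] <;> module

end Legs

end FusionAlgebra

/-! ### The fused matrix satisfies the relations of `X(o_3)` -/

section FusionMatrix

theorem fuseMatrix_map {k k' S S' : Type*} [CommRing k] [CommRing k'] [Ring S] [Ring S']
    [Algebra k S] [Algebra k' S'] (σ : S →+* S') {s : k} {s' : k'}
    (hσ : ∀ x, σ (s • x) = s' • σ x) (U U' : Matrix (Fin 2) (Fin 2) S) (a c : Fin 3) :
    σ (fuseMatrix s U U' a c) = fuseMatrix s' (U.map σ) (U'.map σ) a c := by
  fin_cases a <;> fin_cases c <;>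
    simp [fuseMatrix, fuseEntry, symPart, basisNorm, mul_smul, hσ, smul_add]

variable {A : Type*} [Ring A] [Algebra ℂ A]

/-- Here (2u + a) - (2v + a') = 2(u - v) + (a - a'). Multiplying by (2 + a u⁻¹)(2 + a' v⁻¹) clears
the new denominators. -/
theorem subUV_relation (a a' : ℂ) {F G : A⟦X⟧⟦X⟧}
    (h : (invUVDiff : ℂ⟦X⟧⟦X⟧) • F = (invUV : ℂ⟦X⟧⟦X⟧) • G) :
    (2 * invUVDiff + PowerSeries.C (PowerSeries.C (a - a')) * invUV : ℂ⟦X⟧⟦X⟧) •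
        subUV 2 a 2 a' F = (invUV : ℂ⟦X⟧⟦X⟧) • subUV 2 a 2 a' G := by
  have h1 := congrArg (subUV 2 a 2 a') h
  rw [subUV_smul, subUV_smul, subUV_invUV, subUV_invUVDiff] at h1
  have hu := congrArg (serU (A := ℂ)) (affineInv_mul_denom (c := 2) two_ne_zero a)
  have hv := congrArg (serV (A := ℂ)) (affineInv_mul_denom (c := 2) two_ne_zero a')
  have hU (z : ℂ) : serU (PowerSeries.C z) = PowerSeries.C (PowerSeries.C z) := rfl
  have hV (z : ℂ) : serV (PowerSeries.C z) = PowerSeries.C (PowerSeries.C z) := PowerSeries.map_C _ _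
  have hVX : serV (PowerSeries.X : ℂ⟦X⟧) = PowerSeries.X := PowerSeries.map_X _
  have hUX : serU (PowerSeries.X : ℂ⟦X⟧) = PowerSeries.C PowerSeries.X := rfl
  simp only [map_mul (serU (A := ℂ)), map_add (serU (A := ℂ)), map_mul (serV (A := ℂ)),
    map_add (serV (A := ℂ)), hU, hV, hUX, hVX] at hu hv
  generalize serU (affineInv 2 a) = p, serV (affineInv 2 a') = q at h1 hu hv
  have e2 : PowerSeries.C (PowerSeries.C (2 : ℂ)) = 2 := by rw [map_ofNat, map_ofNat]
  rw [e2] at hu hv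
  have h2 := congrArg (((2 + PowerSeries.C (PowerSeries.C a) * PowerSeries.C PowerSeries.X) *
    (2 + PowerSeries.C (PowerSeries.C a') * PowerSeries.X) : ℂ⟦X⟧⟦X⟧) • ·) h1
  simp only [smul_smul] at h2
  convert h2 using 2
  · rw [map_sub, map_sub, invUVDiff, invUV]
    linear_combination (PowerSeries.C (PowerSeries.C a') * PowerSeries.X + 2) * hu
      - (PowerSeries.C (PowerSeries.C a) * PowerSeries.C PowerSeries.X + 2) * hv
  · rw [invUV]
    linear_combination -(q * (PowerSeries.C (PowerSeries.C a') * PowerSeries.X + 2)) * hu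
      - PowerSeries.C PowerSeries.X * hv

/-- The two arguments are 2u and 2u + 1, whose difference is -1. -/
theorem specUV_fused_relation {F G : A⟦X⟧⟦X⟧}
    (h : (invUVDiff : ℂ⟦X⟧⟦X⟧) • F = (invUV : ℂ⟦X⟧⟦X⟧) • G) :
    -specUV 2 0 2 1 F = specUV 2 0 2 1 G := by
  have h1 := congrArg (specUV 2 0 2 1) h
  rw [specUV_smul, specUV_smul, specUV_invUV, specUV_invUVDiff] at h1
  have hu := affineInv_mul_denom (c := 2) two_ne_zero 0
  have hv := affineInv_mul_denom (c := 2) two_ne_zero 1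
  rw [map_zero, zero_mul, add_zero, show PowerSeries.C (2 : ℂ) = 2 from map_ofNat _ _] at hu
  rw [map_one, one_mul, show PowerSeries.C (2 : ℂ) = 2 from map_ofNat _ _] at hv
  generalize affineInv 2 0 = p, affineInv 2 1 = q at h1 hu hv
  have h2 := congrArg (scalarSeries (2 * (2 + PowerSeries.X)) * ·) h1
  simp only [← mul_assoc, ← map_mul] at h2
  rw [show 2 * (2 + PowerSeries.X) * (q - p) = -(PowerSeries.X * PowerSeries.X) by
      linear_combination 2 * hv - (2 + PowerSeries.X) * hu,
    show 2 * (2 + PowerSeries.X) * p * q = PowerSeries.X * PowerSeries.X by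
      linear_combination (2 + PowerSeries.X) * q * hu + PowerSeries.X * hv, map_neg, map_mul,
    scalarSeries_X, neg_mul, mul_assoc, mul_assoc, ← mul_neg, ← mul_neg] at h2
  exact PowerSeries.X_mul_cancel (PowerSeries.X_mul_cancel h2)

/-- The matrix of the operator `(1 + P)/2 · T₁(2u) T₂(2u+1)` on the space of symmetric tensors. -/
def fusedMatrix (t : Matrix (Fin 2) (Fin 2) A⟦X⟧) : Matrix (Fin 3) (Fin 3) A⟦X⟧ :=
  fuseMatrix sqrtTwo⁻¹ (t.map (aff 2 0)) (t.map (aff 2 1))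

theorem two_mul_inv_sqrtTwo : 2 * sqrtTwo⁻¹ * sqrtTwo⁻¹ = 1 := by
  rw [mul_assoc, ← mul_inv, sqrtTwo_mul_self]
  norm_num

theorem two_smul_invUVDiffKappa : 2 * invUVDiffKappa 3 = 2 * invUVDiff - invUV := by
  rw [invUVDiffKappa, show kappa 3 = 2⁻¹ by norm_num [kappa], mul_sub, two_mul ((2⁻¹ : ℂ) • invUV),
    ← add_smul]
  norm_num

theorem cleared_smul_sub {k S : Type*} [CommRing k] [Ring S] [Algebra k S] {d d' m : k}
    {x y z x' y' z' : S}
    (h : (4 * d * (2 * d')) • ((d * (2 * d')) • x - (m * (2 * d')) • y + (2 * (m * d)) • z) =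
      (4 * d * (2 * d')) • ((d * (2 * d')) • x' - (m * (2 * d')) • y' + (2 * (m * d)) • z')) :
    d • (d' • ((16 : ℕ) • ((d * d') • x - (m * d') • y + (m * d) • z) -
      (16 : ℕ) • ((d * d') • x' - (m * d') • y' + (m * d) • z'))) = 0 := by
  linear_combination (norm := module) h

variable {t : Matrix (Fin 2) (Fin 2) A⟦X⟧}

theorem IsGLMatrix.exchangeRel (ht : IsGLMatrix t) (a a' : ℂ) :
    ExchangeRel (2 * invUVDiff + PowerSeries.C (PowerSeries.C (a - a')) * invUV : ℂ⟦X⟧⟦X⟧) invUV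
      ((t.map (aff 2 a)).map serU) ((t.map (aff 2 a')).map serV) := by
  intro i j k l
  have := subUV_relation a a' (ht.relation i j k l)
  simpa only [map_sub (subUV (A := A) 2 a 2 a'), map_mul (subUV (A := A) 2 a 2 a'), subUV_serU,
    subUV_serV, Matrix.map_apply] using this

/-- At difference -1 the relation reads (1 + P) T₁ T₂ = T₂ T₁ (1 + P), so the left-hand side is
invariant under exchange of the column indices. -/
theorem IsGLMatrix.fused_symm (ht : IsGLMatrix t) (i k j l : Fin 2) :
    aff 2 0 (t i j) * aff 2 1 (t k l) + aff 2 0 (t k j) * aff 2 1 (t i l) =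
      aff 2 0 (t i l) * aff 2 1 (t k j) + aff 2 0 (t k l) * aff 2 1 (t i j) := by
  have h1 := specUV_fused_relation (ht.relation i j k l)
  have h2 := specUV_fused_relation (ht.relation i l k j)
  simp only [map_sub (specUV (A := A) 2 0 2 1), map_mul (specUV (A := A) 2 0 2 1), specUV_serU,
    specUV_serV] at h1 h2
  linear_combination (norm := abel) h2 - h1

theorem IsGLMatrix.isExtYangianMatrix (ht : IsGLMatrix t) :
    IsExtYangianMatrix (fusedMatrix t) where
  constantCoeff_eq i j := by
    have h : (sqrtTwo⁻¹ * sqrtTwo⁻¹) • (1 : A) + (sqrtTwo⁻¹ * sqrtTwo⁻¹) • (1 : A) = 1 := by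
      rw [← add_smul, ← two_mul, ← mul_assoc, two_mul_inv_sqrtTwo, one_smul]
    fin_cases i <;> fin_cases j <;>
      simp [fusedMatrix, fuseMatrix, fuseEntry, symPart, basisNorm, constantCoeff_aff,
        ht.constantCoeff_eq, h]
  rtt := by
    have h13 := ht.exchangeRel 0 0
    have h14 := ht.exchangeRel 0 1
    have h23 := ht.exchangeRel 1 0
    have h24 := ht.exchangeRel 1 1
    simp only [sub_self, map_zero, zero_mul, add_zero, sub_zero, zero_sub, map_neg, map_one,
      neg_mul, one_mul, ← sub_eq_add_neg] at h13 h14 h23 h24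
    let s' : ℂ⟦X⟧⟦X⟧ := PowerSeries.C (PowerSeries.C sqrtTwo⁻¹)
    have hs' : 2 * s' * s' = 1 := by
      have := congrArg (fun z : ℂ => (PowerSeries.C (PowerSeries.C z) : ℂ⟦X⟧⟦X⟧)) two_mul_inv_sqrtTwo
      simpa only [map_mul, map_ofNat, map_one] using this
    have hsm (F : A⟦X⟧⟦X⟧) : sqrtTwo⁻¹ • F = s' • F := by
      rw [smul_eq_scalarSeries₂_mul, scalarSeries₂_C]
      ext m n
      rw [PowerSeries.coeff_smul, PowerSeries.coeff_smul]
      simp [scalarSeries, PowerSeries.coeff_C_mul]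
      rw [Algebra.smul_def]
    have hU (i j : Fin 3) := fuseMatrix_map serU (s := sqrtTwo⁻¹) (s' := s')
      (fun x => by rw [serU_smul, hsm]) (t.map (aff 2 0)) (t.map (aff 2 1)) i j
    have hV (i j : Fin 3) := fuseMatrix_map serV (s := sqrtTwo⁻¹) (s' := s')
      (fun x => by rw [serV_smul, hsm]) (t.map (aff 2 0)) (t.map (aff 2 1)) i j
    have key := fuseMatrix_rtt hs' h13 h14 h23 h24
      (fun p q => by
        simpa only [map_add, map_mul, Matrix.map_apply] using congrArg (serU (A := A)) (ht.fused_symm p q 0 1))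
      (fun p q => by
        simpa only [map_add, map_mul, Matrix.map_apply] using congrArg (serV (A := A)) (ht.fused_symm p q 0 1))
    simp only [← hU, ← hV] at key
    ext ⟨i, k⟩ ⟨j, l⟩ : 1
    have key := key i k j l
    rw [← two_smul_invUVDiffKappa] at key
    rw [rttLeft_apply, rttRight_apply]
    -- The common scalar, with the twos collected, is 16 (u - v)(u - v - κ) with denominators
    -- cleared. Its two series factors are cancelled here, the integer at the end.
    have h := sub_eq_zero.1 (invUVDiff_sub_smul_cancel _ (invUVDiff_smul_cancel
      (cleared_smul_sub key)))
    rw [← Nat.cast_smul_eq_nsmul ℂ, ← Nat.cast_smul_eq_nsmul ℂ] at h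
    exact smul_right_injective _ (by norm_num) h

end FusionMatrix

/-! ### A homomorphism is determined by few generators -/

section Uniqueness

variable {A B : Type*} [Ring A] [Algebra ℂ A] [Ring B] [Algebra ℂ B]

theorem map_commutator_smul (σ : A →ₐ[ℂ] B) {g : B⟦X⟧} (hg : ∀ y, g * y = y * g) {x : A} {x' : B}
    (hx : σ x = x') {F : A⟦X⟧} {F' : B⟦X⟧}
    (hF : PowerSeries.map (σ : A →+* B) F = g * F') :
    PowerSeries.map (σ : A →+* B) (PowerSeries.C x * F - F * PowerSeries.C x) =
      g * (PowerSeries.C x' * F' - F' * PowerSeries.C x') := by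
  rw [map_sub, map_mul, map_mul, hF, PowerSeries.map_C, AlgHom.coe_toRingHom, hx, mul_sub,
    ← mul_assoc, ← hg, mul_assoc, mul_assoc]

/-- A homomorphism that multiplies the first entry of `T(u)` by a central series and preserves two
of the generators of level one multiplies the whole matrix `T(u)` by this series. -/
theorem IsExtYangianMatrix.map_eq {T : Matrix (Fin 3) (Fin 3) A⟦X⟧}
    {T' : Matrix (Fin 3) (Fin 3) B⟦X⟧} (hT : IsExtYangianMatrix T) (hT' : IsExtYangianMatrix T')
    (σ : A →ₐ[ℂ] B) {g : B⟦X⟧} (hg : ∀ y, g * y = y * g)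
    (h00 : PowerSeries.map (σ : A →+* B) (T 0 0) = g * T' 0 0)
    (hb : σ (PowerSeries.coeff 1 (T 0 1)) = PowerSeries.coeff 1 (T' 0 1))
    (hc : σ (PowerSeries.coeff 1 (T 1 0)) = PowerSeries.coeff 1 (T' 1 0)) (i j : Fin 3) :
    PowerSeries.map (σ : A →+* B) (T i j) = g * T' i j := by
  have b (k l : Fin 3) (h : PowerSeries.map (σ : A →+* B) (T k l) = g * T' k l) :=
    map_commutator_smul σ hg hb h
  have c (k l : Fin 3) (h : PowerSeries.map (σ : A →+* B) (T k l) = g * T' k l) :=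
    map_commutator_smul σ hg hc h
  simp only [hT.levelOne, hT'.levelOne, show (0 : Fin 3).rev = 2 from rfl,
    show (1 : Fin 3).rev = 1 from rfl] at b c
  -- Commutators with the two level-one generators spread the property from the corner: 00 to 01 and
  -- 10, then to 02, 20, 11, then to 12, 21, and finally to 22.
  have h01 := b 0 0 h00
  have h10 := c 0 0 h00
  simp at h01 h10
  have h02 := b 0 1 h01
  have h20 := c 1 0 h10
  have h11 := b 1 0 h10
  simp [mul_sub, h00] at h02 h20 h11
  have h12 := b 1 1 h11
  have h21 := c 1 1 h11
  simp [mul_sub, mul_add, h01, h10] at h12 h21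
  have h22 := c 1 2 h12
  simp [mul_add, h11] at h22
  fin_cases i <;> fin_cases j <;> assumption

theorem IsGLMatrix.levelOne {N : ℕ} {t : Matrix (Fin N) (Fin N) A⟦X⟧} (ht : IsGLMatrix t)
    {i j : Fin N} (hij : i ≠ j) (k l : Fin N) :
    PowerSeries.C (PowerSeries.coeff 1 (t i j)) * t k l -
      t k l * PowerSeries.C (PowerSeries.coeff 1 (t i j)) =
    (if k = j then t i l else 0) - (if i = l then t k j else 0) := by
  have h0 (i j : Fin N) : PowerSeries.coeff 0 (t i j) = if i = j then 1 else 0 := by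
    simpa using ht.constantCoeff_eq i j
  rw [commutator_coeff_one ((h0 i j).trans (if_neg hij)) (ht.relation i j k l),
    map_sub, coeffU_serU_mul_serV, coeffU_serV_mul_serU, h0, h0]
  split_ifs <;> simp

/-- A homomorphism that multiplies the first entry of `T(u)` by a central series and preserves two
of the generators of level one multiplies the whole matrix `T(u)` by this series. -/
theorem IsGLMatrix.map_eq {t : Matrix (Fin 2) (Fin 2) A⟦X⟧}
    {t' : Matrix (Fin 2) (Fin 2) B⟦X⟧} (ht : IsGLMatrix t) (ht' : IsGLMatrix t')
    (σ : A →ₐ[ℂ] B) {g : B⟦X⟧} (hg : ∀ y, g * y = y * g)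
    (h00 : PowerSeries.map (σ : A →+* B) (t 0 0) = g * t' 0 0)
    (hb : σ (PowerSeries.coeff 1 (t 0 1)) = PowerSeries.coeff 1 (t' 0 1))
    (hc : σ (PowerSeries.coeff 1 (t 1 0)) = PowerSeries.coeff 1 (t' 1 0)) (i j : Fin 2) :
    PowerSeries.map (σ : A →+* B) (t i j) = g * t' i j := by
  have b (k l : Fin 2) (h : PowerSeries.map (σ : A →+* B) (t k l) = g * t' k l) :=
    map_commutator_smul σ hg hb h
  have c (k l : Fin 2) (h : PowerSeries.map (σ : A →+* B) (t k l) = g * t' k l) :=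
    map_commutator_smul σ hg hc h
  simp only [ht.levelOne zero_ne_one, ht'.levelOne zero_ne_one, ht.levelOne one_ne_zero,
    ht'.levelOne one_ne_zero] at b c
  have h01 := b 0 0 h00
  have h10 := c 0 0 h00
  simp at h01 h10
  have h11 := b 1 0 h10
  simp [mul_sub, h00] at h11
  fin_cases i <;> fin_cases j <;> assumption

end Uniqueness

/-! ### The entries that determine the fusion homomorphism -/

section FusedEntries

variable {A : Type*} [Ring A] [Algebra ℂ A] {t : Matrix (Fin 2) (Fin 2) A⟦X⟧}

theorem fusedMatrix_zero_zero (t : Matrix (Fin 2) (Fin 2) A⟦X⟧) :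
    fusedMatrix t 0 0 = fused (t 0 0) := by
  simp [fusedMatrix, fuseMatrix, fuseEntry, symPart, basisNorm, fused]

theorem IsGLMatrix.coeff_one_fusedMatrix_zero_one (ht : IsGLMatrix t) :
    PowerSeries.coeff 1 (fusedMatrix t 0 1) = sqrtTwo⁻¹ • PowerSeries.coeff 1 (t 0 1) := by
  simp [fusedMatrix, fuseMatrix, fuseEntry, symPart, basisNorm,
    coeff_one_mul_eq, constantCoeff_aff, ht.constantCoeff_eq, coeff_one_aff]
  module

theorem IsGLMatrix.coeff_one_fusedMatrix_one_zero (ht : IsGLMatrix t) :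
    PowerSeries.coeff 1 (fusedMatrix t 1 0) = sqrtTwo⁻¹ • PowerSeries.coeff 1 (t 1 0) := by
  simp [fusedMatrix, fuseMatrix, fuseEntry, symPart, basisNorm,
    coeff_one_mul_eq, constantCoeff_aff, ht.constantCoeff_eq, coeff_one_aff]
  module

end FusedEntries

/-! ### Universal properties of the two Yangians -/

section Presentations

variable {A B : Type*} [Ring A] [Algebra ℂ A] [Ring B] [Algebra ℂ B] {N : ℕ}

/-- A homomorphism applied to the coefficients of a series in two variables. -/
def map₂ (σ : A →ₐ[ℂ] B) : A⟦X⟧⟦X⟧ →+* B⟦X⟧⟦X⟧ :=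
  PowerSeries.map (PowerSeries.map (σ : A →+* B))

theorem coeff_coeff_map₂ (σ : A →ₐ[ℂ] B) (F : A⟦X⟧⟦X⟧) (r s : ℕ) :
    PowerSeries.coeff r (PowerSeries.coeff s (map₂ σ F)) =
      σ (PowerSeries.coeff r (PowerSeries.coeff s F)) := by
  simp [map₂]

theorem map₂_serU (σ : A →ₐ[ℂ] B) (f : A⟦X⟧) :
    map₂ σ (serU f) = serU (PowerSeries.map (σ : A →+* B) f) :=
  PowerSeries.map_C _ _

theorem map₂_serV (σ : A →ₐ[ℂ] B) (f : A⟦X⟧) :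
    map₂ σ (serV f) = serV (PowerSeries.map (σ : A →+* B) f) := by
  ext m n
  rw [coeff_coeff_map₂, coeff_serV, coeff_serV, PowerSeries.coeff_map, PowerSeries.coeff_C,
    PowerSeries.coeff_C]
  split_ifs <;> simp

theorem map₂_smul (σ : A →ₐ[ℂ] B) (s : ℂ⟦X⟧⟦X⟧) (F : A⟦X⟧⟦X⟧) :
    map₂ σ (s • F) = s • map₂ σ F := by
  rw [smul_eq_scalarSeries₂_mul, smul_eq_scalarSeries₂_mul, map_mul]
  congr 1
  ext m n
  rw [coeff_coeff_map₂]
  simp [scalarSeries₂, scalarSeries]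

theorem map₂_rttLeft (σ : A →ₐ[ℂ] B) (T : Matrix (Fin N) (Fin N) A⟦X⟧)
    (a b : Fin N × Fin N) : map₂ σ (rttLeft T a b) =
      rttLeft (T.map (PowerSeries.map (σ : A →+* B))) a b := by
  obtain ⟨i, k⟩ := a
  obtain ⟨j, l⟩ := b
  simp only [rttLeft_apply, map_add (map₂ σ), map_sub (map₂ σ), map₂_smul, map_mul (map₂ σ),
    map₂_serU, map₂_serV, Matrix.map_apply, apply_ite (map₂ σ), map_sum (map₂ σ),
    map_zero (map₂ σ)]

theorem map₂_rttRight (σ : A →ₐ[ℂ] B) (T : Matrix (Fin N) (Fin N) A⟦X⟧)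
    (a b : Fin N × Fin N) : map₂ σ (rttRight T a b) =
      rttRight (T.map (PowerSeries.map (σ : A →+* B))) a b := by
  obtain ⟨i, k⟩ := a
  obtain ⟨j, l⟩ := b
  simp only [rttRight_apply, map_add (map₂ σ), map_sub (map₂ σ), map₂_smul, map_mul (map₂ σ),
    map₂_serU, map₂_serV, Matrix.map_apply, apply_ite (map₂ σ), map_sum (map₂ σ),
    map_zero (map₂ σ)]

theorem coeff_freeMatrix (i j : Fin N) (r : ℕ) :
    PowerSeries.coeff r (freeMatrix N i j) = freeT N i j r := by
  simp [freeMatrix]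

theorem constantCoeff_freeMatrix (i j : Fin N) :
    PowerSeries.constantCoeff (freeMatrix N i j) = if i = j then 1 else 0 := by
  rw [← PowerSeries.coeff_zero_eq_constantCoeff_apply, coeff_freeMatrix, freeT]

/-- The homomorphism from the free algebra sending the symbols to the coefficients of the entries
of a matrix. -/
def freeLift (M : Matrix (Fin N) (Fin N) A⟦X⟧) : FreeGen N →ₐ[ℂ] A :=
  FreeAlgebra.lift ℂ fun p => PowerSeries.coeff (p.2.2 + 1) (M p.1 p.2.1)

theorem freeLift_freeT {M : Matrix (Fin N) (Fin N) A⟦X⟧}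
    (hM : ∀ i j, PowerSeries.constantCoeff (M i j) = if i = j then 1 else 0) (i j : Fin N) (r : ℕ) :
    freeLift M (freeT N i j r) = PowerSeries.coeff r (M i j) := by
  rcases r with _ | r
  · rw [freeT, PowerSeries.coeff_zero_eq_constantCoeff_apply, hM]
    split_ifs <;> simp
  · simp [freeT, freeLift]

theorem map_freeLift {M : Matrix (Fin N) (Fin N) A⟦X⟧}
    (hM : ∀ i j, PowerSeries.constantCoeff (M i j) = if i = j then 1 else 0) :
    (freeMatrix N).map (PowerSeries.map (freeLift M : FreeGen N →+* A)) = M := by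
  ext i j r
  simp [coeff_freeMatrix, freeLift_freeT hM]

theorem map_map_series {C : Type*} [Ring C] [Algebra ℂ C] (σ : A →ₐ[ℂ] B) (τ : B →ₐ[ℂ] C)
    (f : A⟦X⟧) : PowerSeries.map (τ : B →+* C) (PowerSeries.map (σ : A →+* B) f) =
      PowerSeries.map ((τ.comp σ : A →ₐ[ℂ] C) : A →+* C) f := by
  ext n
  simp

namespace ExtYangianO

theorem isExtYangianMatrix (N : ℕ) : IsExtYangianMatrix (T N) where
  constantCoeff_eq i j := by
    rw [T, Matrix.map_apply, ← PowerSeries.coeff_zero_eq_constantCoeff_apply,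
      PowerSeries.coeff_map, PowerSeries.coeff_zero_eq_constantCoeff_apply,
      constantCoeff_freeMatrix]
    split_ifs <;> simp
  rtt := by
    ext a b s r
    rw [T, ← map₂_rttLeft, ← map₂_rttRight, coeff_coeff_map₂, coeff_coeff_map₂]
    exact RingQuot.mkAlgHom_rel ℂ (RttRel.mk a b r s)

/-- The homomorphism from the extended Yangian given by a matrix satisfying its relations. -/
def lift {M : Matrix (Fin N) (Fin N) A⟦X⟧} (hM : IsExtYangianMatrix M) : ExtYangianO N →ₐ[ℂ] A :=
  RingQuot.liftAlgHom ℂ ⟨freeLift M, by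
    rintro _ _ ⟨a, b, r, s⟩
    rw [← coeff_coeff_map₂, ← coeff_coeff_map₂, map₂_rttLeft, map₂_rttRight,
      map_freeLift hM.constantCoeff_eq, hM.rtt]⟩

theorem lift_proj {M : Matrix (Fin N) (Fin N) A⟦X⟧} (hM : IsExtYangianMatrix M) (x : FreeGen N) :
    lift hM (proj N x) = freeLift M x :=
  RingQuot.liftAlgHom_mkAlgHom_apply _ _ _ _

theorem map_lift {M : Matrix (Fin N) (Fin N) A⟦X⟧} (hM : IsExtYangianMatrix M) (i j : Fin N) :
    PowerSeries.map (lift hM : ExtYangianO N →+* A) (T N i j) = M i j := by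
  ext r
  simp [T, lift_proj, coeff_freeMatrix, freeLift_freeT hM.constantCoeff_eq]

theorem hom_ext {σ τ : ExtYangianO N →ₐ[ℂ] A}
    (h : ∀ i j, PowerSeries.map (σ : ExtYangianO N →+* A) (T N i j) =
      PowerSeries.map (τ : ExtYangianO N →+* A) (T N i j)) : σ = τ := by
  refine RingQuot.ringQuot_ext' (s := RttRel N) ℂ σ τ (FreeAlgebra.hom_ext ?_)
  ext ⟨i, j, r⟩
  have := congrArg (PowerSeries.coeff (r + 1)) (h i j)
  simp only [T, Matrix.map_apply, PowerSeries.coeff_map, coeff_freeMatrix] at this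
  exact this

end ExtYangianO

/-- Boundary coefficients impose no condition: the constant terms of M are scalars, so commutators
involving them vanish. -/
theorem gl_relation_iff {M : Matrix (Fin N) (Fin N) A⟦X⟧}
    (hM : ∀ i j, PowerSeries.constantCoeff (M i j) = if i = j then 1 else 0) (i j k l : Fin N) :
    (invUVDiff : ℂ⟦X⟧⟦X⟧) • (serU (M i j) * serV (M k l) - serV (M k l) * serU (M i j)) =
      (invUV : ℂ⟦X⟧⟦X⟧) • (serU (M k j) * serV (M i l) - serV (M k j) * serU (M i l)) ↔ ∀ r s,
    ⁅PowerSeries.coeff (r + 1) (M i j), PowerSeries.coeff s (M k l)⁆ -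
      ⁅PowerSeries.coeff r (M i j), PowerSeries.coeff (s + 1) (M k l)⁆ =
    PowerSeries.coeff r (M k j) * PowerSeries.coeff s (M i l) -
      PowerSeries.coeff s (M k j) * PowerSeries.coeff r (M i l) := by
  have h0 (i j : Fin N) : PowerSeries.coeff 0 (M i j) = if i = j then 1 else 0 := by
    simpa using hM i j
  rw [relation_iff_coeff_coeff]
  · simp only [map_sub, coeff_coeff_serU_mul_serV, coeff_coeff_serV_mul_serU, Ring.lie_def]
  · rw [map_sub, coeff_serU_mul, coeff_mul_serU, coeff_serV, h0]
    split_ifs <;> simp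
  · rw [map_sub, coeffU_serU_mul_serV, coeffU_serV_mul_serU, h0]
    split_ifs <;> simp

namespace YangianGL

theorem isGLMatrix (N : ℕ) : IsGLMatrix (T N) := by
  have h0 (i j : Fin N) : PowerSeries.constantCoeff (T N i j) = if i = j then 1 else 0 := by
    rw [T, Matrix.map_apply, ← PowerSeries.coeff_zero_eq_constantCoeff_apply,
      PowerSeries.coeff_map, PowerSeries.coeff_zero_eq_constantCoeff_apply,
      constantCoeff_freeMatrix]
    split_ifs <;> simp
  refine ⟨h0, fun i j k l => (gl_relation_iff h0 i j k l).2 fun r s => ?_⟩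
  have h := RingQuot.mkAlgHom_rel ℂ (GlRel.mk i j k l r s)
  simp only [Ring.lie_def, map_sub, map_mul] at h
  simp only [T, Matrix.map_apply, PowerSeries.coeff_map, coeff_freeMatrix, Ring.lie_def]
  exact h

/-- The homomorphism from the Yangian of `gl_N` given by a matrix satisfying its relations. -/
def lift {M : Matrix (Fin N) (Fin N) A⟦X⟧} (hM : IsGLMatrix M) : YangianGL N →ₐ[ℂ] A :=
  RingQuot.liftAlgHom ℂ ⟨freeLift M, by
    rintro _ _ ⟨i, j, k, l, r, s⟩
    have h := (gl_relation_iff hM.constantCoeff_eq i j k l).1 (hM.relation i j k l) r s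
    simp only [Ring.lie_def] at h
    simp only [Ring.lie_def, map_sub, map_mul, freeLift_freeT hM.constantCoeff_eq, h]⟩

theorem lift_proj {M : Matrix (Fin N) (Fin N) A⟦X⟧} (hM : IsGLMatrix M) (x : FreeGen N) :
    lift hM (proj N x) = freeLift M x :=
  RingQuot.liftAlgHom_mkAlgHom_apply _ _ _ _

theorem map_lift {M : Matrix (Fin N) (Fin N) A⟦X⟧} (hM : IsGLMatrix M) (i j : Fin N) :
    PowerSeries.map (lift hM : YangianGL N →+* A) (T N i j) = M i j := by
  ext r
  simp [T, lift_proj, coeff_freeMatrix, freeLift_freeT hM.constantCoeff_eq]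

theorem hom_ext {σ τ : YangianGL N →ₐ[ℂ] A}
    (h : ∀ i j, PowerSeries.map (σ : YangianGL N →+* A) (T N i j) =
      PowerSeries.map (τ : YangianGL N →+* A) (T N i j)) : σ = τ := by
  refine RingQuot.ringQuot_ext' (s := GlRel N) ℂ σ τ (FreeAlgebra.hom_ext ?_)
  ext ⟨i, j, r⟩
  have := congrArg (PowerSeries.coeff (r + 1)) (h i j)
  simp only [T, Matrix.map_apply, PowerSeries.coeff_map, coeff_freeMatrix] at this
  exact this

end YangianGL

end Presentations

/-! ### The isomorphism and its restriction to fixed subalgebras -/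

section FusionIsomorphism

theorem fusedOp_apply (p q j l : Fin 2) : fusedOp (p, q) (j, l) =
    (2⁻¹ : ℂ) • (aff 2 0 (YangianGL.T 2 p j) * aff 2 1 (YangianGL.T 2 q l) +
      aff 2 0 (YangianGL.T 2 q j) * aff 2 1 (YangianGL.T 2 p l)) := by
  rw [fusedOp, mul_assoc, Matrix.mul_apply, Fintype.sum_prod_type]
  simp only [kronecker_mul_kronecker_apply, Matrix.smul_apply, Matrix.add_apply, Matrix.one_apply,
    permOp_apply, Matrix.map_apply, ← aff_apply, Prod.mk.injEq]
  fin_cases p <;> fin_cases q <;> simp [smul_add, add_mul, Fin.sum_univ_two]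
  abel

/-- No relation of the Yangian is needed: the operator is applied to symmetric vectors only, and
(1/√2)² = 1/2 accounts for the normalization of (1 + P)/2. -/
theorem isFusedMatrix_fusedMatrix : IsFusedMatrix (fusedMatrix (YangianGL.T 2)) := by
  rw [IsFusedMatrix]
  have hs : sqrtTwo⁻¹ * sqrtTwo⁻¹ = 2⁻¹ := by rw [← mul_inv, sqrtTwo_mul_self]
  have hs' : ((Real.sqrt 2 : ℝ) : ℂ)⁻¹ = sqrtTwo⁻¹ := rfl
  ext1 ⟨p, q⟩ a
  rw [Matrix.mul_apply, Matrix.mul_apply, Fintype.sum_prod_type]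
  simp only [fusedOp_apply, symEmb, Matrix.of_apply, Algebra.algebraMap_eq_smul_one, smul_mul_assoc,
    mul_smul_comm, one_mul, mul_one, Fin.sum_univ_two, Fin.sum_univ_three, fusedMatrix, fuseMatrix,
    fuseEntry, Matrix.map_apply, symVec, hs']
  fin_cases p <;> fin_cases q <;> fin_cases a <;>
    simp [symPart, basisNorm, smul_smul, hs] <;> module

/-- The fusion homomorphism `X(o_3) → Y(gl_2)`. -/
def fusionHom : ExtYangianO 3 →ₐ[ℂ] YangianGL 2 :=
  ExtYangianO.lift (YangianGL.isGLMatrix 2).isExtYangianMatrix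

theorem map_fusionHom (i j : Fin 3) :
    PowerSeries.map (fusionHom : ExtYangianO 3 →+* YangianGL 2) (ExtYangianO.T 3 i j) =
      fusedMatrix (YangianGL.T 2) i j :=
  ExtYangianO.map_lift _ i j

theorem map_fused {A B : Type*} [Ring A] [Algebra ℂ A] [Ring B] [Algebra ℂ B] (σ : A →ₐ[ℂ] B)
    (f : A⟦X⟧) : PowerSeries.map (σ : A →+* B) (fused f) =
      fused (PowerSeries.map (σ : A →+* B) f) := by
  rw [fused, map_mul, map_aff, map_aff, fused]

theorem constantCoeff_map {A B : Type*} [Ring A] [Algebra ℂ A] [Ring B] [Algebra ℂ B]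
    (σ : A →ₐ[ℂ] B) {f : A⟦X⟧} (hf : PowerSeries.constantCoeff f = 1) :
    PowerSeries.constantCoeff (PowerSeries.map (σ : A →+* B) f) = 1 := by
  rw [← PowerSeries.coeff_zero_eq_constantCoeff_apply, PowerSeries.coeff_map,
    PowerSeries.coeff_zero_eq_constantCoeff_apply, hf, map_one]

theorem map_id_series {A : Type*} [Ring A] [Algebra ℂ A] (f : A⟦X⟧) :
    PowerSeries.map ((AlgHom.id ℂ A : A →ₐ[ℂ] A) : A →+* A) f = f := by
  ext n
  simp

theorem coeff_one_of_map {A B : Type*} [Ring A] [Algebra ℂ A] [Ring B] [Algebra ℂ B]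
    (σ : A →ₐ[ℂ] B) {f : A⟦X⟧} {g : B⟦X⟧} (h : PowerSeries.map (σ : A →+* B) f = g) :
    σ (PowerSeries.coeff 1 f) = PowerSeries.coeff 1 g := by
  rw [← h, PowerSeries.coeff_map]
  rfl

theorem fusionHom_coeff_one_zero_one :
    fusionHom (PowerSeries.coeff 1 (ExtYangianO.T 3 0 1)) =
      sqrtTwo⁻¹ • PowerSeries.coeff 1 (YangianGL.T 2 0 1) := by
  rw [coeff_one_of_map _ (map_fusionHom 0 1),
    (YangianGL.isGLMatrix 2).coeff_one_fusedMatrix_zero_one]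

theorem fusionHom_coeff_one_one_zero :
    fusionHom (PowerSeries.coeff 1 (ExtYangianO.T 3 1 0)) =
      sqrtTwo⁻¹ • PowerSeries.coeff 1 (YangianGL.T 2 1 0) := by
  rw [coeff_one_of_map _ (map_fusionHom 1 0),
    (YangianGL.isGLMatrix 2).coeff_one_fusedMatrix_one_zero]

/-- The inverse sends T° to the matrix built from the Gauss data found in `X(o_3)`. By `map_eq` with
g = 1, each composite only has to be checked on the first entry and on two level-one generators,
where the scalars √2 and 1/√2 cancel. -/
theorem exists_inverse : ∃ ψ : YangianGL 2 →ₐ[ℂ] ExtYangianO 3,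
    ψ.comp fusionHom = AlgHom.id ℂ _ ∧ fusionHom.comp ψ = AlgHom.id ℂ _ := by
  have hT := ExtYangianO.isExtYangianMatrix 3
  have ht := YangianGL.isGLMatrix 2
  obtain ⟨a, E, F, K, H, hfa, hE, hF⟩ := hT.exists_gaussData
  let ψ : YangianGL 2 →ₐ[ℂ] ExtYangianO 3 := YangianGL.lift H.isGLMatrix
  have hψ (i j : Fin 2) : PowerSeries.map (ψ : YangianGL 2 →+* ExtYangianO 3) (YangianGL.T 2 i j) =
      gaussMatrix a E F K i j := YangianGL.map_lift _ i j
  have hψb : ψ (PowerSeries.coeff 1 (YangianGL.T 2 0 1)) =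
      sqrtTwo • PowerSeries.coeff 1 (ExtYangianO.T 3 0 1) := by
    rw [coeff_one_of_map _ (hψ 0 1), ← hE]
    exact H.coeff_one_b
  have hψc : ψ (PowerSeries.coeff 1 (YangianGL.T 2 1 0)) =
      sqrtTwo • PowerSeries.coeff 1 (ExtYangianO.T 3 1 0) := by
    rw [coeff_one_of_map _ (hψ 1 0), ← hF]
    exact H.coeff_one_c
  have hψa : PowerSeries.map (ψ : YangianGL 2 →+* ExtYangianO 3) (YangianGL.T 2 0 0) = a := hψ 0 0
  refine ⟨ψ, ExtYangianO.hom_ext fun i j => ?_, YangianGL.hom_ext fun i j => ?_⟩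
  · rw [map_id_series]
    refine (hT.map_eq hT _ (fun y => by rw [one_mul, mul_one]) ?_ ?_ ?_ i j).trans (one_mul _)
    · rw [← map_map_series, map_fusionHom, fusedMatrix_zero_zero, map_fused, hψa, hfa, one_mul]
    · rw [AlgHom.comp_apply, fusionHom_coeff_one_zero_one, map_smul, hψb, smul_smul,
        inv_mul_cancel₀ sqrtTwo_ne_zero, one_smul]
    · rw [AlgHom.comp_apply, fusionHom_coeff_one_one_zero, map_smul, hψc, smul_smul,
        inv_mul_cancel₀ sqrtTwo_ne_zero, one_smul]
  · rw [map_id_series]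
    refine (ht.map_eq ht _ (fun y => by rw [one_mul, mul_one]) ?_ ?_ ?_ i j).trans (one_mul _)
    · rw [← map_map_series, hψa, one_mul]
      -- The image of a is known only through a(2u) a(2u+1); uniqueness of the square root
      -- identifies it with the first entry of T°.
      refine fused_injective (constantCoeff_map _ H.const_a) (ht.constantCoeff_eq 0 0) ?_
      rw [← map_fused, hfa, map_fusionHom, fusedMatrix_zero_zero]
    · rw [AlgHom.comp_apply, hψb, map_smul, fusionHom_coeff_one_zero_one, smul_smul,
        mul_inv_cancel₀ sqrtTwo_ne_zero, one_smul]
    · rw [AlgHom.comp_apply, hψc, map_smul, fusionHom_coeff_one_one_zero, smul_smul,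
        mul_inv_cancel₀ sqrtTwo_ne_zero, one_smul]

/-- The fusion isomorphism `X(o_3) → Y(gl_2)`. -/
def fusionEquiv : ExtYangianO 3 ≃ₐ[ℂ] YangianGL 2 :=
  AlgEquiv.ofAlgHom fusionHom exists_inverse.choose exists_inverse.choose_spec.2
    exists_inverse.choose_spec.1

theorem fusionEquiv_apply (x : ExtYangianO 3) : fusionEquiv x = fusionHom x := rfl

theorem map_fusionHom_injective : Function.Injective
    (PowerSeries.map (fusionHom : ExtYangianO 3 →+* YangianGL 2)) := by
  intro f g h
  ext n
  have := congrArg (PowerSeries.coeff n) h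
  rw [PowerSeries.coeff_map, PowerSeries.coeff_map] at this
  exact fusionEquiv.injective this

theorem map_scalarSeries {A B : Type*} [Ring A] [Algebra ℂ A] [Ring B] [Algebra ℂ B]
    (σ : A →ₐ[ℂ] B) (f : ℂ⟦X⟧) : PowerSeries.map (σ : A →+* B) (scalarSeries f) = scalarSeries f := by
  ext n
  simp [scalarSeries]

theorem scalarSeries_mul_comm {A : Type*} [Ring A] [Algebra ℂ A] (f : ℂ⟦X⟧) (y : A⟦X⟧) :
    scalarSeries f * y = y * scalarSeries f := (scalarSeries_commute f y).eq

theorem fused_scalarSeries_mul {A : Type*} [Ring A] [Algebra ℂ A] (g : ℂ⟦X⟧) (y : A⟦X⟧) :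
    fused (scalarSeries g * y) = scalarSeries (fused g) * fused y := by
  rw [fused, map_mul, map_mul, aff_scalarSeries, aff_scalarSeries, fused, map_mul, fused]
  rw [mul_assoc, mul_assoc, ← mul_assoc (aff 2 0 y), ← scalarSeries_mul_comm, mul_assoc]

theorem constantCoeff_fused {A : Type*} [Ring A] [Algebra ℂ A] {g : A⟦X⟧}
    (hg : PowerSeries.constantCoeff g = 1) : PowerSeries.constantCoeff (fused g) = 1 := by
  rw [fused, map_mul, constantCoeff_aff, constantCoeff_aff, hg, one_mul]

theorem coeff_one_scalarSeries_mul {A : Type*} [Ring A] [Algebra ℂ A] {g : ℂ⟦X⟧}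
    (hg : PowerSeries.constantCoeff g = 1) {y : A⟦X⟧} (hy : PowerSeries.constantCoeff y = 0) :
    PowerSeries.coeff 1 (scalarSeries g * y) = PowerSeries.coeff 1 y := by
  rw [coeff_one_mul_eq, hy, mul_zero, zero_add, scalarSeries,
    ← PowerSeries.coeff_zero_eq_constantCoeff_apply, PowerSeries.coeff_map,
    PowerSeries.coeff_zero_eq_constantCoeff_apply, hg, map_one, one_mul]

theorem mem_multInvariants {A : Type*} [Ring A] [Algebra ℂ A] {N : ℕ}
    {T : Matrix (Fin N) (Fin N) A⟦X⟧} {a : A} :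
    a ∈ multInvariants T ↔ ∀ (f : ℂ⟦X⟧) (σ : A ≃ₐ[ℂ] A), PowerSeries.constantCoeff f = 1 →
      (∀ i j, PowerSeries.map (σ : A →+* A) (T i j) = scalarSeries f * T i j) → σ a = a :=
  Iff.rfl

/-- Transported through the isomorphism, multiplication of T° by g becomes multiplication of T by
g(2u) g(2u+1), so x is fixed by it. -/
theorem fusionHom_mem_yangianSL {x : ExtYangianO 3} (hx : x ∈ YangianO 3) :
    fusionHom x ∈ YangianSL 2 := by
  have hT := ExtYangianO.isExtYangianMatrix 3
  have ht := YangianGL.isGLMatrix 2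
  refine mem_multInvariants.2 fun g τ hg hτ => ?_
  have h := mem_multInvariants.1 hx (fused g) ((fusionEquiv.trans τ).trans fusionEquiv.symm)
    (constantCoeff_fused hg) (fun i j => map_fusionHom_injective ?_)
  · have := congrArg fusionEquiv h
    simpa [fusionEquiv_apply] using this
  · have hc (F : (ExtYangianO 3)⟦X⟧) :
        PowerSeries.map (fusionHom : ExtYangianO 3 →+* YangianGL 2)
          (PowerSeries.map (((fusionEquiv.trans τ).trans fusionEquiv.symm :
            ExtYangianO 3 ≃ₐ[ℂ] ExtYangianO 3) : ExtYangianO 3 →+* ExtYangianO 3) F) =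
        PowerSeries.map (((τ : YangianGL 2 →ₐ[ℂ] YangianGL 2)) : YangianGL 2 →+* YangianGL 2)
          (PowerSeries.map (fusionHom : ExtYangianO 3 →+* YangianGL 2) F) := by
      ext n
      simp only [PowerSeries.coeff_map]
      exact fusionEquiv.apply_symm_apply _
    have hτ' (i j : Fin 2) : PowerSeries.map ((τ : YangianGL 2 →ₐ[ℂ] YangianGL 2) :
        YangianGL 2 →+* YangianGL 2) (YangianGL.T 2 i j) = scalarSeries g * YangianGL.T 2 i j :=
      hτ i j
    rw [hc, map_mul, map_scalarSeries, map_fusionHom]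
    refine ht.isExtYangianMatrix.map_eq ht.isExtYangianMatrix _ (scalarSeries_mul_comm _)
      ?_ ?_ ?_ i j
    · rw [fusedMatrix_zero_zero, map_fused, hτ', fused_scalarSeries_mul]
    · rw [ht.coeff_one_fusedMatrix_zero_one, map_smul, coeff_one_of_map _ (hτ' 0 1),
        coeff_one_scalarSeries_mul hg (ht.constantCoeff_eq 0 1)]
    · rw [ht.coeff_one_fusedMatrix_one_zero, map_smul, coeff_one_of_map _ (hτ' 1 0),
        coeff_one_scalarSeries_mul hg (ht.constantCoeff_eq 1 0)]

/-- Conversely, multiplication by f on `X(o_3)` is transported to multiplication by the g with g(2u)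
g(2u+1) = f(u). On the first entry this again uses uniqueness of the square root. -/
theorem mem_yangianO_of_fusionHom {x : ExtYangianO 3} (hx : fusionHom x ∈ YangianSL 2) :
    x ∈ YangianO 3 := by
  have hT := ExtYangianO.isExtYangianMatrix 3
  have ht := YangianGL.isGLMatrix 2
  refine mem_multInvariants.2 fun f σ hf hσ => ?_
  obtain ⟨g, hg, rfl⟩ := exists_fused_eq f hf
  have h := mem_multInvariants.1 hx g ((fusionEquiv.symm.trans σ).trans fusionEquiv) hg
    (fun i j => ?_)
  · apply fusionEquiv.injective
    simpa [← fusionEquiv_apply] using h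
  · let τ : YangianGL 2 →ₐ[ℂ] YangianGL 2 :=
      ((fusionEquiv.symm.trans σ).trans fusionEquiv : YangianGL 2 ≃ₐ[ℂ] YangianGL 2)
    have hτ (x : ExtYangianO 3) : τ (fusionHom x) = fusionHom (σ x) :=
      congrArg (fun y => fusionHom (σ y)) (fusionEquiv.symm_apply_apply x)
    have hc (F : (ExtYangianO 3)⟦X⟧) : PowerSeries.map (τ : YangianGL 2 →+* YangianGL 2)
          (PowerSeries.map (fusionHom : ExtYangianO 3 →+* YangianGL 2) F) =
        PowerSeries.map (fusionHom : ExtYangianO 3 →+* YangianGL 2)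
          (PowerSeries.map (σ : ExtYangianO 3 →+* ExtYangianO 3) F) := by
      ext n
      simp only [PowerSeries.coeff_map]
      exact hτ _
    have hσ1 (i j : Fin 3) (hij : i ≠ j) : σ (PowerSeries.coeff 1 (ExtYangianO.T 3 i j)) =
        PowerSeries.coeff 1 (ExtYangianO.T 3 i j) := by
      have h1 : σ (PowerSeries.coeff 1 (ExtYangianO.T 3 i j)) = _ :=
        coeff_one_of_map (σ : ExtYangianO 3 →ₐ[ℂ] ExtYangianO 3) (hσ i j)
      rw [h1, coeff_one_scalarSeries_mul hf ((hT.constantCoeff_eq i j).trans (if_neg hij))]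
    refine ht.map_eq ht τ (scalarSeries_mul_comm _) ?_ ?_ ?_ i j
    · refine fused_injective (constantCoeff_map _ (ht.constantCoeff_eq 0 0)) ?_ ?_
      · rw [map_mul, ht.constantCoeff_eq, if_pos rfl, mul_one, scalarSeries,
          ← PowerSeries.coeff_zero_eq_constantCoeff_apply, PowerSeries.coeff_map,
          PowerSeries.coeff_zero_eq_constantCoeff_apply, hg, map_one]
      · rw [← map_fused, ← fusedMatrix_zero_zero, ← map_fusionHom, hc, hσ, map_mul,
          map_scalarSeries, map_fusionHom, fusedMatrix_zero_zero, fused_scalarSeries_mul]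
    · have h := hτ (PowerSeries.coeff 1 (ExtYangianO.T 3 0 1))
      rw [hσ1 0 1 (by decide), fusionHom_coeff_one_zero_one, map_smul] at h
      exact smul_right_injective _ (inv_ne_zero sqrtTwo_ne_zero) h
    · have h := hτ (PowerSeries.coeff 1 (ExtYangianO.T 3 1 0))
      rw [hσ1 1 0 (by decide), fusionHom_coeff_one_one_zero, map_smul] at h
      exact smul_right_injective _ (inv_ne_zero sqrtTwo_ne_zero) h

theorem map_yangianO : (YangianO 3).map (fusionEquiv : ExtYangianO 3 →ₐ[ℂ] YangianGL 2) =
    YangianSL 2 := by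
  ext y
  rw [Subalgebra.mem_map]
  constructor
  · rintro ⟨x, hx, rfl⟩
    exact fusionHom_mem_yangianSL hx
  · intro hy
    refine ⟨fusionEquiv.symm y, mem_yangianO_of_fusionHom ?_, fusionEquiv.apply_symm_apply y⟩
    rwa [← fusionEquiv_apply, AlgEquiv.apply_symm_apply]

end FusionIsomorphism

end LowRankYangian

end

theorem corollary4p6 :
    ∃ φ : LowRankYangian.ExtYangianO 3 ≃ₐ[ℂ] LowRankYangian.YangianGL 2,
      LowRankYangian.IsFusedMatrix
        ((LowRankYangian.ExtYangianO.T 3).map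
          (PowerSeries.map
            (φ : LowRankYangian.ExtYangianO 3 →+* LowRankYangian.YangianGL 2))) ∧
      ∃ ψ : LowRankYangian.YangianO 3 ≃ₐ[ℂ] LowRankYangian.YangianSL 2,
        ∀ y : LowRankYangian.YangianO 3,
          (ψ y : LowRankYangian.YangianGL 2) = φ (y : LowRankYangian.ExtYangianO 3) := by
  refine ⟨LowRankYangian.fusionEquiv, ?_,
    (LowRankYangian.fusionEquiv.subalgebraMap (LowRankYangian.YangianO 3)).trans
      (Subalgebra.equivOfEq _ _ LowRankYangian.map_yangianO), fun y => rfl⟩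
  have h : (LowRankYangian.ExtYangianO.T 3).map (PowerSeries.map
      (LowRankYangian.fusionEquiv : LowRankYangian.ExtYangianO 3 →+* LowRankYangian.YangianGL 2)) =
      LowRankYangian.fusedMatrix (LowRankYangian.YangianGL.T 2) := by
    ext1 i j
    exact LowRankYangian.map_fusionHom i j
  rw [h]
  exact LowRankYangian.isFusedMatrix_fusedMatrix
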